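/- **Setting.** An RBM with $n$ visible and $n_H$ hidden units has parameters $W\in\mathbb R^{n\times n_H}$, $b^{(1)}\in\mathbb R^n$, $b^{(2)}\in\mathbb R^{n_H}$ and the joint law $\Pr(X=x,H=h)\propto\exp(\langle x,Wh\rangle+\langle b^{(1)},x\rangle+\langle b^{(2)},h\rangle)$ on $\{\pm1\}^n\times\{\pm1\}^{n_H}$; its distribution $P$ is the law of $X$. It is $(\lambda_1,\lambda_2)$-bounded if $\sum_j|\tanh W_{ij}|+|b^{(1)}_i|\le\lambda_1$ for all $i$ and $\sum_i|W_{ij}|\le\lambda_2$ for all $j$. The Markov blanket (two-hop neighborhood) $\mathcal N(i)$ is the minimal $S\not\ni i$ such that $X_i$ is conditionally independent of all other $X_j$ given $X_S$. Nodes $i,j$ are $\eta$-nondegenerate if the conditional mutual information (in nats) satisfies $I(X_i;X_j\mid X_{\sim\{i,j\}})\ge\eta$. Write $x_S=\prod_{i\in S}x_i$. **Algorithm** (input: i.i.d. samples $X^{(1)},\dots,X^{(m)}$ from $P$, parameters $\lambda_1,\lambda_2,\eta$, a degree $D$). 1. *Structure.* Let $R=\lambda_1\sqrt{D+1}\,(4e)^{D+1}(1+\lambda_2)^{D+1}$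 and $\ell(v,y)=\log(1+e^{-2vy})$. For $A\not\ni i$ let $L_i(A)$ be the minimum of the empirical loss $\frac1m\sum_k\ell\big(\sum_{S}w_SX^{(k)}_S,\,X^{(k)}_i\big)$ over coefficient vectors $w$ indexed by $S\subseteq A$, $|S|\le D$, with $\|w\|_1\le R$. For $j\neq i$ put $j\in\widehat{\mathcal N}(i)$ iff $L_i([n]\setminus\{i,j\})-L_i([n]\setminus\{i\})\ge\frac34\eta$ or the same holds with $i,j$ interchanged. 2. *Distribution.* Let $\hat f_i(x)=\widehat{\mathbb E}[X_i\mid X_{\widehat{\mathcal N}(i)}=x_{\widehat{\mathcal N}(i)}]$ be the empirical conditional expectation. For every $S$ with $S\subseteq\widehat{\mathcal N}(i)\cup\{i\}$ for some $i$, let $\hat w_S=\frac1{|S|}\sum_{i\in S}\mathbb E_{X\sim \mathrm{Uni}(\{\pm1\}^n)}[\tanh^{-1}(\hat f_i(X))X_{S\setminus i}]$ (the empty set may be ignored). Output $\hat P(x)\propto\exp(\sum_S\hat w_Sx_S)$. **Theorem.** There are universal constants $c,C>0$ and $K\in\mathbb N$ such that the following holds. Consider a $(\lambda_1,\lambda_2)$-bounded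 RBM with $\lambda_2\ge2$, and let $\Lambda$ satisfy $\sum_j|W_{ij}|+|b^{(1)}_i|\le\Lambda$ for every visible unit $i$ (so one may take $\Lambda=\lambda_1$ if $\lambda_1$ bounds the actual $\ell_1$ norm into the visible units). Let $\eta>0$ and suppose that for every $i$ and every $j\in\mathcal N(i)$ the nodes $i,j$ are $\eta$-nondegenerate, and that $|\mathcal N(i)|\le d_2$ for every $i$. Let $0<\epsilon\le1$, let $\delta>0$ with $2\delta\le n$ (for $n\ge2$ this includes every $\delta\le 1$), and let $D=\lceil c\,\lambda_2\log(\lambda_1\lambda_2/\eta)\rceil$ (read as $0$ if this is negative or if $\lambda_1=0$). If $$m\ \ge\ C\left(\lambda_2^{K D}\log\frac{2n}{\delta}+n^2\Big(\frac{2}{1-\tanh\Lambda}\Big)^{d_2+1}\frac{\log(n/\delta)}{\epsilon^4}\right),$$ then with probability at least $1-\delta$ over $m$ i.i.d. samples of $X$: the algorithm recovers the structure, $\widehat{\mathcal N}(i)=\mathcal N(i)$ for all $i$; all coefficients $\hat w_S$ are well defined (every conditioning event occurs in the samples and $|\hat f_i|<1$); and the output satisfies $\mathrm{TV}(\hat P,P)\le\epsilon$.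 -/

import Mathlib

open Real Finset

noncomputable section

/-! ### Spin configurations and distributions on the hypercube -/

/-- The hypercube `{±1}ⁿ`. -/
abbrev Config (n : ℕ) := Fin n → ℤˣ

/-- The value of spin `i` as a real number. -/
def spin {n : ℕ} (x : Config n) (i : Fin n) : ℝ := ((x i : ℤ) : ℝ)

/-- The monomial `x_S = ∏_{i ∈ S} x_i`. -/
def chi {n : ℕ} (S : Finset (Fin n)) (x : Config n) : ℝ := ∏ i ∈ S, spin x i

/-- Two configurations agree on the coordinates in `A`. -/
abbrev Agree {n : ℕ} (A : Finset (Fin n)) (x y : Config n) : Prop := ∀ a ∈ A, y a = x a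

/-- The marginal probability `P(X_A = x_A)`. -/
def marg {n : ℕ} (P : Config n → ℝ) (A : Finset (Fin n)) (x : Config n) : ℝ :=
  ∑ y : Config n, if Agree A x y then P y else 0

/-- Total variation distance of two probability mass functions. -/
def tvDist {n : ℕ} (P Q : Config n → ℝ) : ℝ := (1 / 2) * ∑ x, |P x - Q x|

/-- Probability of the event `E` when `m` samples are drawn independently from `P`. -/
def sampleProb {n : ℕ} (P : Config n → ℝ) (m : ℕ) (E : Set (Fin m → Config n)) : ℝ :=
  ∑ s : Fin m → Config n, E.indicator (fun s => ∏ k, P (s k)) s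

/-! ### Restricted Boltzmann machines -/

/-- Parameters of an RBM with `n` visible and `nh` hidden units. -/
structure RBM (n nh : ℕ) where
  /-- the weight matrix -/
  W : Fin n → Fin nh → ℝ
  /-- external fields of the visible units -/
  b1 : Fin n → ℝ
  /-- external fields of the hidden units -/
  b2 : Fin nh → ℝ

namespace RBM

variable {n nh : ℕ}

/-- `⟨x, W h⟩ + ⟨b⁽¹⁾, x⟩ + ⟨b⁽²⁾, h⟩`. -/
def potential (M : RBM n nh) (x : Config n) (h : Config nh) : ℝ :=
  (∑ i, ∑ j, spin x i * M.W i j * spin h j) + (∑ i, M.b1 i * spin x i) + ∑ j, M.b2 j * spin h j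

/-- The joint law of visible and hidden units. -/
def jointProb (M : RBM n nh) (x : Config n) (h : Config nh) : ℝ :=
  exp (M.potential x h) / ∑ x' : Config n, ∑ h' : Config nh, exp (M.potential x' h')

/-- The distribution of the RBM: the marginal law of the visible units. -/
def law (M : RBM n nh) (x : Config n) : ℝ := ∑ h : Config nh, M.jointProb x h

/-- `(lam1, lam2)`-boundedness. -/
def IsBounded (M : RBM n nh) (lam1 lam2 : ℝ) : Prop :=
  (∀ i, (∑ j, |tanh (M.W i j)|) + |M.b1 i| ≤ lam1) ∧ (∀ j, ∑ i, |M.W i j| ≤ lam2)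

end RBM

/-! ### Markov blankets and nondegeneracy -/

/-- `i ∉ S`, and under `P` the spin `X_i` is conditionally independent of all spins outside
`S ∪ {i}` given `X_S`: `P(x) P(x_S) = P(x_{S ∪ i}) P(x_{∼i})`. -/
def Separates {n : ℕ} (P : Config n → ℝ) (i : Fin n) (S : Finset (Fin n)) : Prop :=
  i ∉ S ∧ ∀ x : Config n,
    P x * marg P S x = marg P (insert i S) x * marg P (univ.erase i) x

/-- `S` is the Markov blanket (two-hop neighborhood) of node `i`: a minimal set which separates
`i` from all other nodes. -/
def IsMarkovBlanket {n : ℕ} (P : Config n → ℝ) (i : Fin n) (S : Finset (Fin n)) : Prop :=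
  Minimal (Separates P i) S

/-- The conditional mutual information `I(X_i; X_j | X_{∼{i,j}})` in nats. -/
def condMutualInfo {n : ℕ} (P : Config n → ℝ) (i j : Fin n) : ℝ :=
  ∑ x : Config n, P x *
    log ((P x * marg P ((univ.erase i).erase j) x) /
      (marg P (univ.erase j) x * marg P (univ.erase i) x))

/-- `i, j` are `eta`-nondegenerate neighbors. -/
def Nondegenerate {n : ℕ} (P : Config n → ℝ) (eta : ℝ) (i j : Fin n) : Prop :=
  eta ≤ condMutualInfo P i j ∨ eta ≤ condMutualInfo P j i

/-! ### Structure recovery by `ℓ¹`-constrained logistic regression -/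

/-- The logistic loss `ℓ(v, y) = log (1 + e^{-2vy})`. -/
def logisticLoss (v y : ℝ) : ℝ := log (1 + exp (-2 * v * y))

/-- Indices of the monomials of degree at most `D` in the variables `X_A`. -/
def features {n : ℕ} (A : Finset (Fin n)) (D : ℕ) : Finset (Finset (Fin n)) :=
  A.powerset.filter (fun S => S.card ≤ D)

/-- Empirical logistic loss of predicting `X_i` by the polynomial in `X_A` of degree at most `D`
with coefficient vector `w`. -/
def empLoss {n m : ℕ} (s : Fin m → Config n) (D : ℕ) (A : Finset (Fin n)) (i : Fin n)
    (w : Finset (Fin n) → ℝ) : ℝ :=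
  (1 / (m : ℝ)) * ∑ k, logisticLoss (∑ S ∈ features A D, w S * chi S (s k)) (spin (s k) i)

/-- The empirical loss achieved by degree-`D` regression of `X_i` on `X_A` with `ℓ¹`-constraint
`R`. -/
def regLoss {n m : ℕ} (s : Fin m → Config n) (D : ℕ) (R : ℝ) (A : Finset (Fin n))
    (i : Fin n) : ℝ :=
  sInf (empLoss s D A i '' {w | ∑ S ∈ features A D, |w S| ≤ R})

/-- The increase of the loss in predicting `X_i` when `X_j` is removed from the predictors. -/
def lossIncrease {n m : ℕ} (s : Fin m → Config n) (D : ℕ) (R : ℝ) (i j : Fin n) : ℝ :=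
  regLoss s D R ((univ.erase i).erase j) i - regLoss s D R (univ.erase i) i

/-- The `ℓ¹`-radius used in the regressions of degree `D`. -/
def regRadius (lam1 lam2 : ℝ) (D : ℕ) : ℝ :=
  lam1 * sqrt ((D : ℝ) + 1) * (4 * exp 1) ^ (D + 1) * (1 + lam2) ^ (D + 1)

open Classical in
/-- The recovered neighborhood of `i`: all `j ≠ i` for which the regression test, run in both
directions with threshold `3 eta / 4`, rejects the hypothesis that `i, j` are not neighbors. -/
def recoveredNbhd {n m : ℕ} (s : Fin m → Config n) (lam1 lam2 eta : ℝ) (D : ℕ) (i : Fin n) :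
    Finset (Fin n) :=
  (univ.erase i).filter (fun j =>
    3 * eta / 4 ≤ lossIncrease s D (regRadius lam1 lam2 D) i j ∨
      3 * eta / 4 ≤ lossIncrease s D (regRadius lam1 lam2 D) j i)

/-! ### The distribution-recovery algorithms -/

/-- The coefficient `E_{X ∼ Uni}[tanh⁻¹(f_i(X)) X_{S∖i}]`. -/
def nodeCoeff {n : ℕ} (f : Fin n → Config n → ℝ) (S : Finset (Fin n)) (i : Fin n) : ℝ :=
  (1 / (2 : ℝ) ^ n) * ∑ x : Config n, artanh (f i x) * chi (S.erase i) x

/-- The MRF coefficient of `S`: the average of the node coefficients over `i ∈ S`. -/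
def mrfCoeff {n : ℕ} (f : Fin n → Config n → ℝ) (S : Finset (Fin n)) : ℝ :=
  (1 / (S.card : ℝ)) * ∑ i ∈ S, nodeCoeff f S i

/-- The sets consisting of (some of) a node and its neighborhood, which carry the coefficients of
the recovered MRF. -/
def mrfSets {n : ℕ} (N : Fin n → Finset (Fin n)) : Finset (Finset (Fin n)) :=
  univ.filter (fun S => ∃ i, S ⊆ insert i (N i))

/-- The unnormalized pmf of the recovered MRF. -/
def mrfWeight {n : ℕ} (N : Fin n → Finset (Fin n)) (f : Fin n → Config n → ℝ)
    (x : Config n) : ℝ :=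
  exp (∑ S ∈ mrfSets N, mrfCoeff f S * chi S x)

/-- Algorithm DistributionFromPredictors: the MRF built from predictors `f i` of `X_i` that depend
on the coordinates in `N i`. -/
def distributionFromPredictors {n : ℕ} (N : Fin n → Finset (Fin n))
    (f : Fin n → Config n → ℝ) (x : Config n) : ℝ :=
  mrfWeight N f x / ∑ y : Config n, mrfWeight N f y

/-- The number of samples that agree with `x` on `A`. -/
def sampleCount {n m : ℕ} (s : Fin m → Config n) (A : Finset (Fin n)) (x : Config n) : ℕ :=
  (univ.filter (fun k => Agree A x (s k))).card

/-- The empirical conditional expectation of `X_i` given `X_A = x_A`. -/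
def empCondExp {n m : ℕ} (s : Fin m → Config n) (A : Finset (Fin n)) (i : Fin n)
    (x : Config n) : ℝ :=
  (∑ k ∈ univ.filter (fun k => Agree A x (s k)), spin (s k) i) / (sampleCount s A x : ℝ)

/-- Every quantity that DistributionFromStructure evaluates is defined: each conditioning event
is observed in the samples, and no empirical conditional expectation equals `±1`. -/
def WellDefinedRun {n m : ℕ} (s : Fin m → Config n) (N : Fin n → Finset (Fin n)) : Prop :=
  ∀ i x, 0 < sampleCount s (N i) x ∧ |empCondExp s (N i) i x| < 1

/-- Algorithm DistributionFromStructure, run on samples `s` and neighborhoods `N`. -/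
def distributionFromStructure {n m : ℕ} (s : Fin m → Config n) (N : Fin n → Finset (Fin n)) :
    Config n → ℝ :=
  distributionFromPredictors N (fun i => empCondExp s (N i) i)

/-! ### Parameters -/

/-- The degree `D = O(lam2 log (lam1 lam2 / eta))`, with implied constant `c`. -/
def regDegree (c lam1 lam2 eta : ℝ) : ℕ := ⌈c * lam2 * log (lam1 * lam2 / eta)⌉₊

end

noncomputable section

/-! ### Spins, flips and marginals -/

section Hypercube

variable {n : ℕ}

theorem spin_eq_one_or (x : Config n) (i : Fin n) : spin x i = 1 ∨ spin x i = -1 := by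
  rcases Int.units_eq_one_or (x i) with h | h <;> simp [spin, h]

theorem spin_mul_self (x : Config n) (i : Fin n) : spin x i * spin x i = 1 := by
  rcases spin_eq_one_or x i with h | h <;> simp [h]

theorem abs_spin (x : Config n) (i : Fin n) : |spin x i| = 1 := by
  rcases spin_eq_one_or x i with h | h <;> simp [h]

theorem spin_congr {x y : Config n} {i : Fin n} (h : y i = x i) : spin y i = spin x i := by
  simp [spin, h]

theorem abs_chi (S : Finset (Fin n)) (x : Config n) : |chi S x| = 1 := by
  simp [chi, Finset.abs_prod, abs_spin]

theorem chi_congr {S A : Finset (Fin n)} (hS : S ⊆ A) {x y : Config n} (h : Agree A x y) :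
    chi S y = chi S x :=
  Finset.prod_congr rfl fun i hi => spin_congr (h i (hS hi))

/-- The configuration with spin `i` reversed. -/
def flipAt (i : Fin n) (x : Config n) : Config n := Function.update x i (-x i)

theorem flipAt_flipAt (i : Fin n) (x : Config n) : flipAt i (flipAt i x) = x := by
  simp [flipAt]

theorem spin_flipAt_self (i : Fin n) (x : Config n) : spin (flipAt i x) i = -spin x i := by
  simp [spin, flipAt]

theorem flipAt_apply_ne {i j : Fin n} (h : j ≠ i) (x : Config n) : flipAt i x j = x j := by
  simp [flipAt, h]

theorem spin_flipAt_ne {i j : Fin n} (h : j ≠ i) (x : Config n) :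
    spin (flipAt i x) j = spin x j := spin_congr (flipAt_apply_ne h x)

theorem agree_flipAt {A : Finset (Fin n)} {i : Fin n} (h : i ∉ A) (x : Config n) :
    Agree A x (flipAt i x) :=
  fun a ha => flipAt_apply_ne (by rintro rfl; exact h ha) x

theorem sum_flipAt (i : Fin n) (F : Config n → ℝ) : ∑ x, F (flipAt i x) = ∑ x, F x :=
  Equiv.sum_comp (Function.Involutive.toPerm (flipAt i) (flipAt_flipAt i)) F

theorem sum_eq_half_sum_add_flipAt (i : Fin n) (F : Config n → ℝ) :
    ∑ x, F x = (∑ x, (F x + F (flipAt i x))) / 2 := by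
  rw [Finset.sum_add_distrib, sum_flipAt]; ring

theorem update_one_or (i : Fin n) (x : Config n) :
    (spin x i = 1 ∧ Function.update x i 1 = x ∧ Function.update x i (-1) = flipAt i x) ∨
    (spin x i = -1 ∧ Function.update x i 1 = flipAt i x ∧ Function.update x i (-1) = x) := by
  rcases Int.units_eq_one_or (x i) with h | h
  · left
    refine ⟨by simp [spin, h], ?_, ?_⟩
    · rw [← h]; simp
    · simp [flipAt, h]
  · right
    refine ⟨by simp [spin, h], ?_, ?_⟩
    · simp [flipAt, h]
    · rw [← h]; simp

theorem Agree.symm {A : Finset (Fin n)} {x y : Config n} (h : Agree A x y) : Agree A y x :=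
  fun a ha => (h a ha).symm

theorem marg_congr (P : Config n → ℝ) {A : Finset (Fin n)} {x y : Config n} (h : Agree A x y) :
    marg P A y = marg P A x := by
  unfold marg
  refine Finset.sum_congr rfl fun z _ => ?_
  have : Agree A y z ↔ Agree A x z :=
    ⟨fun hz a ha => (hz a ha).trans (h a ha), fun hz a ha => (hz a ha).trans (h a ha).symm⟩
  exact if_congr this rfl rfl

theorem marg_pos {P : Config n → ℝ} (hP : ∀ x, 0 < P x) (A : Finset (Fin n)) (x : Config n) :
    0 < marg P A x := by
  unfold marg
  refine Finset.sum_pos' (fun y _ => ?_) ⟨x, Finset.mem_univ _, ?_⟩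
  · split_ifs
    exacts [(hP y).le, le_rfl]
  · rw [if_pos fun a _ => rfl]
    exact hP x

theorem marg_univ (P : Config n → ℝ) (x : Config n) : marg P univ x = P x := by
  unfold marg
  rw [Finset.sum_eq_single x]
  · simp
  · intro y _ hy
    rw [if_neg]
    intro h
    exact hy (funext fun a => h a (Finset.mem_univ a))
  · simp

theorem agree_insert_or {A : Finset (Fin n)} {i : Fin n} (hi : i ∉ A) (x y : Config n) :
    (Agree A x y ↔ Agree (insert i A) x y ∨ Agree (insert i A) (flipAt i x) y) ∧
      ¬ (Agree (insert i A) x y ∧ Agree (insert i A) (flipAt i x) y) := by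
  have hA : (∀ a ∈ A, y a = flipAt i x a) ↔ ∀ a ∈ A, y a = x a := by
    refine forall₂_congr fun a ha => ?_
    rw [flipAt_apply_ne (by rintro rfl; exact hi ha)]
  have h2 : y i = x i ∨ y i = -x i := by
    rcases Int.units_eq_one_or (x i) with h | h <;>
    rcases Int.units_eq_one_or (y i) with h' | h' <;> simp [h, h']
  have h3 : ¬ (y i = x i ∧ y i = -x i) := by
    rcases Int.units_eq_one_or (x i) with h | h <;>
    rcases Int.units_eq_one_or (y i) with h' | h' <;> simp [h, h']
  have h4 : flipAt i x i = - x i := by simp [flipAt]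
  simp only [Agree, Finset.forall_mem_insert, hA, h4]
  tauto

theorem marg_eq_add (P : Config n → ℝ) {A : Finset (Fin n)} {i : Fin n} (hi : i ∉ A)
    (x : Config n) :
    marg P A x = marg P (insert i A) x + marg P (insert i A) (flipAt i x) := by
  unfold marg
  rw [← Finset.sum_add_distrib]
  refine Finset.sum_congr rfl fun y _ => ?_
  obtain ⟨h1, h2⟩ := agree_insert_or hi x y
  rw [if_congr h1 rfl rfl]
  by_cases ha : Agree (insert i A) x y <;> by_cases hb : Agree (insert i A) (flipAt i x) y
  · exact absurd ⟨ha, hb⟩ h2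
  · rw [if_pos (Or.inl ha), if_pos ha, if_neg hb, add_zero]
  · rw [if_pos (Or.inr hb), if_neg ha, if_pos hb, zero_add]
  · rw [if_neg (by tauto), if_neg ha, if_neg hb, zero_add]

/-- Summing a function of the coordinates in `B` against `P` or against its marginal on `B` gives
the same value up to a factor. -/
theorem exists_mul_sum_eq_sum_marg (P : Config n → ℝ) (B : Finset (Fin n)) :
    ∃ K : ℝ, 0 < K ∧ ∀ ψ : Config n → ℝ, (∀ x y, Agree B x y → ψ y = ψ x) →
      K * ∑ x, P x * ψ x = ∑ x, marg P B x * ψ x := by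
  refine ⟨∑ z : Config n, if ∀ a ∈ B, z a = 1 then 1 else 0, ?_, fun ψ hψ => ?_⟩
  · refine Finset.sum_pos' (fun y _ => ?_) ⟨1, Finset.mem_univ _, ?_⟩
    · split_ifs <;> norm_num
    · simp
  · have hK : ∀ y : Config n, (∑ z : Config n, if ∀ a ∈ B, z a = 1 then (1 : ℝ) else 0) =
        ∑ x : Config n, if Agree B x y then (1 : ℝ) else 0 := by
      intro y
      rw [← Equiv.sum_comp (Equiv.mulLeft y)]
      refine Finset.sum_congr rfl fun z _ => ?_
      have : (∀ a ∈ B, Equiv.mulLeft y z a = 1) ↔ Agree B z y := by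
        refine forall₂_congr fun a _ => ?_
        change y a * z a = 1 ↔ _
        rw [mul_eq_one_iff_eq_inv, Int.units_inv_eq_self]
      exact if_congr this rfl rfl
    unfold marg
    simp only [fun x => Finset.sum_mul univ (fun y => if Agree B x y then P y else 0) (ψ x)]
    rw [Finset.sum_comm, Finset.mul_sum]
    refine Finset.sum_congr rfl fun y _ => ?_
    rw [hK y, Finset.sum_mul]
    refine Finset.sum_congr rfl fun x _ => ?_
    split_ifs with h
    · rw [hψ x y h]; ring
    · ring

/-! ### Conditional log-odds -/

/-- Half the log-odds of `X_i` given `X_A = x_A`. -/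
def logit (P : Config n → ℝ) (A : Finset (Fin n)) (i : Fin n) (x : Config n) : ℝ :=
  (log (marg P (insert i A) (Function.update x i 1)) -
    log (marg P (insert i A) (Function.update x i (-1)))) / 2

theorem logit_eq (P : Config n → ℝ) (A : Finset (Fin n)) (i : Fin n) (x : Config n) :
    logit P A i x = spin x i *
      ((log (marg P (insert i A) x) - log (marg P (insert i A) (flipAt i x))) / 2) := by
  rcases update_one_or i x with ⟨h, h1, h2⟩ | ⟨h, h1, h2⟩ <;> rw [logit, h, h1, h2] <;> ring

theorem logit_congr (P : Config n → ℝ) {A : Finset (Fin n)} {i : Fin n}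
    {x y : Config n} (h : Agree A x y) : logit P A i y = logit P A i x := by
  unfold logit
  have : ∀ u : ℤˣ, Agree (insert i A) (Function.update x i u) (Function.update y i u) := by
    intro u a ha
    by_cases hai : a = i
    · subst hai; simp
    · simp only [Function.update_of_ne hai]
      exact h a ((Finset.mem_insert.1 ha).resolve_left hai)
  rw [marg_congr P (this 1), marg_congr P (this (-1))]

theorem logit_flipAt (P : Config n → ℝ) (A : Finset (Fin n)) (i : Fin n) (x : Config n) :
    logit P A i (flipAt i x) = logit P A i x := by
  simp [logit, flipAt]

theorem logisticLoss_logit {P : Config n → ℝ} (hP : ∀ x, 0 < P x) {A : Finset (Fin n)}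
    {i : Fin n} (hi : i ∉ A) (x : Config n) :
    logisticLoss (logit P A i x) (spin x i) =
      log (marg P A x) - log (marg P (insert i A) x) := by
  have ha := marg_pos hP (insert i A) x
  have hb := marg_pos hP (insert i A) (flipAt i x)
  have e : -2 * logit P A i x * spin x i =
      log (marg P (insert i A) (flipAt i x)) - log (marg P (insert i A) x) := by
    rw [logit_eq]
    linear_combination (-(log (marg P (insert i A) x) -
      log (marg P (insert i A) (flipAt i x)))) * spin_mul_self x i
  rw [logisticLoss, e, Real.exp_sub, Real.exp_log ha, Real.exp_log hb, marg_eq_add P hi x,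
    ← Real.log_div (by positivity) ha.ne']
  congr 1
  field_simp

theorem tanh_half_log_sub {a b : ℝ} (ha : 0 < a) (hb : 0 < b) :
    tanh ((log a - log b) / 2) = (a - b) / (a + b) := by
  have h1 : exp ((log a - log b) / 2) * exp ((log a - log b) / 2) = a / b := by
    rw [← Real.exp_add, add_halves, Real.exp_sub, Real.exp_log ha, Real.exp_log hb]
  have hE := Real.exp_pos ((log a - log b) / 2)
  rw [Real.tanh_eq_sinh_div_cosh, Real.sinh_eq, Real.cosh_eq, Real.exp_neg]
  set E := exp ((log a - log b) / 2)
  have h2 : a = b * (E * E) := by rw [h1]; field_simp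
  rw [h2]
  have : b * (E * E) + b ≠ 0 := by positivity
  field_simp

theorem tanh_logit_mul_marg {P : Config n → ℝ} (hP : ∀ x, 0 < P x) {A : Finset (Fin n)}
    {i : Fin n} (hi : i ∉ A) (x : Config n) :
    tanh (logit P A i x) * marg P A x =
      spin x i * (marg P (insert i A) x - marg P (insert i A) (flipAt i x)) := by
  have ha := marg_pos hP (insert i A) x
  have hb := marg_pos hP (insert i A) (flipAt i x)
  have h := tanh_half_log_sub ha hb
  rw [logit_eq, marg_eq_add P hi x]
  rcases spin_eq_one_or x i with hs | hs <;> rw [hs]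
  · rw [one_mul, h]; field_simp
  · rw [neg_one_mul, Real.tanh_neg, h]; field_simp

/-- The residual of the conditional expectation given `X_A` is orthogonal to functions of `X_A`. -/
theorem sum_residual_eq_zero {P : Config n → ℝ} (hP : ∀ x, 0 < P x) {A : Finset (Fin n)}
    {i : Fin n} (hi : i ∉ A) (φ : Config n → ℝ) (hφ : ∀ x y, Agree A x y → φ y = φ x) :
    ∑ x, P x * ((tanh (logit P A i x) - spin x i) * φ x) = 0 := by
  obtain ⟨K, hK, h⟩ := exists_mul_sum_eq_sum_marg P (insert i A)
  have h1 := h (fun x => (tanh (logit P A i x) - spin x i) * φ x) (by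
    intro x y hxy
    have hA : Agree A x y := fun a ha => hxy a (Finset.mem_insert_of_mem ha)
    simp only [logit_congr P hA, hφ x y hA, spin_congr (hxy i (Finset.mem_insert_self _ _))])
  have h2 : ∑ x, marg P (insert i A) x * ((tanh (logit P A i x) - spin x i) * φ x) = 0 := by
    rw [sum_eq_half_sum_add_flipAt i, Finset.sum_eq_zero, zero_div]
    intro x _
    rw [logit_flipAt, hφ _ _ (agree_flipAt hi x), spin_flipAt_self]
    have := tanh_logit_mul_marg hP hi x
    rw [marg_eq_add P hi x] at this
    linear_combination φ x * this
  rw [h2] at h1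
  exact (mul_eq_zero.1 h1).resolve_left hK.ne'

theorem marg_insert_le {P : Config n → ℝ} {F : ℝ} {i : Fin n}
    (h : ∀ x, P x ≤ F * P (flipAt i x)) {A : Finset (Fin n)} (hi : i ∉ A) (x : Config n) :
    marg P (insert i A) x ≤ F * marg P (insert i A) (flipAt i x) := by
  unfold marg
  rw [Finset.mul_sum, ← sum_flipAt i fun y => F * _]
  refine Finset.sum_le_sum fun y _ => ?_
  have : Agree (insert i A) (flipAt i x) (flipAt i y) ↔ Agree (insert i A) x y := by
    refine forall₂_congr fun a _ => ?_
    by_cases hai : a = i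
    · subst hai; simp [flipAt]
    · rw [flipAt_apply_ne hai, flipAt_apply_ne hai]
  rw [if_congr this rfl rfl]
  split_ifs
  · exact h y
  · simp

theorem logit_univ_erase (P : Config n → ℝ) (i : Fin n) (x : Config n) :
    logit P (univ.erase i) i x = spin x i * ((log (P x) - log (P (flipAt i x))) / 2) := by
  rw [logit_eq, Finset.insert_erase (Finset.mem_univ i), marg_univ, marg_univ]

theorem abs_logit_le {P : Config n → ℝ} (hP : ∀ x, 0 < P x) {F : ℝ} {i : Fin n}
    (h : ∀ x, |logit P (univ.erase i) i x| ≤ F) {A : Finset (Fin n)} (hi : i ∉ A)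
    (x : Config n) : |logit P A i x| ≤ F := by
  have h1 : ∀ x, P x ≤ exp (2 * F) * P (flipAt i x) := by
    intro x
    have := h x
    rw [logit_univ_erase, abs_mul, abs_spin, one_mul] at this
    have h2 := (abs_le.1 this).2
    rw [← Real.exp_log (hP x), ← Real.exp_log (hP (flipAt i x)), ← Real.exp_add]
    apply Real.exp_le_exp.2
    linarith
  have h3 : ∀ x, log (marg P (insert i A) x) - log (marg P (insert i A) (flipAt i x)) ≤ 2 * F := by
    intro x
    have := Real.log_le_log (marg_pos hP _ _) (marg_insert_le h1 hi x)
    rw [Real.log_mul (Real.exp_pos _).ne' (marg_pos hP _ _).ne', Real.log_exp] at this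
    linarith
  rw [logit_eq, abs_mul, abs_spin, one_mul, abs_le]
  have a := h3 x
  have b := h3 (flipAt i x)
  rw [flipAt_flipAt] at b
  constructor <;> linarith

/-- A separating set determines the conditional log-odds. -/
theorem logit_eq_of_separates {P : Config n → ℝ} (hP : ∀ x, 0 < P x) {i : Fin n}
    {S : Finset (Fin n)} (h : Separates P i S) (x : Config n) :
    logit P (univ.erase i) i x = logit P S i x := by
  obtain ⟨hi, h⟩ := h
  have key : ∀ y, log (P y) + log (marg P S y) =
      log (marg P (insert i S) y) + log (marg P (univ.erase i) y) := by
    intro y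
    rw [← Real.log_mul (hP y).ne' (marg_pos hP _ _).ne', h y,
      Real.log_mul (marg_pos hP _ _).ne' (marg_pos hP _ _).ne']
  have a := key x
  have b := key (flipAt i x)
  rw [marg_congr P (agree_flipAt hi x), marg_congr P (agree_flipAt (Finset.notMem_erase i univ) x)] at b
  rw [logit_univ_erase, logit_eq]
  have : log (P x) - log (P (flipAt i x)) =
    log (marg P (insert i S) x) - log (marg P (insert i S) (flipAt i x)) := by linarith
  rw [this]

theorem flipAt_comm (i j : Fin n) (x : Config n) :
    flipAt i (flipAt j x) = flipAt j (flipAt i x) := by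
  by_cases h : i = j
  · rw [h]
  · funext k
    by_cases h1 : k = i
    · subst h1; rw [flipAt_apply_ne h]; simp [flipAt, h]
    · rw [flipAt_apply_ne h1]
      by_cases h2 : k = j
      · subst h2; simp [flipAt, h1]
      · rw [flipAt_apply_ne h2, flipAt_apply_ne h2, flipAt_apply_ne h1]

/-- Pairwise independence given the rest is symmetric. -/
theorem logit_flipAt_symm {P : Config n → ℝ} {i j : Fin n} (hij : i ≠ j)
    (h : ∀ x, logit P (univ.erase i) i (flipAt j x) = logit P (univ.erase i) i x) (x : Config n) :
    logit P (univ.erase j) j (flipAt i x) = logit P (univ.erase j) j x := by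
  have := h x
  simp only [logit_univ_erase] at this ⊢
  rw [spin_flipAt_ne hij] at this
  rw [spin_flipAt_ne hij.symm, flipAt_comm j i]
  have hs : spin x i ≠ 0 := by
    intro h0; have := spin_mul_self x i; rw [h0] at this; simp at this
  have := mul_left_cancel₀ hs this
  congr 1
  rw [flipAt_comm i j] at this ⊢
  linear_combination this

end Hypercube

/-! ### Expectations over independent samples -/

section Sampling

variable {n m : ℕ} {P : Config n → ℝ}

/-- Expectation of `F` over `m` independent samples from `P`. -/
def sampleExp (P : Config n → ℝ) (m : ℕ) (F : (Fin m → Config n) → ℝ) : ℝ :=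
  ∑ s : Fin m → Config n, (∏ k, P (s k)) * F s

theorem sampleExp_mono (hP : ∀ x, 0 ≤ P x) {F G : (Fin m → Config n) → ℝ} (h : ∀ s, F s ≤ G s) :
    sampleExp P m F ≤ sampleExp P m G :=
  Finset.sum_le_sum fun s _ =>
    mul_le_mul_of_nonneg_left (h s) (Finset.prod_nonneg fun _ _ => hP _)

theorem sampleExp_sum {ι : Type*} (T : Finset ι) (F : ι → (Fin m → Config n) → ℝ) :
    sampleExp P m (fun s => ∑ a ∈ T, F a s) = ∑ a ∈ T, sampleExp P m (F a) := by
  unfold sampleExp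
  simp only [Finset.mul_sum]
  exact Finset.sum_comm

theorem sampleExp_const_mul (c : ℝ) (F : (Fin m → Config n) → ℝ) :
    sampleExp P m (fun s => c * F s) = c * sampleExp P m F := by
  unfold sampleExp
  rw [Finset.mul_sum]
  exact Finset.sum_congr rfl fun s _ => by ring

theorem sampleExp_add (F G : (Fin m → Config n) → ℝ) :
    sampleExp P m (fun s => F s + G s) = sampleExp P m F + sampleExp P m G := by
  unfold sampleExp
  rw [← Finset.sum_add_distrib]
  exact Finset.sum_congr rfl fun s _ => by ring

theorem sampleExp_prod (φ : Config n → ℝ) :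
    sampleExp P m (fun s => ∏ k, φ (s k)) = (∑ x, P x * φ x) ^ m := by
  unfold sampleExp
  simp only [← Finset.prod_mul_distrib]
  rw [Fintype.sum_pow (fun x => P x * φ x) m]

theorem sampleExp_exp_sum (Z : Config n → ℝ) :
    sampleExp P m (fun s => exp (∑ k, Z (s k))) = (∑ x, P x * exp (Z x)) ^ m := by
  simp only [Real.exp_sum]
  exact sampleExp_prod fun x => exp (Z x)

theorem sampleProb_eq (E : Set (Fin m → Config n)) :
    sampleProb P m E = sampleExp P m (E.indicator 1) := by
  unfold sampleProb sampleExp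
  refine Finset.sum_congr rfl fun s _ => ?_
  by_cases h : s ∈ E <;> simp [h]

theorem sampleProb_nonneg (hP : ∀ x, 0 ≤ P x) (E : Set (Fin m → Config n)) :
    0 ≤ sampleProb P m E :=
  Finset.sum_nonneg fun s _ =>
    Set.indicator_nonneg (fun _ _ => Finset.prod_nonneg fun _ _ => hP _) s

theorem sampleProb_mono (hP : ∀ x, 0 ≤ P x) {E G : Set (Fin m → Config n)} (h : E ⊆ G) :
    sampleProb P m E ≤ sampleProb P m G :=
  Finset.sum_le_sum fun _ _ =>
    Set.indicator_le_indicator_of_subset h (fun _ => Finset.prod_nonneg fun _ _ => hP _) _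

theorem sampleProb_univ (h1 : ∑ x, P x = 1) : sampleProb P m Set.univ = 1 := by
  have := sampleExp_prod (P := P) (m := m) (fun _ => 1)
  simpa [sampleProb_eq, sampleExp, h1] using this

theorem sampleProb_union_le (hP : ∀ x, 0 ≤ P x) (E G : Set (Fin m → Config n)) :
    sampleProb P m (E ∪ G) ≤ sampleProb P m E + sampleProb P m G := by
  rw [sampleProb_eq, sampleProb_eq, sampleProb_eq, ← sampleExp_add]
  refine sampleExp_mono hP fun s => ?_
  by_cases h : s ∈ E <;> by_cases h' : s ∈ G <;> simp [h, h']

theorem one_sub_sampleProb_compl_le (hP : ∀ x, 0 ≤ P x) (h1 : ∑ x, P x = 1)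
    (E : Set (Fin m → Config n)) : 1 - sampleProb P m Eᶜ ≤ sampleProb P m E := by
  have := sampleProb_union_le hP E Eᶜ
  rw [Set.union_compl_self, sampleProb_univ h1] at this
  linarith

theorem sampleProb_exists_le (hP : ∀ x, 0 ≤ P x) {ι : Type*} (T : Finset ι)
    (Q : ι → (Fin m → Config n) → Prop) {q : ℝ}
    (h : ∀ a ∈ T, sampleProb P m {s | Q a s} ≤ q) :
    sampleProb P m {s | ∃ a ∈ T, Q a s} ≤ T.card * q := by
  have h1 : sampleProb P m {s | ∃ a ∈ T, Q a s} ≤ ∑ a ∈ T, sampleProb P m {s | Q a s} := by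
    simp only [sampleProb_eq]
    rw [← sampleExp_sum]
    refine sampleExp_mono hP fun s => ?_
    have h0 : ∀ a ∈ T, (0 : ℝ) ≤ Set.indicator {s | Q a s} 1 s := fun a _ =>
      Set.indicator_nonneg (fun _ _ => zero_le_one) s
    by_cases hs : ∃ a ∈ T, Q a s
    · obtain ⟨a, ha, hq⟩ := hs
      rw [Set.indicator_of_mem (show s ∈ {s | ∃ a ∈ T, Q a s} from ⟨a, ha, hq⟩)]
      refine le_trans ?_ (Finset.single_le_sum h0 ha)
      rw [Set.indicator_of_mem (show s ∈ {s | Q a s} from hq)]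
    · rw [Set.indicator_of_notMem (show s ∉ {s | ∃ a ∈ T, Q a s} from hs)]
      exact Finset.sum_nonneg h0
  refine h1.trans ((Finset.sum_le_sum h).trans ?_)
  simp

theorem sampleProb_lt_le_div (hP : ∀ x, 0 ≤ P x) {F : (Fin m → Config n) → ℝ}
    (hF : ∀ s, 0 ≤ F s) {a : ℝ} (ha : 0 < a) :
    sampleProb P m {s | a < F s} ≤ sampleExp P m F / a := by
  rw [sampleProb_eq, le_div_iff₀ ha, mul_comm, ← sampleExp_const_mul]
  refine sampleExp_mono hP fun s => ?_
  by_cases h : a < F s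
  · rw [Set.indicator_of_mem (show s ∈ {s | a < F s} from h)]; simpa using h.le
  · rw [Set.indicator_of_notMem (show s ∉ {s | a < F s} from h)]; simpa using hF s

/-! ### Hoeffding's inequality -/

theorem exp_mul_le_cosh_add {z : ℝ} (hz : |z| ≤ 1) (l : ℝ) :
    exp (l * z) ≤ cosh l + z * sinh l := by
  have hz := abs_le.1 hz
  have := convexOn_exp.2 (Set.mem_univ l) (Set.mem_univ (-l))
    (show 0 ≤ (1 + z) / 2 by linarith) (show 0 ≤ (1 - z) / 2 by linarith) (by ring)
  simp only [smul_eq_mul] at this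
  rw [Real.cosh_eq, Real.sinh_eq]
  calc exp (l * z) = exp ((1 + z) / 2 * l + (1 - z) / 2 * -l) := by congr 1; ring
    _ ≤ _ := this
    _ = _ := by ring

theorem sum_mul_exp_le (hP : ∀ x, 0 ≤ P x) (h1 : ∑ x, P x = 1) {Z : Config n → ℝ}
    (hZ : ∀ x, |Z x| ≤ 1) (h0 : ∑ x, P x * Z x = 0) (l : ℝ) :
    ∑ x, P x * exp (l * Z x) ≤ exp (l ^ 2 / 2) := by
  calc ∑ x, P x * exp (l * Z x) ≤ ∑ x, P x * (cosh l + Z x * sinh l) :=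
        Finset.sum_le_sum fun x _ =>
          mul_le_mul_of_nonneg_left (exp_mul_le_cosh_add (hZ x) l) (hP x)
    _ = (∑ x, P x) * cosh l + (∑ x, P x * Z x) * sinh l := by
        rw [Finset.sum_mul, Finset.sum_mul, ← Finset.sum_add_distrib]
        exact Finset.sum_congr rfl fun x _ => by ring
    _ = cosh l := by rw [h1, h0]; ring
    _ ≤ _ := Real.cosh_le_exp_half_sq l

theorem sampleProb_sum_gt_le (hP : ∀ x, 0 ≤ P x) (h1 : ∑ x, P x = 1) {Z : Config n → ℝ}
    (hZ : ∀ x, |Z x| ≤ 1) (h0 : ∑ x, P x * Z x = 0) (t : ℝ) (ht : 0 ≤ t) :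
    sampleProb P m {s | m * t < ∑ k, Z (s k)} ≤ exp (-(m * t ^ 2 / 2)) := by
  rcases ht.eq_or_lt with h | h
  · subst h
    have := sampleProb_mono (m := m) hP (Set.subset_univ {s | (m : ℝ) * 0 < ∑ k, Z (s k)})
    rw [sampleProb_univ h1] at this
    simpa using this
  · refine (sampleProb_mono hP (G := {s | exp (t * (m * t)) < exp (∑ k, t * Z (s k))}) ?_).trans ?_
    · intro s hs
      refine Real.exp_lt_exp.2 ?_
      rw [← Finset.mul_sum]
      exact mul_lt_mul_of_pos_left hs h
    · refine (sampleProb_lt_le_div hP (fun s => (Real.exp_pos _).le) (Real.exp_pos _)).trans ?_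
      rw [sampleExp_exp_sum (fun x => t * Z x), div_le_iff₀ (Real.exp_pos _), ← Real.exp_add]
      refine (pow_le_pow_left₀ (Finset.sum_nonneg fun x _ =>
        mul_nonneg (hP x) (Real.exp_pos _).le) (sum_mul_exp_le hP h1 hZ h0 t) m).trans ?_
      rw [← Real.exp_nat_mul]
      exact Real.exp_le_exp.2 (by ring_nf; rfl)

/-- Hoeffding's inequality for the mean of a bounded centered function of the samples. -/
theorem sampleProb_abs_mean_gt_le (hP : ∀ x, 0 ≤ P x) (h1 : ∑ x, P x = 1) (hm : 0 < m)
    {Z : Config n → ℝ} {B : ℝ} (hZ : ∀ x, |Z x| ≤ B) (h0 : ∑ x, P x * Z x = 0)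
    {t : ℝ} (ht : 0 ≤ t) :
    sampleProb P m {s | B * t < |1 / (m : ℝ) * ∑ k, Z (s k)|} ≤ 2 * exp (-(m * t ^ 2 / 2)) := by
  have hm' : (0 : ℝ) < m := by exact_mod_cast hm
  have hB : 0 ≤ B := by
    by_contra hB
    push Not at hB
    have hn : ∀ x : Config n, False := fun x => by linarith [hZ x, abs_nonneg (Z x)]
    have : ∑ x, P x = 0 := Finset.sum_eq_zero fun x _ => (hn x).elim
    linarith
  rcases hB.eq_or_lt with hB0 | hB0
  · have hz : ∀ x, Z x = 0 := fun x => by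
      have := hZ x; rw [← hB0] at this; exact abs_nonpos_iff.1 this
    have : {s : Fin m → Config n | B * t < |1 / (m : ℝ) * ∑ k, Z (s k)|} = ∅ := by
      ext s; simp [hz, ← hB0]
    rw [this]
    have : sampleProb P m ∅ = 0 := by simp [sampleProb]
    rw [this]
    positivity
  · have hsub : {s : Fin m → Config n | B * t < |1 / (m : ℝ) * ∑ k, Z (s k)|} ⊆
        {s | m * t < ∑ k, Z (s k) / B} ∪ {s | m * t < ∑ k, -(Z (s k) / B)} := by
      intro s hs
      have hs' : B * t < |1 / (m : ℝ) * ∑ k, Z (s k)| := hs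
      rw [Set.mem_union, Set.mem_ofPred_eq, Set.mem_ofPred_eq, Finset.sum_neg_distrib,
        ← Finset.sum_div, lt_neg, ← lt_abs.trans (or_congr Iff.rfl lt_neg)]
      rw [abs_mul, abs_of_pos (by positivity : 0 < 1 / (m : ℝ)), one_div, ← div_eq_inv_mul,
        lt_div_iff₀ hm'] at hs'
      rw [abs_div, abs_of_pos hB0, lt_div_iff₀ hB0]
      linarith
    have hZ' : ∀ x, |Z x / B| ≤ 1 := fun x => by
      rw [abs_div, abs_of_pos hB0, div_le_one hB0]; exact hZ x
    have h0' : ∑ x, P x * (Z x / B) = 0 := by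
      simp only [← mul_div_assoc, ← Finset.sum_div, h0, zero_div]
    have a := sampleProb_sum_gt_le (m := m) hP h1 hZ' h0' t ht
    have b := sampleProb_sum_gt_le (m := m) hP h1 (Z := fun x => -(Z x / B))
      (fun x => by rw [abs_neg]; exact hZ' x)
      (by simp only [mul_neg, Finset.sum_neg_distrib, h0', neg_zero]) t ht
    linarith [sampleProb_mono hP hsub, sampleProb_union_le hP
      {s : Fin m → Config n | m * t < ∑ k, Z (s k) / B} {s | m * t < ∑ k, -(Z (s k) / B)}]

/-! ### Concentration of sample counts -/

theorem sampleCount_eq_sum (s : Fin m → Config n) (B : Finset (Fin n)) (x : Config n) :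
    (sampleCount s B x : ℝ) = ∑ k, if Agree B x (s k) then (1 : ℝ) else 0 := by
  unfold sampleCount
  rw [Finset.sum_boole]

/-- The relative deviation of a sample count from its expectation. -/
def countDev (P : Config n → ℝ) {m : ℕ} (s : Fin m → Config n) (B : Finset (Fin n))
    (x : Config n) : ℝ :=
  sampleCount s B x / (m * marg P B x) - 1

theorem sampleExp_exp_countDev_le (hP : ∀ x, 0 < P x) (h1 : ∑ x, P x = 1) (hm : 0 < m)
    (B : Finset (Fin n)) (x : Config n) {l : ℝ} (hl : |l| ≤ m * marg P B x) :
    sampleExp P m (fun s => exp (l * countDev P s B x)) ≤ exp (l ^ 2 / (m * marg P B x)) := by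
  have hm' : (0 : ℝ) < m := by exact_mod_cast hm
  set p := marg P B x with hp
  have hp0 : 0 < p := marg_pos hP B x
  set u := l / (m * p) with hu
  have hu1 : |u| ≤ 1 := by
    rw [hu, abs_div, abs_of_pos (by positivity : 0 < m * p), div_le_one (by positivity)]
    exact hl
  have e1 : ∀ s : Fin m → Config n, exp (l * countDev P s B x) =
      exp (-l) * exp (∑ k, (fun y => u * if Agree B x y then (1 : ℝ) else 0) (s k)) := by
    intro s
    rw [← Real.exp_add, ← Finset.mul_sum, ← sampleCount_eq_sum, countDev, ← hp, hu]
    congr 1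
    field_simp
    ring
  simp only [e1]
  rw [sampleExp_const_mul, sampleExp_exp_sum fun y => u * if Agree B x y then (1 : ℝ) else 0]
  have e2 : ∑ y, P y * exp (u * if Agree B x y then (1 : ℝ) else 0) = 1 + p * (exp u - 1) := by
    have : ∀ y, P y * exp (u * if Agree B x y then (1 : ℝ) else 0) =
        P y + (if Agree B x y then P y else 0) * (exp u - 1) := by
      intro y; split_ifs <;> simp; ring
    simp only [this]
    rw [Finset.sum_add_distrib, h1, ← Finset.sum_mul, hp, marg]
  rw [e2]
  have hexp : exp u - 1 ≤ u + u ^ 2 := by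
    have := (abs_le.1 (Real.abs_exp_sub_one_sub_id_le hu1)).2
    linarith
  have h3 : 1 + p * (exp u - 1) ≤ exp (p * (u + u ^ 2)) := by
    have := Real.add_one_le_exp (p * (u + u ^ 2))
    nlinarith
  have h4 : 0 ≤ 1 + p * (exp u - 1) := by
    rw [← e2]
    exact Finset.sum_nonneg fun y _ => mul_nonneg (hP y).le (Real.exp_pos _).le
  refine (mul_le_mul_of_nonneg_left (pow_le_pow_left₀ h4 h3 m) (Real.exp_pos _).le).trans ?_
  rw [← Real.exp_nat_mul, ← Real.exp_add]
  apply Real.exp_le_exp.2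
  rw [hu]
  apply le_of_eq
  field_simp
  ring

theorem sampleExp_exp_abs_countDev_le (hP : ∀ x, 0 < P x) (h1 : ∑ x, P x = 1) (hm : 0 < m)
    (B : Finset (Fin n)) (x : Config n) {l : ℝ} (hl0 : 0 ≤ l) (hl : l ≤ m * marg P B x) :
    sampleExp P m (fun s => exp (l * |countDev P s B x|)) ≤
      2 * exp (l ^ 2 / (m * marg P B x)) := by
  have a := sampleExp_exp_countDev_le hP h1 hm B x (l := l) (by rwa [abs_of_nonneg hl0])
  have b := sampleExp_exp_countDev_le hP h1 hm B x (l := -l) (by rwa [abs_neg, abs_of_nonneg hl0])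
  have c : sampleExp P m (fun s => exp (l * |countDev P s B x|)) ≤
      sampleExp P m (fun s => exp (l * countDev P s B x) + exp (-l * countDev P s B x)) := by
    refine sampleExp_mono (fun x => (hP x).le) fun s => ?_
    rcases abs_cases (countDev P s B x) with ⟨h, _⟩ | ⟨h, _⟩ <;> rw [h]
    · linarith [Real.exp_pos (-l * countDev P s B x)]
    · rw [mul_neg, ← neg_mul]
      linarith [Real.exp_pos (l * countDev P s B x)]
  rw [sampleExp_add] at c
  rw [neg_sq] at b
  linarith

theorem sampleProb_abs_countDev_gt_le (hP : ∀ x, 0 < P x) (h1 : ∑ x, P x = 1) (hm : 0 < m)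
    (B : Finset (Fin n)) (x : Config n) :
    sampleProb P m {s | 1 / 2 < |countDev P s B x|} ≤ 2 * exp (-(m * marg P B x / 16)) := by
  have hm' : (0 : ℝ) < m := by exact_mod_cast hm
  have hp := marg_pos hP B x
  have hq : 0 < m * marg P B x := by positivity
  set q := m * marg P B x
  have a := sampleExp_exp_abs_countDev_le hP h1 hm B x (l := q / 4) (by positivity)
    (by change q / 4 ≤ q; linarith)
  change _ ≤ 2 * exp ((q / 4) ^ 2 / q) at a
  refine (sampleProb_mono (fun x => (hP x).le)
    (G := {s | exp (q / 8) < exp (q / 4 * |countDev P s B x|)}) ?_).trans ?_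
  · intro s hs
    have hs' : 1 / 2 < |countDev P s B x| := hs
    refine Real.exp_lt_exp.2 ?_
    nlinarith
  · refine (sampleProb_lt_le_div (fun x => (hP x).le) (fun s => (Real.exp_pos _).le)
      (Real.exp_pos _)).trans ?_
    rw [div_le_iff₀ (Real.exp_pos _), mul_assoc, ← Real.exp_add]
    have e : -(q / 16) + q / 8 = (q / 4) ^ 2 / q := by field_simp; ring
    rw [e]
    exact a

end Sampling

/-! ### The logistic loss -/

section Logistic

/-- The entropy in nats of a spin with mean `tanh v`. -/
def spinEntropy (v : ℝ) : ℝ := log (2 * cosh v) - v * tanh v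

theorem log_two_mul_cosh (v : ℝ) : log (2 * cosh v) = log 2 + log (cosh v) :=
  Real.log_mul two_ne_zero (Real.cosh_pos v).ne'

theorem logisticLoss_eq {y : ℝ} (hy : y = 1 ∨ y = -1) (v : ℝ) :
    logisticLoss v y = log (2 * cosh v) - v * y := by
  have h : ∀ u : ℝ, log (1 + exp (-2 * u)) = log (2 * cosh u) - u := by
    intro u
    have : 2 * cosh u = exp u * (1 + exp (-2 * u)) := by
      rw [Real.cosh_eq, mul_add, ← Real.exp_add, mul_one]; ring_nf
    rw [this, Real.log_mul (Real.exp_pos _).ne' (by positivity), Real.log_exp]; ring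
  unfold logisticLoss
  rcases hy with rfl | rfl
  · rw [mul_one, h, mul_one]
  · have := h (-v)
    rw [Real.cosh_neg] at this
    rw [show -2 * v * -1 = -2 * -v by ring, this]; ring

theorem logisticLoss_nonneg (v y : ℝ) : 0 ≤ logisticLoss v y :=
  Real.log_nonneg (by linarith [Real.exp_pos (-2 * v * y)])

/-- `log cosh` lies above its tangents. -/
theorem log_cosh_tangent_le (f v : ℝ) : log (cosh f) + tanh f * (v - f) ≤ log (cosh v) := by
  have hf := Real.cosh_pos f
  rw [← Real.log_exp (tanh f * (v - f)), ← Real.log_mul hf.ne' (Real.exp_pos _).ne']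
  refine Real.log_le_log (mul_pos hf (Real.exp_pos _)) ?_
  have hp : 0 ≤ exp f / (2 * cosh f) := by positivity
  have hq : 0 ≤ exp (-f) / (2 * cosh f) := by positivity
  have hpq : exp f / (2 * cosh f) + exp (-f) / (2 * cosh f) = 1 := by
    rw [← add_div, div_eq_one_iff_eq (by positivity), Real.cosh_eq]; ring
  have := convexOn_exp.2 (Set.mem_univ (v - f)) (Set.mem_univ (-(v - f))) hp hq hpq
  simp only [smul_eq_mul] at this
  have e : exp f / (2 * cosh f) * (v - f) + exp (-f) / (2 * cosh f) * -(v - f) =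
      tanh f * (v - f) := by
    rw [Real.tanh_eq_sinh_div_cosh, Real.sinh_eq]; field_simp; ring
  rw [e] at this
  calc cosh f * exp (tanh f * (v - f)) ≤ _ := mul_le_mul_of_nonneg_left this hf.le
    _ = cosh v := by
      have h1 : exp f * exp (v - f) = exp v := by rw [← Real.exp_add]; ring_nf
      have h2 : exp (-f) * exp (-(v - f)) = exp (-v) := by rw [← Real.exp_add]; ring_nf
      rw [Real.cosh_eq v, ← h1, ← h2]
      field_simp

theorem abs_tanh_le_one (v : ℝ) : |tanh v| ≤ 1 :=
  abs_le.2 ⟨(Real.neg_one_lt_tanh v).le, (Real.tanh_lt_one v).le⟩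

theorem log_cosh_sub_le (v f : ℝ) : log (cosh v) - log (cosh f) ≤ |v - f| := by
  have h1 := log_cosh_tangent_le v f
  have h2 : |tanh v * (v - f)| ≤ |v - f| := by
    rw [abs_mul]; exact mul_le_of_le_one_left (abs_nonneg _) (abs_tanh_le_one v)
  have := (abs_le.1 h2).2
  linarith

theorem log_cosh_nonneg (v : ℝ) : 0 ≤ log (cosh v) := Real.log_nonneg (Real.one_le_cosh v)

theorem spinEntropy_le (v : ℝ) : spinEntropy v ≤ log 2 := by
  have := log_cosh_tangent_le v 0
  rw [Real.cosh_zero, Real.log_one] at this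
  rw [spinEntropy, log_two_mul_cosh]
  linarith

theorem le_spinEntropy (v : ℝ) : log 2 - |v| ≤ spinEntropy v := by
  have h : |v * tanh v| ≤ |v| := by
    rw [abs_mul]; exact mul_le_of_le_one_right (abs_nonneg _) (abs_tanh_le_one v)
  rw [spinEntropy, log_two_mul_cosh]
  linarith [(abs_le.1 h).2, log_cosh_nonneg v]

theorem spinEntropy_nonneg (v : ℝ) : 0 ≤ spinEntropy v := by
  have h : |v * tanh v| ≤ |v| := by
    rw [abs_mul]; exact mul_le_of_le_one_right (abs_nonneg _) (abs_tanh_le_one v)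
  have h2 : |v| ≤ log (2 * cosh v) := by
    rw [← Real.cosh_abs, ← Real.log_exp |v|]
    refine Real.log_le_log (Real.exp_pos _) ?_
    rw [Real.log_exp, Real.cosh_eq]
    linarith [Real.exp_pos (-|v|)]
  rw [spinEntropy]
  linarith [(abs_le.1 h).2]

theorem abs_tanh_sub_le (a b : ℝ) : |tanh a - tanh b| ≤ |a - b| := by
  wlog h : b ≤ a generalizing a b
  · rw [abs_sub_comm, abs_sub_comm a]; exact this b a (le_of_not_ge h)
  have hd : ∀ x, HasDerivAt tanh (1 - tanh x ^ 2) x := by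
    intro x
    have h1 := (Real.hasDerivAt_sinh x).div (Real.hasDerivAt_cosh x) (Real.cosh_pos x).ne'
    have h2 : tanh = sinh / cosh := funext Real.tanh_eq_sinh_div_cosh
    have h3 := (Real.cosh_pos x).ne'
    rw [h2]
    refine h1.congr_deriv ?_
    rw [Pi.div_apply]
    field_simp
  have := Convex.norm_image_sub_le_of_norm_hasDerivWithin_le (f := tanh)
    (f' := fun x => 1 - tanh x ^ 2) (s := Set.univ) (C := 1) (x := b) (y := a)
    (fun x _ => (hd x).hasDerivWithinAt) (fun x _ => by
      rw [Real.norm_eq_abs, abs_le]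
      have := abs_le_one_iff_mul_self_le_one.1 (abs_tanh_le_one x)
      constructor <;> nlinarith [sq_nonneg (tanh x)]) convex_univ trivial trivial
  simpa using this

theorem log_cosh_quadratic (f v : ℝ) :
    log (cosh v) - log (cosh f) - tanh f * (v - f) ≤ (v - f) ^ 2 := by
  have h1 := log_cosh_tangent_le v f
  have h2 : (tanh v - tanh f) * (v - f) ≤ (v - f) ^ 2 := by
    refine (le_abs_self _).trans ?_
    rw [abs_mul, ← sq_abs (v - f), sq]
    exact mul_le_mul_of_nonneg_right (abs_tanh_sub_le v f) (abs_nonneg _)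
  linarith

/-- First-order lower bound for the loss around the predictor `f`. -/
theorem spinEntropy_add_le_logisticLoss {y : ℝ} (hy : y = 1 ∨ y = -1) (f v : ℝ) :
    spinEntropy f + (tanh f - y) * v ≤ logisticLoss v y := by
  have := log_cosh_tangent_le f v
  rw [logisticLoss_eq hy, spinEntropy, log_two_mul_cosh, log_two_mul_cosh]
  linarith

theorem logisticLoss_le_spinEntropy_add {y : ℝ} (hy : y = 1 ∨ y = -1) (f v : ℝ) :
    logisticLoss v y ≤ spinEntropy f + (tanh f - y) * f + 2 * |v - f| := by
  have h1 := log_cosh_sub_le v f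
  have h2 : |(v - f) * y| = |v - f| := by
    rw [abs_mul]; rcases hy with rfl | rfl <;> simp
  have := (abs_le.1 h2.le).1
  rw [logisticLoss_eq hy, spinEntropy, log_two_mul_cosh, log_two_mul_cosh]
  linarith

end Logistic

/-! ### Regression losses -/

section Regression

variable {n m : ℕ}

theorem empty_mem_features (A : Finset (Fin n)) (D : ℕ) : ∅ ∈ features A D := by
  simp [features]

theorem regLoss_le {s : Fin m → Config n} {D : ℕ} {R : ℝ} {A : Finset (Fin n)} {i : Fin n}
    {w : Finset (Fin n) → ℝ} (hw : ∑ S ∈ features A D, |w S| ≤ R) :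
    regLoss s D R A i ≤ empLoss s D A i w := by
  refine csInf_le ⟨0, ?_⟩ ⟨w, hw, rfl⟩
  rintro _ ⟨w, _, rfl⟩
  exact mul_nonneg (by positivity) (Finset.sum_nonneg fun k _ => logisticLoss_nonneg _ _)

theorem le_regLoss {s : Fin m → Config n} {D : ℕ} {R b : ℝ} (hR : 0 ≤ R) {A : Finset (Fin n)}
    {i : Fin n} (h : ∀ w, ∑ S ∈ features A D, |w S| ≤ R → b ≤ empLoss s D A i w) :
    b ≤ regLoss s D R A i := by
  refine le_csInf ⟨_, 0, by simpa using hR, rfl⟩ ?_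
  rintro _ ⟨w, hw, rfl⟩
  exact h w hw

/-- The mean of a function over the samples. -/
def sampleMean (s : Fin m → Config n) (Z : Config n → ℝ) : ℝ := 1 / (m : ℝ) * ∑ k, Z (s k)

theorem sampleMean_add (s : Fin m → Config n) (Z Y : Config n → ℝ) :
    sampleMean s (fun x => Z x + Y x) = sampleMean s Z + sampleMean s Y := by
  simp only [sampleMean, Finset.sum_add_distrib]; ring

theorem sampleMean_mono (s : Fin m → Config n) {Z Y : Config n → ℝ} (h : ∀ x, Z x ≤ Y x) :
    sampleMean s Z ≤ sampleMean s Y :=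
  mul_le_mul_of_nonneg_left (Finset.sum_le_sum fun k _ => h _) (by positivity)

theorem sampleMean_const (hm : 0 < m) (s : Fin m → Config n) (c : ℝ) :
    sampleMean s (fun _ => c) = c := by
  have : (m : ℝ) ≠ 0 := by exact_mod_cast hm.ne'
  simp [sampleMean, this]

theorem sampleMean_sum_mul (s : Fin m → Config n) {ι : Type*} (T : Finset ι) (w : ι → ℝ)
    (Z : ι → Config n → ℝ) :
    sampleMean s (fun x => ∑ a ∈ T, w a * Z a x) = ∑ a ∈ T, w a * sampleMean s (Z a) := by
  simp only [sampleMean, Finset.mul_sum]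
  rw [Finset.sum_comm]
  exact Finset.sum_congr rfl fun a _ => Finset.sum_congr rfl fun k _ => by ring

theorem empLoss_eq_sampleMean (s : Fin m → Config n) (D : ℕ) (A : Finset (Fin n)) (i : Fin n)
    (w : Finset (Fin n) → ℝ) : empLoss s D A i w = sampleMean s (fun x =>
      logisticLoss (∑ S ∈ features A D, w S * chi S x) (spin x i)) := rfl

theorem sampleMean_sub_le_regLoss {s : Fin m → Config n} {D : ℕ} {R t : ℝ} (hR : 0 ≤ R)
    {A : Finset (Fin n)} {i : Fin n} (f : Config n → ℝ)
    (h : ∀ S ∈ features A D,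
      |sampleMean s fun x => (tanh (f x) - spin x i) * chi S x| ≤ t) :
    sampleMean s (fun x => spinEntropy (f x)) - R * t ≤ regLoss s D R A i := by
  refine le_regLoss hR fun w hw => ?_
  have h1 : sampleMean s (fun x => spinEntropy (f x)) + ∑ S ∈ features A D,
      w S * sampleMean s (fun x => (tanh (f x) - spin x i) * chi S x) ≤ empLoss s D A i w := by
    rw [← sampleMean_sum_mul, ← sampleMean_add, empLoss_eq_sampleMean]
    refine sampleMean_mono s ?_
    intro x
    have h := spinEntropy_add_le_logisticLoss (spin_eq_one_or x i) (f x)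
      (∑ S ∈ features A D, w S * chi S x)
    rw [Finset.mul_sum] at h
    refine le_trans (le_of_eq ?_) h
    congr 1
    exact Finset.sum_congr rfl fun S _ => by ring
  have ht : 0 ≤ t := (abs_nonneg _).trans (h ∅ (empty_mem_features A D))
  have h2 : |∑ S ∈ features A D,
      w S * sampleMean s (fun x => (tanh (f x) - spin x i) * chi S x)| ≤ R * t := by
    refine (Finset.abs_sum_le_sum_abs _ _).trans ?_
    refine le_trans ?_ (mul_le_mul_of_nonneg_right hw ht)
    rw [Finset.sum_mul]
    refine Finset.sum_le_sum fun S hS => ?_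
    rw [abs_mul]
    exact mul_le_mul_of_nonneg_left (h S hS) (abs_nonneg _)
  linarith [(abs_le.1 h2).1]

theorem regLoss_le_sampleMean_add (hm : 0 < m) {s : Fin m → Config n} {D : ℕ} {R e : ℝ}
    {A : Finset (Fin n)} {i : Fin n} (f : Config n → ℝ) {w : Finset (Fin n) → ℝ}
    (hw : ∑ S ∈ features A D, |w S| ≤ R)
    (hf : ∀ x, |(∑ S ∈ features A D, w S * chi S x) - f x| ≤ e) :
    regLoss s D R A i ≤ sampleMean s (fun x => spinEntropy (f x)) +
      sampleMean s (fun x => (tanh (f x) - spin x i) * f x) + 2 * e := by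
  refine (regLoss_le hw).trans ?_
  rw [← sampleMean_const hm s (2 * e), ← sampleMean_add, ← sampleMean_add, empLoss_eq_sampleMean]
  refine sampleMean_mono s ?_
  intro x
  have h1 := logisticLoss_le_spinEntropy_add (spin_eq_one_or x i) (f x)
    (∑ S ∈ features A D, w S * chi S x)
  have h2 := hf x
  linarith

end Regression

/-! ### Chebyshev expansion of functions analytic near an interval -/

section Chebyshev

theorem norm_integral_exp_mul_le {G : ℂ → ℂ} {τ M : ℝ} (hτ : 0 < τ)
    (hper : ∀ z, G (z + 2 * π) = G z) (hd : DifferentiableOn ℂ G {z | |z.im| ≤ τ})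
    (hM : ∀ z : ℂ, |z.im| ≤ τ → ‖G z‖ ≤ M) (k : ℤ) :
    ‖∫ x : ℝ in (0 : ℝ)..2 * π, Complex.exp (-(Complex.I * k * x)) * G x‖ ≤
      M * exp (-τ) ^ k.natAbs * (2 * π) := by
  obtain ⟨σ, hσ, hσk⟩ : ∃ σ : ℝ, |σ| = τ ∧ (k : ℝ) * σ = -τ * k.natAbs := by
    rcases le_total 0 k with h | h
    · refine ⟨-τ, by rw [abs_neg, abs_of_pos hτ], ?_⟩
      rw [Nat.cast_natAbs, abs_of_nonneg h]; ring
    · refine ⟨τ, abs_of_pos hτ, ?_⟩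
      rw [Nat.cast_natAbs, abs_of_nonpos h]; push_cast; ring
  set f : ℂ → ℂ := fun z => Complex.exp (-(Complex.I * k * z)) * G z with hf
  have hfper : ∀ z, f (z + 2 * π) = f z := by
    intro z
    simp only [hf, hper]
    congr 1
    have := (Complex.exp_periodic.int_mul (-k)) (-(Complex.I * k * z))
    rw [← this]
    congr 1
    push_cast
    ring
  have hrect : DifferentiableOn ℂ f
      (Set.uIcc (0 : ℂ).re (2 * π + σ * Complex.I : ℂ).re ×ℂ
        Set.uIcc (0 : ℂ).im (2 * π + σ * Complex.I : ℂ).im) := by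
    have h1 : DifferentiableOn ℂ f {z | |z.im| ≤ τ} := by
      refine DifferentiableOn.mul (Differentiable.differentiableOn ?_) hd
      fun_prop
    refine h1.mono fun z hz => ?_
    have hz2 := hz.2
    simp only [Complex.zero_im, Complex.add_im, Complex.mul_im, Complex.ofReal_im,
      Complex.ofReal_re, Complex.I_im, Complex.I_re, Complex.re_ofNat, Complex.im_ofNat,
      mul_zero, zero_mul, mul_one, add_zero, zero_add, Set.mem_preimage] at hz2
    have := Set.abs_sub_left_of_mem_uIcc hz2
    simp only [sub_zero] at this
    exact this.trans hσ.le
  have hint := Complex.integral_boundary_rect_eq_zero_of_differentiableOn f 0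
    (2 * π + σ * Complex.I) hrect
  have hper2 : ∀ y : ℝ, f (2 * π + y * Complex.I) = f (y * Complex.I) := by
    intro y; rw [add_comm, hfper]
  simp only [Complex.zero_im, Complex.zero_re, Complex.add_im, Complex.add_re, Complex.mul_im,
    Complex.mul_re, Complex.ofReal_im,
    Complex.ofReal_re, Complex.I_im, Complex.I_re, Complex.re_ofNat, Complex.im_ofNat,
    mul_zero, zero_mul, mul_one, add_zero, zero_add, sub_zero, Complex.ofReal_zero,
    Complex.ofReal_mul, Complex.ofReal_ofNat, hper2, add_sub_cancel_right] at hint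
  have heq := sub_eq_zero.1 hint
  change ‖∫ x : ℝ in (0 : ℝ)..2 * π, f x‖ ≤ _
  rw [heq]
  have := intervalIntegral.norm_integral_le_of_norm_le_const
    (a := 0) (b := 2 * π) (f := fun x : ℝ => f (x + σ * Complex.I))
    (C := M * exp (-τ) ^ k.natAbs) (fun x _ => by
      simp only [hf, norm_mul, Complex.norm_exp]
      rw [mul_comm]
      have e : (-(Complex.I * k * (x + σ * Complex.I))).re = k.natAbs * -τ := by
        simp only [Complex.neg_re, Complex.mul_re, Complex.I_re, Complex.I_im, Complex.add_re,
          Complex.add_im, Complex.mul_im, Complex.intCast_re, Complex.intCast_im,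
          Complex.ofReal_re, Complex.ofReal_im]
        linarith
      rw [e, Real.exp_nat_mul]
      refine mul_le_mul_of_nonneg_right (hM _ ?_) (by positivity)
      simp [hσ])
  rwa [sub_zero, abs_of_pos Real.two_pi_pos] at this

/-- Chebyshev expansion with geometric coefficient decay. -/
theorem exists_chebyshev_expansion {G : ℂ → ℂ} {φ : ℝ → ℝ} {τ M : ℝ} (hτ : 0 < τ)
    (hper : ∀ z, G (z + 2 * π) = G z) (hd : DifferentiableOn ℂ G {z | |z.im| ≤ τ})
    (hM : ∀ z : ℂ, |z.im| ≤ τ → ‖G z‖ ≤ M) (hG : ∀ θ : ℝ, G θ = φ (cos θ)) :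
    ∃ b : ℕ → ℝ, (∀ k, |b k| ≤ 2 * M) ∧ ∀ (D : ℕ) (θ : ℝ),
      |φ (cos θ) - ∑ k ∈ range (D + 1), b k * cos (k * θ)| ≤
        2 * M * exp (-τ) ^ (D + 1) / (1 - exp (-τ)) := by
  have hM0 : 0 ≤ M := (norm_nonneg _).trans (hM 0 (by simpa using hτ.le))
  have : Fact (0 < 2 * π) := ⟨Real.two_pi_pos⟩
  set r := exp (-τ) with hr
  have hr0 : 0 < r := Real.exp_pos _
  have hr1 : r < 1 := by
    rw [hr, ← Real.exp_zero]; exact Real.exp_lt_exp.2 (by linarith)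
  have hcont : Continuous fun x : ℝ => G x := by
    rw [continuous_iff_continuousAt]
    intro x
    have : ContinuousAt G (x : ℂ) := by
      refine (hd.continuousOn).continuousAt ?_
      have : {z : ℂ | |z.im| < τ} ∈ nhds (x : ℂ) := by
        refine IsOpen.mem_nhds ?_ (by simpa using hτ)
        exact isOpen_lt (by fun_prop) continuous_const
      filter_upwards [this] with z hz using le_of_lt hz
    exact ContinuousAt.comp this Complex.continuous_ofReal.continuousAt
  have hperR : Function.Periodic (fun x : ℝ => G x) (2 * π) := by
    intro x; simp only [Complex.ofReal_add, Complex.ofReal_mul, Complex.ofReal_ofNat, hper]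
  let g : C(AddCircle (2 * π), ℂ) := ⟨hperR.lift, continuous_coinduced_dom.mpr hcont⟩
  have hg : ∀ x : ℝ, g (x : AddCircle (2 * π)) = G x := fun x => hperR.lift_coe x
  set c := fourierCoeff g with hc
  have hcn : ∀ k : ℤ, ‖c k‖ ≤ M * r ^ k.natAbs := by
    intro k
    rw [hc, fourierCoeff_eq_intervalIntegral g k 0, zero_add]
    have e : ∀ x : ℝ, (fourier (-k) (x : AddCircle (2 * π))) • g (x : AddCircle (2 * π)) =
        Complex.exp (-(Complex.I * k * x)) * G x := by
      intro x
      rw [hg, fourier_coe_apply, smul_eq_mul]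
      congr 2
      have : (π : ℂ) ≠ 0 := by exact_mod_cast Real.pi_ne_zero
      push_cast
      field_simp
    simp only [e]
    rw [norm_smul, Real.norm_of_nonneg (by positivity)]
    have := norm_integral_exp_mul_le hτ hper hd hM k
    calc _ ≤ 1 / (2 * π) * (M * r ^ k.natAbs * (2 * π)) :=
          mul_le_mul_of_nonneg_left this (by positivity)
      _ = _ := by field_simp
  have hsumZ : Summable fun k : ℤ => M * r ^ k.natAbs := by
    refine Summable.mul_left M ?_
    exact summable_int_iff_summable_nat_and_neg.2
      ⟨by simpa using summable_geometric_of_lt_one hr0.le hr1,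
        by simpa using summable_geometric_of_lt_one hr0.le hr1⟩
  have hsum : Summable c := Summable.of_norm_bounded hsumZ hcn
  have hF : ∀ θ : ℝ, HasSum (fun k : ℤ => (c k).re * cos (k * θ)) (φ (cos θ)) := by
    intro θ
    have h1 := has_pointwise_sum_fourier_series_of_summable hsum (θ : AddCircle (2 * π))
    have h2 := has_pointwise_sum_fourier_series_of_summable hsum ((-θ : ℝ) : AddCircle (2 * π))
    rw [hg, hG] at h1 h2
    rw [Real.cos_neg] at h2
    have h3 := Complex.hasSum_re ((h1.add h2).div_const 2)
    have e1 : (((φ (cos θ) : ℂ) + φ (cos θ)) / 2).re = φ (cos θ) := by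
      rw [add_self_div_two, Complex.ofReal_re]
    rw [e1] at h3
    refine h3.congr_fun ?_
    intro k
    rw [fourier_coe_apply, fourier_coe_apply]
    have hpi : (π : ℂ) ≠ 0 := by exact_mod_cast Real.pi_ne_zero
    have a1 : 2 * π * Complex.I * k * θ / ((2 * π : ℝ) : ℂ) = ((k * θ : ℝ) : ℂ) * Complex.I := by
      push_cast; field_simp
    have a2 : 2 * π * Complex.I * k * ((-θ : ℝ) : ℂ) / ((2 * π : ℝ) : ℂ) =
        -((k * θ : ℝ) : ℂ) * Complex.I := by
      push_cast; field_simp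
    rw [a1, a2, smul_eq_mul, smul_eq_mul, ← mul_add, mul_div_assoc]
    change _ = (c k * Complex.cos _).re
    rw [← Complex.ofReal_cos, Complex.re_mul_ofReal]
  have hcr : ∀ k : ℤ, |(c k).re| ≤ M * r ^ k.natAbs := fun k =>
    (Complex.abs_re_le_norm _).trans (hcn k)
  let b : ℕ → ℝ := fun k => if k = 0 then (c 0).re else (c k).re + (c (-k)).re
  have hb : ∀ k, |b k| ≤ 2 * M * r ^ k := by
    intro k
    by_cases hk : k = 0
    · subst hk
      have := hcr 0
      simp only [b, if_pos, Int.natAbs_zero, pow_zero] at this ⊢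
      linarith
    · simp only [b, if_neg hk]
      have h1 := hcr k
      have h2 := hcr (-k)
      rw [Int.natAbs_neg] at h2
      rw [Int.natAbs_natCast] at h1 h2
      exact (abs_add_le _ _).trans (by linarith)
  refine ⟨b, fun k => (hb k).trans (mul_le_of_le_one_right (by positivity)
    (pow_le_one₀ hr0.le hr1.le)), fun D θ => ?_⟩
  have hb_sum : HasSum (fun k : ℕ => b k * cos (k * θ)) (φ (cos θ)) := by
    have h1 := (hF θ).nat_add_neg
    have h2 := h1.sub (hasSum_ite_eq 0 ((c 0).re))
    simp only [Int.cast_zero, zero_mul, Real.cos_zero, mul_one, add_sub_cancel_right] at h2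
    refine h2.congr_fun ?_
    intro k
    by_cases hk : k = 0
    · subst hk; simp [b]
    · simp only [b, if_neg hk, Int.cast_natCast, Int.cast_neg, neg_mul, Real.cos_neg]
      ring
  have htail := (hasSum_nat_add_iff' (D + 1)).2 hb_sum
  have hgeo : HasSum (fun k : ℕ => 2 * M * r ^ (D + 1) * r ^ k)
      (2 * M * r ^ (D + 1) * (1 - r)⁻¹) :=
    (hasSum_geometric_of_lt_one hr0.le hr1).mul_left _
  have := htail.norm_le_of_bounded hgeo fun k => by
    rw [norm_mul, Real.norm_eq_abs, Real.norm_eq_abs]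
    calc |b (k + (D + 1))| * |cos _| ≤ 2 * M * r ^ (k + (D + 1)) * 1 :=
          mul_le_mul (hb _) (Real.abs_cos_le_one _) (abs_nonneg _) (by positivity)
      _ = _ := by rw [pow_add]; ring
  rwa [Real.norm_eq_abs, ← div_eq_mul_inv] at this

end Chebyshev

/-! ### Response functions of hidden units -/

section HiddenResponse

theorem complex_cosh_re (z : ℂ) : (Complex.cosh z).re = cosh z.re * cos z.im := by
  conv_lhs => rw [← Complex.re_add_im z, Complex.cosh_add, Complex.cosh_mul_I, Complex.sinh_mul_I]
  simp [Complex.cos_ofReal_re, Complex.sin_ofReal_re, Complex.sinh_ofReal_re,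
    Complex.cosh_ofReal_re]

theorem complex_cosh_im (z : ℂ) : (Complex.cosh z).im = sinh z.re * sin z.im := by
  conv_lhs => rw [← Complex.re_add_im z, Complex.cosh_add, Complex.cosh_mul_I, Complex.sinh_mul_I]
  simp [Complex.cos_ofReal_re, Complex.sin_ofReal_re, Complex.sinh_ofReal_re,
    Complex.cosh_ofReal_re]

theorem complex_sinh_re (z : ℂ) : (Complex.sinh z).re = sinh z.re * cos z.im := by
  conv_lhs => rw [← Complex.re_add_im z, Complex.sinh_add, Complex.cosh_mul_I, Complex.sinh_mul_I]
  simp [Complex.cos_ofReal_re, Complex.sin_ofReal_re, Complex.sinh_ofReal_re,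
    Complex.cosh_ofReal_re]

theorem complex_sinh_im (z : ℂ) : (Complex.sinh z).im = cosh z.re * sin z.im := by
  conv_lhs => rw [← Complex.re_add_im z, Complex.sinh_add, Complex.cosh_mul_I, Complex.sinh_mul_I]
  simp [Complex.cos_ofReal_re, Complex.sin_ofReal_re, Complex.sinh_ofReal_re,
    Complex.cosh_ofReal_re]

theorem cosh_mem_slitPlane {z : ℂ} (hz : |z.im| ≤ π / 4) : Complex.cosh z ∈ Complex.slitPlane := by
  left
  rw [complex_cosh_re]
  have := abs_le.1 hz
  exact mul_pos (Real.cosh_pos _)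
    (Real.cos_pos_of_mem_Ioo ⟨by linarith [Real.pi_pos], by linarith [Real.pi_pos]⟩)

theorem norm_sinh_le_norm_cosh {z : ℂ} (hz : |z.im| ≤ π / 4) :
    ‖Complex.sinh z‖ ≤ ‖Complex.cosh z‖ := by
  refine le_of_sq_le_sq ?_ (norm_nonneg _)
  rw [Complex.sq_norm, Complex.sq_norm, Complex.normSq_apply, Complex.normSq_apply,
    complex_cosh_re, complex_cosh_im, complex_sinh_re, complex_sinh_im]
  have h1 : 0 ≤ cos (2 * z.im) := by
    have := abs_le.1 hz
    exact Real.cos_nonneg_of_mem_Icc ⟨by linarith, by linarith⟩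
  have h2 := Real.cos_sq_add_sin_sq z.im
  have h3 := Real.cosh_sq_sub_sinh_sq z.re
  rw [Real.cos_two_mul] at h1
  nlinarith

/-- The contribution of a hidden unit with incoming weight `W` to the log-odds, as a function of
the field `z` from the other units. -/
def hiddenResponse (W z : ℝ) : ℝ := (log (cosh (z + W)) - log (cosh (z - W))) / 2

/-- The analytic continuation of `hiddenResponse` to a strip. -/
def complexResponse (W : ℝ) (z : ℂ) : ℂ :=
  (Complex.log (Complex.cosh (z + W)) - Complex.log (Complex.cosh (z - W))) / 2

theorem complexResponse_ofReal (W z : ℝ) : complexResponse W z = hiddenResponse W z := by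
  unfold complexResponse hiddenResponse
  rw [Complex.ofReal_div, Complex.ofReal_sub, Complex.ofReal_log (Real.cosh_pos _).le,
    Complex.ofReal_log (Real.cosh_pos _).le, Complex.ofReal_cosh, Complex.ofReal_cosh]
  push_cast
  rfl

theorem differentiableAt_complexResponse (W : ℝ) {z : ℂ} (hz : |z.im| ≤ π / 4) :
    DifferentiableAt ℂ (complexResponse W) z := by
  unfold complexResponse
  have h1 : Complex.cosh (z + W) ∈ Complex.slitPlane := cosh_mem_slitPlane (by simpa using hz)
  have h2 : Complex.cosh (z - W) ∈ Complex.slitPlane := cosh_mem_slitPlane (by simpa using hz)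
  refine DifferentiableAt.div_const (DifferentiableAt.sub ?_ ?_) _
  · exact DifferentiableAt.clog (by fun_prop) h1
  · exact DifferentiableAt.clog (by fun_prop) h2

theorem norm_complexResponse_le (W : ℝ) {z : ℂ} (hz : |z.im| ≤ π / 4) :
    ‖complexResponse W z‖ ≤ |W| := by
  have hs : ∀ t : ℝ, |(z + t).im| ≤ π / 4 := fun t => by simpa using hz
  have hd : ∀ t : ℝ, HasDerivAt (fun t : ℝ => Complex.log (Complex.cosh (z + t)))
      (Complex.sinh (z + t) / Complex.cosh (z + t)) t := by
    intro t
    have h1 : HasDerivAt (fun t : ℝ => z + (t : ℂ)) 1 t := by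
      simpa using (Complex.ofRealCLM.hasDerivAt (x := t)).const_add z
    have h2 : HasDerivAt (fun t : ℝ => Complex.cosh (z + t)) (Complex.sinh (z + t)) t := by
      have h := (Complex.hasDerivAt_cosh (z + t)).comp t h1
      rw [mul_one] at h
      exact h
    exact h2.clog_real (cosh_mem_slitPlane (hs t))
  have := Convex.norm_image_sub_le_of_norm_hasDerivWithin_le (𝕜 := ℝ)
    (f := fun t : ℝ => Complex.log (Complex.cosh (z + t)))
    (f' := fun t : ℝ => Complex.sinh (z + t) / Complex.cosh (z + t)) (s := Set.univ) (C := 1)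
    (x := -W) (y := W) (fun t _ => (hd t).hasDerivWithinAt) (fun t _ => by
      rw [norm_div]
      exact div_le_one_of_le₀ (norm_sinh_le_norm_cosh (hs t)) (norm_nonneg _))
    convex_univ trivial trivial
  unfold complexResponse
  rw [norm_div, Complex.norm_ofNat, div_le_iff₀ two_pos]
  have e : ‖W - -W‖ = |W| * 2 := by
    rw [sub_neg_eq_add, ← mul_two, norm_mul, Real.norm_eq_abs]; norm_num
  rw [e, one_mul] at this
  simpa [sub_eq_add_neg] using this

theorem abs_hiddenResponse_le (W z : ℝ) : |hiddenResponse W z| ≤ |W| := by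
  have := norm_complexResponse_le W (z := z) (by simp; positivity)
  rwa [complexResponse_ofReal, Complex.norm_real, Real.norm_eq_abs] at this

theorem abs_im_cos_le (z : ℂ) : |(Complex.cos z).im| ≤ sinh |z.im| := by
  have h : (Complex.cos z).im = -(sin z.re * sinh z.im) := by
    conv_lhs => rw [← Complex.re_add_im z, Complex.cos_add_mul_I]
    simp [Complex.cos_ofReal_re, Complex.sin_ofReal_re, Complex.sinh_ofReal_re,
      Complex.cosh_ofReal_re]
  rw [h, abs_neg, abs_mul, Real.abs_sinh]
  exact mul_le_of_le_one_left (Real.sinh_nonneg_iff.2 (abs_nonneg _)) (Real.abs_sin_le_one _)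

theorem sinh_le_mul {τ : ℝ} (h0 : 0 ≤ τ) (h1 : τ ≤ 1 / 4) : sinh τ ≤ 9 / 8 * τ := by
  have h2 := (abs_le.1 (Real.abs_exp_sub_one_sub_id_le (x := τ)
    (by rw [abs_of_nonneg h0]; linarith))).2
  have h3 := Real.add_one_le_exp (-τ)
  rw [Real.sinh_eq]
  nlinarith

/-- Polynomial approximation of the response of a hidden unit on an interval of radius `lam`. -/
theorem exists_hiddenResponse_approx (W b : ℝ) {lam : ℝ} (hlam : 2 ≤ lam) :
    ∃ a : ℕ → ℝ, (∀ k, |a k| ≤ 2 * |W|) ∧ ∀ (D : ℕ) (u : ℝ), |u| ≤ 1 →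
      |hiddenResponse W (b + lam * u) -
        ∑ k ∈ range (D + 1), a k * (Polynomial.Chebyshev.T ℝ k).eval u| ≤
        4 * lam * |W| * exp (-(D / (2 * lam))) := by
  have hl : 0 < lam := by linarith
  set τ := 1 / (2 * lam) with hτ
  have hτ0 : 0 < τ := by positivity
  have hτ1 : τ ≤ 1 / 4 := by
    rw [hτ]; exact one_div_le_one_div_of_le (by norm_num) (by linarith)
  have hlt : lam * τ = 1 / 2 := by rw [hτ]; field_simp
  have him : ∀ z : ℂ, |z.im| ≤ τ → |((b : ℂ) + lam * Complex.cos z).im| ≤ π / 4 := by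
    intro z hz
    have e : ((b : ℂ) + lam * Complex.cos z).im = lam * (Complex.cos z).im := by simp
    rw [e, abs_mul, abs_of_pos hl]
    have h1 := (abs_im_cos_le z).trans (Real.sinh_le_sinh.2 hz)
    have h2 := h1.trans (sinh_le_mul hτ0.le hτ1)
    calc lam * |(Complex.cos z).im| ≤ lam * (9 / 8 * τ) := mul_le_mul_of_nonneg_left h2 hl.le
      _ = 9 / 8 * (lam * τ) := by ring
      _ ≤ π / 4 := by rw [hlt]; linarith [Real.pi_gt_three]
  obtain ⟨a, ha, happ⟩ := exists_chebyshev_expansion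
    (G := fun z => complexResponse W (b + lam * Complex.cos z))
    (φ := fun u => hiddenResponse W (b + lam * u)) (τ := τ) (M := |W|) hτ0
    (fun z => by simp only [Complex.cos_add_two_pi])
    (fun z hz => by
      have := differentiableAt_complexResponse W (him z hz)
      exact (DifferentiableAt.comp z (f := fun z : ℂ => (b : ℂ) + lam * Complex.cos z) this
        (by fun_prop)).differentiableWithinAt)
    (fun z hz => norm_complexResponse_le W (him z hz))
    (fun θ => by
      rw [← complexResponse_ofReal]
      push_cast
      rfl)
  refine ⟨a, ha, fun D u hu => ?_⟩
  have hu' := abs_le.1 hu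
  have h := happ D (arccos u)
  rw [Real.cos_arccos hu'.1 hu'.2] at h
  have e : ∀ k : ℕ, (Polynomial.Chebyshev.T ℝ k).eval u = cos (k * arccos u) := by
    intro k
    have := Polynomial.Chebyshev.T_real_cos (arccos u) k
    rw [Real.cos_arccos hu'.1 hu'.2] at this
    simpa using this
  simp only [e]
  refine h.trans ?_
  have hr1 : exp (-τ) < 1 := by
    rw [← Real.exp_zero]; exact Real.exp_lt_exp.2 (by linarith)
  rw [div_le_iff₀ (by linarith)]
  have e2 : exp (-(D / (2 * lam))) = exp (-τ) ^ D := by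
    rw [← Real.exp_nat_mul, hτ]; congr 1; ring
  rw [e2, pow_succ]
  have h3 : exp (-τ) ≤ 2 * lam * (1 - exp (-τ)) := by
    have h4 := Real.add_one_le_exp τ
    have h5 : exp (-τ) * exp τ = 1 := by rw [← Real.exp_add]; simp
    have h6 : τ * exp (-τ) ≤ 1 - exp (-τ) := by
      nlinarith [mul_le_mul_of_nonneg_left h4 (Real.exp_pos (-τ)).le]
    calc exp (-τ) = 2 * lam * (τ * exp (-τ)) := by rw [hτ]; field_simp
      _ ≤ _ := mul_le_mul_of_nonneg_left h6 (by positivity)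
  calc 2 * |W| * (exp (-τ) ^ D * exp (-τ))
      ≤ 2 * |W| * (exp (-τ) ^ D * (2 * lam * (1 - exp (-τ)))) := by gcongr
    _ = _ := by ring

end HiddenResponse

/-! ### Polynomials on the hypercube with bounded coefficient norm -/

section PolyRep

variable {n : ℕ} {A : Finset (Fin n)} {D : ℕ}

/-- `v` is a polynomial of degree at most `D` in the coordinates `A` with coefficients of
`ℓ¹`-norm at most `r`. -/
def PolyRep (A : Finset (Fin n)) (D : ℕ) (r : ℝ) (v : Config n → ℝ) : Prop :=
  ∃ w : Finset (Fin n) → ℝ, ∑ S ∈ features A D, |w S| ≤ r ∧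
    ∀ x, v x = ∑ S ∈ features A D, w S * chi S x

theorem mem_features {S : Finset (Fin n)} : S ∈ features A D ↔ S ⊆ A ∧ S.card ≤ D := by
  simp [features]

theorem PolyRep.nonneg {r : ℝ} {v : Config n → ℝ} (h : PolyRep A D r v) : 0 ≤ r := by
  obtain ⟨w, hw, _⟩ := h
  exact (Finset.sum_nonneg fun _ _ => abs_nonneg _).trans hw

theorem PolyRep.mono {r r' : ℝ} {v : Config n → ℝ} (h : PolyRep A D r v) (hr : r ≤ r') :
    PolyRep A D r' v := by
  obtain ⟨w, hw, hv⟩ := h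
  exact ⟨w, hw.trans hr, hv⟩

theorem PolyRep.chi {T : Finset (Fin n)} (hT : T ∈ features A D) :
    PolyRep A D 1 (_root_.chi T) := by
  refine ⟨fun S => if S = T then 1 else 0, ?_, fun x => ?_⟩
  · simp only [apply_ite abs, abs_one, abs_zero]
    rw [Finset.sum_ite_eq' _ T, if_pos hT]
  · simp only [ite_mul, one_mul, zero_mul]
    rw [Finset.sum_ite_eq' _ T, if_pos hT]

theorem PolyRep.smul {r : ℝ} {v : Config n → ℝ} (h : PolyRep A D r v) (c : ℝ) :
    PolyRep A D (|c| * r) (fun x => c * v x) := by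
  obtain ⟨w, hw, hv⟩ := h
  refine ⟨fun S => c * w S, ?_, fun x => ?_⟩
  · simp only [abs_mul, ← Finset.mul_sum]
    exact mul_le_mul_of_nonneg_left hw (abs_nonneg c)
  · dsimp only
    rw [hv x, Finset.mul_sum]
    exact Finset.sum_congr rfl fun S _ => by ring

theorem PolyRep.add {r r' : ℝ} {v v' : Config n → ℝ} (h : PolyRep A D r v)
    (h' : PolyRep A D r' v') : PolyRep A D (r + r') (fun x => v x + v' x) := by
  obtain ⟨w, hw, hv⟩ := h
  obtain ⟨w', hw', hv'⟩ := h'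
  refine ⟨fun S => w S + w' S, ?_, fun x => ?_⟩
  · refine (Finset.sum_le_sum fun S _ => abs_add_le _ _).trans ?_
    rw [Finset.sum_add_distrib]
    exact add_le_add hw hw'
  · dsimp only
    rw [hv x, hv' x, ← Finset.sum_add_distrib]
    exact Finset.sum_congr rfl fun S _ => by ring

theorem PolyRep.const (c : ℝ) : PolyRep A D |c| (fun _ => c) := by
  have := (PolyRep.chi (empty_mem_features A D)).smul c
  simpa [_root_.chi] using this

theorem PolyRep.sum {ι : Type*} (T : Finset ι) (r : ι → ℝ) (v : ι → Config n → ℝ)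
    (h : ∀ a ∈ T, PolyRep A D (r a) (v a)) :
    PolyRep A D (∑ a ∈ T, r a) (fun x => ∑ a ∈ T, v a x) := by
  classical
  induction T using Finset.induction_on with
  | empty => simpa using PolyRep.const (A := A) (D := D) 0
  | insert a T ha ih =>
    simp only [Finset.sum_insert ha]
    exact (h a (Finset.mem_insert_self a T)).add
      (ih fun b hb => h b (Finset.mem_insert_of_mem hb))

theorem PolyRep.transform {A' : Finset (Fin n)} {D' : ℕ} {r : ℝ} {v : Config n → ℝ}
    (h : PolyRep A D r v) (g : Config n → ℝ)
    (hg : ∀ S ∈ features A D, ∃ T ∈ features A' D', ∀ x, _root_.chi S x * g x = _root_.chi T x) :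
    PolyRep A' D' r (fun x => v x * g x) := by
  obtain ⟨w, hw, hv⟩ := h
  have := PolyRep.sum (A := A') (D := D') (features A D) (fun S => |w S|)
    (fun S x => w S * (_root_.chi S x * g x)) (fun S hS => by
      obtain ⟨T, hT, hST⟩ := hg S hS
      simpa [hST] using (PolyRep.chi hT).smul (w S))
  refine (this.mono hw).imp fun w' hw' => ⟨hw'.1, fun x => ?_⟩
  rw [← hw'.2 x]
  dsimp only
  rw [hv x, Finset.sum_mul]
  exact Finset.sum_congr rfl fun S _ => by ring

theorem PolyRep.degree_mono {D' : ℕ} {r : ℝ} {v : Config n → ℝ} (h : PolyRep A D r v)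
    (hD : D ≤ D') : PolyRep A D' r v := by
  have := h.transform (A' := A) (D' := D') (fun _ => 1) fun S hS =>
    ⟨S, mem_features.2 ⟨(mem_features.1 hS).1, (mem_features.1 hS).2.trans hD⟩,
      fun x => mul_one _⟩
  simpa using this

theorem PolyRep.mul_spin {r : ℝ} {v : Config n → ℝ} (h : PolyRep A D r v) {k : Fin n}
    (hk : k ∈ A) : PolyRep A (D + 1) r (fun x => v x * spin x k) := by
  refine h.transform _ fun S hS => ?_
  obtain ⟨hSA, hSD⟩ := mem_features.1 hS
  by_cases hkS : k ∈ S
  · refine ⟨S.erase k, mem_features.2 ⟨(Finset.erase_subset _ _).trans hSA,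
      (Finset.card_erase_le).trans (by omega)⟩, fun x => ?_⟩
    unfold _root_.chi
    rw [← Finset.mul_prod_erase S _ hkS]
    linear_combination (∏ i ∈ S.erase k, spin x i) * spin_mul_self x k
  · refine ⟨insert k S, mem_features.2 ⟨Finset.insert_subset hk hSA,
      (Finset.card_insert_le _ _).trans (by omega)⟩, fun x => ?_⟩
    unfold _root_.chi
    rw [Finset.prod_insert hkS, mul_comm]

theorem PolyRep.linear_mul {r : ℝ} {v : Config n → ℝ} (h : PolyRep A D r v) {c : Fin n → ℝ}
    (hc : ∑ k ∈ A, |c k| ≤ 1) :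
    PolyRep A (D + 1) r (fun x => (∑ k ∈ A, c k * spin x k) * v x) := by
  have h1 := PolyRep.sum (A := A) (D := D + 1) A (fun k => |c k| * r)
    (fun k x => c k * (v x * spin x k)) fun k hk => (h.mul_spin hk).smul (c k)
  rw [← Finset.sum_mul] at h1
  refine (h1.mono (mul_le_of_le_one_left h.nonneg hc)).imp fun w hw => ⟨hw.1, fun x => ?_⟩
  rw [← hw.2 x]
  dsimp only
  rw [Finset.sum_mul]
  exact Finset.sum_congr rfl fun k _ => by ring

theorem polyRep_chebyshev {c : Fin n → ℝ} (hc : ∑ k ∈ A, |c k| ≤ 1) (k : ℕ) :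
    PolyRep A k (3 ^ k)
      (fun x => (Polynomial.Chebyshev.T ℝ k).eval (∑ k ∈ A, c k * spin x k)) := by
  induction k using Nat.twoStepInduction with
  | zero => simpa using PolyRep.const (A := A) (D := 0) 1
  | one =>
    have h := (PolyRep.const (A := A) (D := 0) 1).linear_mul hc
    simp only [abs_one, mul_one, zero_add] at h
    simpa using h.mono (by norm_num)
  | more k h0 h1 =>
    have h2 := ((h1.linear_mul hc).smul 2).add ((h0.degree_mono (by omega : k ≤ k + 2)).smul (-1))
    refine (h2.mono ?_).imp fun w hw => ⟨hw.1, fun x => ?_⟩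
    · have h3 : (0 : ℝ) < 3 ^ k := by positivity
      have h4 : (3 : ℝ) ^ (k + 1) = 3 * 3 ^ k := by ring
      have h5 : (3 : ℝ) ^ (k + 2) = 9 * 3 ^ k := by ring
      rw [abs_two, abs_neg, abs_one, h4, h5]
      linarith
    · rw [← hw.2 x]
      push_cast
      rw [Polynomial.Chebyshev.T_add_two]
      simp only [Polynomial.eval_sub, Polynomial.eval_mul, Polynomial.eval_ofNat,
        Polynomial.eval_X]
      ring

theorem exists_polyRep_hiddenResponse (W b : ℝ) {lam : ℝ} (hlam : 2 ≤ lam) {c : Fin n → ℝ}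
    (hc : ∑ k ∈ A, |c k| ≤ lam) (D : ℕ) :
    ∃ v, PolyRep A D (|W| * 3 ^ (D + 1)) v ∧ ∀ x,
      |v x - hiddenResponse W (b + ∑ k ∈ A, c k * spin x k)| ≤
        4 * lam * |W| * exp (-(D / (2 * lam))) := by
  have hl : 0 < lam := by linarith
  obtain ⟨a, ha, happ⟩ := exists_hiddenResponse_approx W b hlam
  have hc' : ∑ k ∈ A, |c k / lam| ≤ 1 := by
    simp only [abs_div, abs_of_pos hl, ← Finset.sum_div]
    exact (div_le_one hl).2 hc
  refine ⟨fun x => ∑ k ∈ range (D + 1), a k *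
    (Polynomial.Chebyshev.T ℝ k).eval (∑ i ∈ A, c i / lam * spin x i), ?_, fun x => ?_⟩
  · refine (PolyRep.sum (A := A) (D := D) (range (D + 1)) (fun k => |a k| * 3 ^ k) _
      fun k hk => ((polyRep_chebyshev hc' k).degree_mono
        (Nat.lt_succ_iff.1 (Finset.mem_range.1 hk))).smul (a k)).mono ?_
    calc ∑ k ∈ range (D + 1), |a k| * 3 ^ k ≤ ∑ k ∈ range (D + 1), 2 * |W| * 3 ^ k :=
          Finset.sum_le_sum fun k _ => mul_le_mul_of_nonneg_right (ha k) (by positivity)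
      _ = |W| * (3 ^ (D + 1) - 1) := by
          rw [← Finset.mul_sum, geom_sum_eq (by norm_num)]; ring
      _ ≤ _ := mul_le_mul_of_nonneg_left (by linarith) (abs_nonneg W)
  · have e : ∑ k ∈ A, c k * spin x k = lam * ∑ i ∈ A, c i / lam * spin x i := by
      rw [Finset.mul_sum]
      exact Finset.sum_congr rfl fun k _ => by field_simp
    rw [e, abs_sub_comm]
    refine happ D _ ((Finset.abs_sum_le_sum_abs _ _).trans ?_)
    simpa only [abs_mul, abs_spin, mul_one] using hc'

end PolyRep

/-! ### The log-odds of a visible unit of an RBM -/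

namespace RBM

variable {n nh : ℕ} (M : RBM n nh)

/-- The field acting on hidden unit `j`. -/
def hiddenField (x : Config n) (j : Fin nh) : ℝ := M.b2 j + ∑ i, M.W i j * spin x i

theorem sum_exp_potential (x : Config n) :
    ∑ h : Config nh, exp (M.potential x h) =
      exp (∑ i, M.b1 i * spin x i) * ∏ j, (2 * cosh (M.hiddenField x j)) := by
  have h1 : ∀ h : Config nh, exp (M.potential x h) = exp (∑ i, M.b1 i * spin x i) *
      ∏ j, exp (M.hiddenField x j * ((h j : ℤ) : ℝ)) := by
    intro h
    rw [← Real.exp_sum, ← Real.exp_add]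
    congr 1
    unfold potential hiddenField
    rw [Finset.sum_comm]
    simp only [add_mul, Finset.sum_add_distrib, Finset.sum_mul]
    have : ∀ j, ∀ i, spin x i * M.W i j * spin h j = M.W i j * spin x i * ((h j : ℤ) : ℝ) :=
      fun j i => by unfold spin; ring
    simp only [this]
    unfold spin
    ring
  simp only [h1, ← Finset.mul_sum]
  congr 1
  have h2 := Finset.prod_univ_sum (fun _ : Fin nh => (univ : Finset ℤˣ))
    (fun j u => exp (M.hiddenField x j * ((u : ℤ) : ℝ)))
  rw [Fintype.piFinset_univ] at h2
  rw [← h2]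
  refine Finset.prod_congr rfl fun j _ => ?_
  have hu : (univ : Finset ℤˣ) = {1, -1} := by decide
  rw [hu, Finset.sum_pair (by decide), Real.cosh_eq]
  simp
  ring

theorem partition_pos : 0 < ∑ x' : Config n, ∑ h' : Config nh, exp (M.potential x' h') :=
  Finset.sum_pos (fun _ _ => Finset.sum_pos (fun _ _ => Real.exp_pos _) Finset.univ_nonempty)
    Finset.univ_nonempty

theorem law_eq (x : Config n) : M.law x = (∑ h : Config nh, exp (M.potential x h)) /
    ∑ x' : Config n, ∑ h' : Config nh, exp (M.potential x' h') := by
  unfold law jointProb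
  rw [Finset.sum_div]

theorem law_pos (x : Config n) : 0 < M.law x := by
  rw [law_eq]
  exact div_pos (Finset.sum_pos (fun _ _ => Real.exp_pos _) Finset.univ_nonempty) M.partition_pos

theorem sum_law : ∑ x, M.law x = 1 := by
  simp only [law_eq]
  rw [← Finset.sum_div]
  exact div_self M.partition_pos.ne'

theorem log_law (x : Config n) : log (M.law x) = ∑ i, M.b1 i * spin x i +
    ∑ j, (log 2 + log (cosh (M.hiddenField x j))) -
      log (∑ x' : Config n, ∑ h' : Config nh, exp (M.potential x' h')) := by
  have hc : ∀ j, (2 * cosh (M.hiddenField x j)) ≠ 0 := fun j =>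
    (mul_pos two_pos (Real.cosh_pos _)).ne'
  rw [law_eq, sum_exp_potential, Real.log_div (mul_ne_zero (Real.exp_pos _).ne'
    (Finset.prod_ne_zero_iff.2 fun j _ => hc j)) M.partition_pos.ne',
    Real.log_mul (Real.exp_pos _).ne' (Finset.prod_ne_zero_iff.2 fun j _ => hc j),
    Real.log_exp, Real.log_prod fun j _ => hc j]
  simp only [log_two_mul_cosh]

theorem logit_law (i : Fin n) (x : Config n) :
    logit M.law (univ.erase i) i x = M.b1 i + ∑ j, hiddenResponse (M.W i j)
      (M.b2 j + ∑ k ∈ univ.erase i, M.W k j * spin x k) := by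
  rw [logit_univ_erase, log_law, log_law]
  have hsplit : ∀ (c : Fin n → ℝ) (y : Config n), ∑ k, c k * spin y k =
      c i * spin y i + ∑ k ∈ univ.erase i, c k * spin y k := fun c y =>
    (Finset.add_sum_erase _ (fun k => c k * spin y k) (Finset.mem_univ i)).symm
  have hflip : ∀ c : Fin n → ℝ, ∑ k ∈ univ.erase i, c k * spin (flipAt i x) k =
      ∑ k ∈ univ.erase i, c k * spin x k := fun c =>
    Finset.sum_congr rfl fun k hk => by rw [spin_flipAt_ne (Finset.ne_of_mem_erase hk)]
  have hf1 : ∀ j, M.hiddenField x j =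
      (M.b2 j + ∑ k ∈ univ.erase i, M.W k j * spin x k) + M.W i j * spin x i := by
    intro j
    unfold hiddenField
    rw [hsplit (fun k => M.W k j) x]; ring
  have hf2 : ∀ j, M.hiddenField (flipAt i x) j =
      (M.b2 j + ∑ k ∈ univ.erase i, M.W k j * spin x k) - M.W i j * spin x i := by
    intro j
    unfold hiddenField
    rw [hsplit (fun k => M.W k j) (flipAt i x), hflip fun k => M.W k j, spin_flipAt_self]; ring
  simp only [hf1, hf2]
  rw [hsplit M.b1 x, hsplit M.b1 (flipAt i x), hflip M.b1, spin_flipAt_self]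
  unfold hiddenResponse
  simp only [Finset.sum_add_distrib, ← Finset.sum_div, Finset.sum_sub_distrib]
  rcases spin_eq_one_or x i with h | h <;> rw [h]
  · simp only [mul_one]; ring
  · simp only [mul_neg, mul_one, sub_neg_eq_add, ← sub_eq_add_neg]; ring

theorem abs_logit_law_sub_le (i : Fin n) (x : Config n) :
    |logit M.law (univ.erase i) i x - M.b1 i| ≤ ∑ j, |M.W i j| := by
  rw [logit_law, add_sub_cancel_left]
  exact (Finset.abs_sum_le_sum_abs _ _).trans
    (Finset.sum_le_sum fun j _ => abs_hiddenResponse_le _ _)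

theorem abs_logit_law_le (i : Fin n) (x : Config n) :
    |logit M.law (univ.erase i) i x| ≤ (∑ j, |M.W i j|) + |M.b1 i| := by
  have := abs_add_le (logit M.law (univ.erase i) i x - M.b1 i) (M.b1 i)
  rw [sub_add_cancel] at this
  linarith [M.abs_logit_law_sub_le i x]

theorem exists_polyRep_response (i : Fin n) (β : Fin nh → ℝ) (A : Finset (Fin n)) {lam2 : ℝ}
    (hlam : 2 ≤ lam2) (hM : ∀ j, ∑ i, |M.W i j| ≤ lam2) (D : ℕ) :
    ∃ v, PolyRep A D (|M.b1 i| + (∑ j, |M.W i j|) * 3 ^ (D + 1)) v ∧ ∀ x,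
      |v x - (M.b1 i + ∑ j, hiddenResponse (M.W i j) (β j + ∑ k ∈ A, M.W k j * spin x k))| ≤
        4 * lam2 * (∑ j, |M.W i j|) * exp (-(D / (2 * lam2))) := by
  have h : ∀ j, ∃ v, PolyRep A D (|M.W i j| * 3 ^ (D + 1)) v ∧ ∀ x,
      |v x - hiddenResponse (M.W i j) (β j + ∑ k ∈ A, M.W k j * spin x k)| ≤
        4 * lam2 * |M.W i j| * exp (-(D / (2 * lam2))) := fun j =>
    exists_polyRep_hiddenResponse _ _ hlam
      ((Finset.sum_le_sum_of_subset_of_nonneg (Finset.subset_univ A)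
        fun _ _ _ => abs_nonneg _).trans (hM j)) D
  choose v hv hv' using h
  refine ⟨fun x => M.b1 i + ∑ j, v j x, ?_, fun x => ?_⟩
  · rw [Finset.sum_mul]
    exact (PolyRep.const _).add (PolyRep.sum univ _ v fun j _ => hv j)
  · rw [add_sub_add_left_eq_sub, ← Finset.sum_sub_distrib, Finset.mul_sum, Finset.sum_mul]
    exact (Finset.abs_sum_le_sum_abs _ _).trans (Finset.sum_le_sum fun j _ => hv' j x)

/-- The log-odds of unit `i` are approximated by a polynomial in any set of visible units which
determines them, if this set omits one of the other units. -/
theorem exists_polyRep_logit {i j : Fin n} (hij : i ≠ j) {lam2 : ℝ}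
    (hlam : 2 ≤ lam2) (hM : ∀ j, ∑ i, |M.W i j| ≤ lam2)
    (hind : ∀ x, logit M.law (univ.erase i) i (flipAt j x) = logit M.law (univ.erase i) i x)
    (D : ℕ) :
    ∃ v, PolyRep ((univ.erase i).erase j) D (|M.b1 i| + (∑ j, |M.W i j|) * 3 ^ (D + 1)) v ∧
      ∀ x, |v x - logit M.law (univ.erase i) i x| ≤
        4 * lam2 * (∑ j, |M.W i j|) * exp (-(D / (2 * lam2))) := by
  obtain ⟨v, hv, hv'⟩ := M.exists_polyRep_response i (fun l => M.b2 l + M.W j l)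
    ((univ.erase i).erase j) hlam hM D
  refine ⟨v, hv, fun x => ?_⟩
  have h1 : logit M.law (univ.erase i) i x =
      logit M.law (univ.erase i) i (Function.update x j 1) := by
    rcases update_one_or j x with ⟨_, h, _⟩ | ⟨_, h, _⟩ <;> rw [h]
    rw [hind]
  have h2 : ∀ l, M.b2 l + ∑ k ∈ univ.erase i, M.W k l * spin (Function.update x j 1) k =
      M.b2 l + M.W j l + ∑ k ∈ (univ.erase i).erase j, M.W k l * spin x k := by
    intro l
    rw [← Finset.add_sum_erase (univ.erase i) _
      (Finset.mem_erase.2 ⟨hij.symm, Finset.mem_univ j⟩), add_assoc]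
    congr 2
    · simp [spin]
    · exact Finset.sum_congr rfl fun k hk => by
        rw [spin_congr (y := Function.update x j 1) (x := x)
          (by simp [Finset.ne_of_mem_erase hk])]
  rw [h1, logit_law]
  simp only [h2]
  exact hv' x

end RBM

/-! ### Conditional mutual information -/

section Information

variable {n : ℕ} {P : Config n → ℝ}

/-- The conditional entropy of `X_i` given `X_A`. -/
def condEntropy (P : Config n → ℝ) (A : Finset (Fin n)) (i : Fin n) : ℝ :=
  ∑ x, P x * spinEntropy (logit P A i x)

theorem sum_log_marg_sub_eq_condEntropy (hP : ∀ x, 0 < P x) {A : Finset (Fin n)} {i : Fin n}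
    (hi : i ∉ A) : ∑ x, P x * (log (marg P A x) - log (marg P (insert i A) x)) =
      condEntropy P A i := by
  have h := sum_residual_eq_zero hP hi (logit P A i) fun x y hxy => logit_congr P hxy
  rw [← add_zero (condEntropy P A i), ← h, condEntropy, ← Finset.sum_add_distrib]
  refine Finset.sum_congr rfl fun x _ => ?_
  rw [← logisticLoss_logit hP hi, logisticLoss_eq (spin_eq_one_or x i), spinEntropy]
  ring

theorem condMutualInfo_eq (hP : ∀ x, 0 < P x) {i j : Fin n} (hij : i ≠ j) :
    condMutualInfo P i j =
      condEntropy P ((univ.erase i).erase j) i - condEntropy P (univ.erase i) i := by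
  have e : insert i ((univ.erase i).erase j) = univ.erase j := by
    rw [Finset.erase_right_comm, Finset.insert_erase (Finset.mem_erase.2 ⟨hij, mem_univ i⟩)]
  rw [← sum_log_marg_sub_eq_condEntropy hP (by simp), ← sum_log_marg_sub_eq_condEntropy hP
    (by simp), e, Finset.insert_erase (Finset.mem_univ i), ← Finset.sum_sub_distrib,
    condMutualInfo]
  refine Finset.sum_congr rfl fun x _ => ?_
  have h1 := marg_pos hP ((univ.erase i).erase j) x
  have h2 := marg_pos hP (univ.erase j) x
  have h3 := marg_pos hP (univ.erase i) x
  rw [marg_univ, Real.log_div (mul_pos (hP x) h1).ne' (mul_pos h2 h3).ne',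
    Real.log_mul (hP x).ne' h1.ne', Real.log_mul h2.ne' h3.ne']
  ring

theorem condEntropy_le (hP : ∀ x, 0 < P x) {A : Finset (Fin n)} {i : Fin n} (hi : i ∉ A)
    (v : ℝ) : condEntropy P A i ≤ ∑ x, P x * logisticLoss v (spin x i) := by
  have h := sum_residual_eq_zero hP hi (fun _ => v) fun x y _ => rfl
  rw [← add_zero (condEntropy P A i), ← h, condEntropy, ← Finset.sum_add_distrib]
  refine Finset.sum_le_sum fun x _ => ?_
  rw [← mul_add]
  exact mul_le_mul_of_nonneg_left
    (spinEntropy_add_le_logisticLoss (spin_eq_one_or x i) _ v) (hP x).le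

theorem condMutualInfo_le (hP : ∀ x, 0 < P x) {i j : Fin n} (hij : i ≠ j) (v : ℝ) :
    condMutualInfo P i j ≤ ∑ x, P x * (log (2 * cosh v) - v * tanh (logit P (univ.erase i) i x) -
      spinEntropy (logit P (univ.erase i) i x)) := by
  rw [condMutualInfo_eq hP hij]
  have h1 := condEntropy_le hP (A := (univ.erase i).erase j) (i := i) (by simp) v
  have h2 := sum_residual_eq_zero hP (Finset.notMem_erase i univ) (fun _ => v) fun x y _ => rfl
  have h3 : ∑ x, P x * (log (2 * cosh v) - v * tanh (logit P (univ.erase i) i x) -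
      spinEntropy (logit P (univ.erase i) i x)) = ∑ x, P x * logisticLoss v (spin x i) -
      ∑ x, P x * ((tanh (logit P (univ.erase i) i x) - spin x i) * v) -
      condEntropy P (univ.erase i) i := by
    rw [condEntropy, ← Finset.sum_sub_distrib, ← Finset.sum_sub_distrib]
    refine Finset.sum_congr rfl fun x _ => ?_
    rw [logisticLoss_eq (spin_eq_one_or x i)]
    ring
  rw [h3, h2]
  linarith

theorem condMutualInfo_le_log_two (hP : ∀ x, 0 < P x) (h1 : ∑ x, P x = 1) {i j : Fin n}
    (hij : i ≠ j) : condMutualInfo P i j ≤ log 2 := by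
  refine (condMutualInfo_le hP hij 0).trans ?_
  calc _ ≤ ∑ x, P x * log 2 := Finset.sum_le_sum fun x _ =>
        mul_le_mul_of_nonneg_left (by
          have := spinEntropy_nonneg (logit P (univ.erase i) i x)
          rw [Real.cosh_zero, mul_one, zero_mul]; linarith) (hP x).le
    _ = log 2 := by rw [← Finset.sum_mul, h1, one_mul]

theorem condMutualInfo_le_sq (hP : ∀ x, 0 < P x) (h1 : ∑ x, P x = 1) {i j : Fin n}
    (hij : i ≠ j) {v B : ℝ} (hB : ∀ x, |logit P (univ.erase i) i x - v| ≤ B) :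
    condMutualInfo P i j ≤ B ^ 2 := by
  refine (condMutualInfo_le hP hij v).trans ?_
  calc _ ≤ ∑ x, P x * B ^ 2 := Finset.sum_le_sum fun x _ =>
        mul_le_mul_of_nonneg_left (by
          have h2 := log_cosh_quadratic (logit P (univ.erase i) i x) v
          have h3 : (v - logit P (univ.erase i) i x) ^ 2 ≤ B ^ 2 :=
            sq_le_sq.2 (by
              rw [abs_sub_comm]
              exact (hB x).trans (le_abs_self B))
          rw [spinEntropy, log_two_mul_cosh, log_two_mul_cosh]
          linarith) (hP x).le
    _ = B ^ 2 := by rw [← Finset.sum_mul, h1, one_mul]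

end Information

/-! ### Structure recovery -/

section Structure

variable {n m : ℕ} {P : Config n → ℝ}

/-- The samples are representative for the logistic regressions of degree `D`. -/
def Representative (P : Config n → ℝ) (D : ℕ) (F t : ℝ) (s : Fin m → Config n) : Prop :=
  ∀ i j : Fin n,
    (∀ S ∈ features ((univ.erase i).erase j) D, |sampleMean s fun x =>
      (tanh (logit P ((univ.erase i).erase j) i x) - spin x i) * chi S x| ≤ 2 * t) ∧
    |sampleMean s fun x => spinEntropy (logit P ((univ.erase i).erase j) i x) -
      condEntropy P ((univ.erase i).erase j) i| ≤ 2 * F * t ∧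
    |sampleMean s fun x => (tanh (logit P ((univ.erase i).erase j) i x) - spin x i) *
      logit P ((univ.erase i).erase j) i x| ≤ 2 * F * t

theorem notMem_erase_erase (i j : Fin n) : i ∉ (univ.erase i).erase j := by simp

theorem abs_tanh_sub_spin_le (v : ℝ) (x : Config n) (i : Fin n) : |tanh v - spin x i| ≤ 2 := by
  refine (abs_sub _ _).trans ?_
  rw [abs_spin]
  linarith [abs_tanh_le_one v]

theorem card_filter_card_le (n D : ℕ) :
    ((univ : Finset (Finset (Fin n))).filter fun S => S.card ≤ D).card ≤ (n + 1) ^ D := by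
  have h : (univ : Finset (Finset (Fin n))).filter (fun S => S.card ≤ D) =
      (range (D + 1)).biUnion fun k => powersetCard k univ := by
    ext S
    simp [Finset.mem_powersetCard]
  rw [h]
  refine Finset.card_biUnion_le.trans ?_
  rw [add_pow]
  refine Finset.sum_le_sum fun k hk => ?_
  rw [Finset.card_powersetCard, Finset.card_univ, Fintype.card_fin, one_pow, mul_one]
  exact (Nat.choose_le_pow n k).trans (Nat.le_mul_of_pos_right _
    (Nat.choose_pos (Nat.lt_succ_iff.1 (Finset.mem_range.1 hk))))

theorem sampleProb_residual_gt_le (hP : ∀ x, 0 < P x) (h1 : ∑ x, P x = 1) (hm : 0 < m)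
    {A : Finset (Fin n)} {i : Fin n} (hi : i ∉ A) {φ : Config n → ℝ} {B t : ℝ}
    (hφ : ∀ x y, Agree A x y → φ y = φ x) (hB : ∀ x, |φ x| ≤ B) (ht : 0 ≤ t) :
    sampleProb P m {s | 2 * B * t <
      |sampleMean s fun x => (tanh (logit P A i x) - spin x i) * φ x|} ≤
      2 * exp (-(m * t ^ 2 / 2)) := by
  refine sampleProb_abs_mean_gt_le (fun x => (hP x).le) h1 hm
    (Z := fun x => (tanh (logit P A i x) - spin x i) * φ x) (fun x => ?_)
    (sum_residual_eq_zero hP hi φ hφ) ht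
  rw [abs_mul]
  exact mul_le_mul (abs_tanh_sub_spin_le _ _ _) (hB x) (abs_nonneg _) two_pos.le

theorem sampleProb_entropy_gt_le (hP : ∀ x, 0 < P x) (h1 : ∑ x, P x = 1) (hm : 0 < m)
    {A : Finset (Fin n)} {i : Fin n} {F t : ℝ} (hF : ∀ x, |logit P A i x| ≤ F) (ht : 0 ≤ t) :
    sampleProb P m {s | 2 * F * t <
      |sampleMean s fun x => spinEntropy (logit P A i x) - condEntropy P A i|} ≤
      2 * exp (-(m * t ^ 2 / 2)) := by
  have hup : condEntropy P A i ≤ log 2 := by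
    calc _ ≤ ∑ x, P x * log 2 := Finset.sum_le_sum fun x _ =>
          mul_le_mul_of_nonneg_left (spinEntropy_le _) (hP x).le
      _ = log 2 := by rw [← Finset.sum_mul, h1, one_mul]
  have hlo : log 2 - F ≤ condEntropy P A i := by
    calc log 2 - F = ∑ x, P x * (log 2 - F) := by rw [← Finset.sum_mul, h1, one_mul]
      _ ≤ _ := Finset.sum_le_sum fun x _ => mul_le_mul_of_nonneg_left
          ((sub_le_sub_left (hF x) _).trans (le_spinEntropy _)) (hP x).le
  refine sampleProb_abs_mean_gt_le (fun x => (hP x).le) h1 hm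
    (Z := fun x => spinEntropy (logit P A i x) - condEntropy P A i) (fun x => ?_) ?_ ht
  · have h2 := spinEntropy_le (logit P A i x)
    have h3 := le_spinEntropy (logit P A i x)
    have h4 := hF x
    have h5 := abs_nonneg (logit P A i x)
    rw [abs_le]
    constructor <;> linarith
  · simp only [mul_sub, Finset.sum_sub_distrib, ← Finset.sum_mul, h1, one_mul]
    rw [condEntropy, sub_self]

theorem sampleProb_not_representative_le (hP : ∀ x, 0 < P x) (h1 : ∑ x, P x = 1) (hm : 0 < m)
    {F : ℝ} (hF : ∀ i x, |logit P (univ.erase i) i x| ≤ F) (D : ℕ) {t : ℝ} (ht : 0 ≤ t) :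
    sampleProb P m {s | ¬ Representative P D F t s} ≤
      (n : ℝ) ^ 2 * ((n + 1) ^ D + 2) * (2 * exp (-(m * t ^ 2 / 2))) := by
  have hP' : ∀ x, 0 ≤ P x := fun x => (hP x).le
  set q := 2 * exp (-(m * t ^ 2 / 2)) with hq
  have hq0 : 0 ≤ q := by positivity
  have hFA : ∀ (a : Fin n × Fin n) x, |logit P ((univ.erase a.1).erase a.2) a.1 x| ≤ F :=
    fun a x => abs_logit_le hP (hF a.1) (notMem_erase_erase _ _) x
  let Q1 : (Fin n × Fin n) × Finset (Fin n) → (Fin m → Config n) → Prop := fun a s =>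
    a.2 ⊆ (univ.erase a.1.1).erase a.1.2 ∧ 2 * 1 * t < |sampleMean s fun x =>
      (tanh (logit P ((univ.erase a.1.1).erase a.1.2) a.1.1 x) - spin x a.1.1) * chi a.2 x|
  let Q2 : Fin n × Fin n → (Fin m → Config n) → Prop := fun a s =>
    2 * F * t < |sampleMean s fun x =>
      spinEntropy (logit P ((univ.erase a.1).erase a.2) a.1 x) -
        condEntropy P ((univ.erase a.1).erase a.2) a.1|
  let Q3 : Fin n × Fin n → (Fin m → Config n) → Prop := fun a s =>
    2 * F * t < |sampleMean s fun x =>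
      (tanh (logit P ((univ.erase a.1).erase a.2) a.1 x) - spin x a.1) *
        logit P ((univ.erase a.1).erase a.2) a.1 x|
  set E1 : Set (Fin m → Config n) := {s | ∃ a ∈ (univ : Finset (Fin n × Fin n)) ×ˢ
      ((univ : Finset (Finset (Fin n))).filter fun S => S.card ≤ D), Q1 a s} with hE1
  set E2 : Set (Fin m → Config n) := {s | ∃ a ∈ (univ : Finset (Fin n × Fin n)), Q2 a s} with hE2
  set E3 : Set (Fin m → Config n) := {s | ∃ a ∈ (univ : Finset (Fin n × Fin n)), Q3 a s} with hE3
  have b1 : sampleProb P m E1 ≤ ((n : ℝ) ^ 2 * (n + 1) ^ D) * q := by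
    refine (sampleProb_exists_le hP' _ Q1 (q := q) ?_).trans ?_
    · rintro ⟨a, S⟩ _
      by_cases hS : S ⊆ (univ.erase a.1).erase a.2
      · exact (sampleProb_mono hP' fun s hs => hs.2).trans
          (sampleProb_residual_gt_le hP h1 hm (notMem_erase_erase _ _) (φ := chi S)
            (fun x y hxy => chi_congr hS hxy) (fun x => (abs_chi S x).le) ht)
      · refine le_trans (sampleProb_mono hP' (G := ∅) fun s hs => hS hs.1) ?_
        simpa [sampleProb] using hq0
    · refine mul_le_mul_of_nonneg_right ?_ hq0
      rw [Finset.card_product, Finset.card_univ, Fintype.card_prod, Fintype.card_fin]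
      have := card_filter_card_le n D
      calc ((n * n * _ : ℕ) : ℝ) ≤ ((n * n * (n + 1) ^ D : ℕ) : ℝ) := by
            exact_mod_cast Nat.mul_le_mul_left _ this
        _ = _ := by push_cast; ring
  have hcard : ((univ : Finset (Fin n × Fin n)).card : ℝ) = (n : ℝ) ^ 2 := by
    rw [Finset.card_univ, Fintype.card_prod, Fintype.card_fin]; push_cast; ring
  have b2 : sampleProb P m E2 ≤ (n : ℝ) ^ 2 * q := by
    rw [← hcard]
    exact sampleProb_exists_le hP' _ Q2 fun a _ =>
      sampleProb_entropy_gt_le hP h1 hm (hFA a) ht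
  have b3 : sampleProb P m E3 ≤ (n : ℝ) ^ 2 * q := by
    rw [← hcard]
    exact sampleProb_exists_le hP' _ Q3 fun a _ =>
      sampleProb_residual_gt_le hP h1 hm (notMem_erase_erase _ _)
        (fun x y hxy => logit_congr P hxy) (hFA a) ht
  have hsub : {s : Fin m → Config n | ¬ Representative P D F t s} ⊆ E1 ∪ (E2 ∪ E3) := by
    intro s hs
    by_contra hc
    rw [Set.mem_union, Set.mem_union, not_or, not_or] at hc
    obtain ⟨c1, c2, c3⟩ := hc
    refine hs fun i j => ⟨fun S hS => ?_, ?_, ?_⟩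
    · by_contra h
      obtain ⟨hSA, hSD⟩ := mem_features.1 hS
      rw [not_le] at h
      exact c1 ⟨((i, j), S), by simp [hSD], hSA, by rw [mul_one]; exact h⟩
    · by_contra h
      exact c2 ⟨(i, j), Finset.mem_univ _, not_le.1 h⟩
    · by_contra h
      exact c3 ⟨(i, j), Finset.mem_univ _, not_le.1 h⟩
  have h4 := sampleProb_mono hP' hsub
  have h5 := sampleProb_union_le hP' E1 (E2 ∪ E3)
  have h6 := sampleProb_union_le hP' E2 E3
  calc _ ≤ (n : ℝ) ^ 2 * (n + 1) ^ D * q + ((n : ℝ) ^ 2 * q + (n : ℝ) ^ 2 * q) := by linarith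
    _ = _ := by ring

theorem recoveredNbhd_eq_of_representative (hP : ∀ x, 0 < P x) (hm : 0 < m)
    {lam1 lam2 eta F t e : ℝ} {D : ℕ}
    {N : Fin n → Finset (Fin n)} (hsep : ∀ i, Separates P i (N i))
    (hnd : ∀ i, ∀ j ∈ N i, Nondegenerate P eta i j) (heta : 0 < eta)
    (hF0 : 0 ≤ F) (hFR : F ≤ regRadius lam1 lam2 D) (ht : 0 ≤ t)
    (happ : ∀ i j, (∀ x, logit P (univ.erase i) i (flipAt j x) = logit P (univ.erase i) i x) →
      ∃ v, PolyRep ((univ.erase i).erase j) D (regRadius lam1 lam2 D) v ∧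
        ∀ x, |v x - logit P (univ.erase i) i x| ≤ e)
    (hRt : regRadius lam1 lam2 D * t ≤ eta / 64) (he : e ≤ eta / 16)
    {s : Fin m → Config n} (hs : Representative P D F t s) :
    recoveredNbhd s lam1 lam2 eta D = N := by
  set R := regRadius lam1 lam2 D with hR
  have hR0 : 0 ≤ R := hF0.trans hFR
  have hFt : F * t ≤ eta / 64 := (mul_le_mul_of_nonneg_right hFR ht).trans hRt
  have hii : ∀ i : Fin n, (univ.erase i).erase i = univ.erase i := fun i => by simp
  have hlow : ∀ i j, sampleMean s (fun x => spinEntropy (logit P ((univ.erase i).erase j) i x)) -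
      R * (2 * t) ≤ regLoss s D R ((univ.erase i).erase j) i := fun i j =>
    sampleMean_sub_le_regLoss hR0 _ (hs i j).1
  have hupp : ∀ i j,
      (∀ x, logit P (univ.erase i) i (flipAt j x) = logit P (univ.erase i) i x) →
      regLoss s D R ((univ.erase i).erase j) i ≤
        sampleMean s (fun x => spinEntropy (logit P (univ.erase i) i x)) + 2 * F * t + 2 * e := by
    intro i j hij
    obtain ⟨v, ⟨w, hw, hv⟩, hve⟩ := happ i j hij
    refine (regLoss_le_sampleMean_add hm (logit P (univ.erase i) i) hw (e := e)
      fun x => by rw [← hv x]; exact hve x).trans ?_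
    have := (hs i i).2.2
    rw [hii] at this
    linarith [(abs_le.1 this).2]
  have hmean : ∀ i j, |sampleMean s (fun x => spinEntropy (logit P ((univ.erase i).erase j) i x)) -
      condEntropy P ((univ.erase i).erase j) i| ≤ 2 * F * t := by
    intro i j
    have := (hs i j).2.1
    rw [← sampleMean_const hm s (condEntropy P ((univ.erase i).erase j) i)]
    convert this using 2
    rw [sub_eq_iff_eq_add, ← sampleMean_add]
    simp only [sub_add_cancel]
  have hincl : ∀ i j, i ≠ j → eta ≤ condMutualInfo P i j → 3 * eta / 4 ≤ lossIncrease s D R i j := by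
    intro i j hij h
    rw [condMutualInfo_eq hP hij] at h
    have h1 := hlow i j
    have h2 := hupp i i fun x => logit_flipAt P _ i x
    have h3 := (abs_le.1 (hmean i j)).1
    have h4 := (abs_le.1 (hmean i i)).2
    rw [hii] at h2 h4
    unfold lossIncrease
    linarith
  have hexcl : ∀ i j, (∀ x, logit P (univ.erase i) i (flipAt j x) = logit P (univ.erase i) i x) →
      lossIncrease s D R i j < 3 * eta / 4 := by
    intro i j hij
    have h1 := hlow i i
    have h2 := hupp i j hij
    rw [hii] at h1
    unfold lossIncrease
    linarith
  funext i
  ext j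
  simp only [recoveredNbhd, Finset.mem_filter, Finset.mem_erase, Finset.mem_univ, and_true]
  constructor
  · rintro ⟨hji, h⟩
    by_contra hj
    have hind : ∀ x, logit P (univ.erase i) i (flipAt j x) = logit P (univ.erase i) i x := by
      intro x
      rw [logit_eq_of_separates hP (hsep i), logit_eq_of_separates hP (hsep i)]
      exact logit_congr P (agree_flipAt hj x)
    rcases h with h | h
    · exact absurd (hexcl i j hind) (not_lt.2 h)
    · exact absurd (hexcl j i (logit_flipAt_symm hji.symm hind)) (not_lt.2 h)
  · intro hj
    have hji : j ≠ i := fun h => (hsep i).1 (h ▸ hj)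
    refine ⟨hji, ?_⟩
    rcases hnd i j hj with h | h
    · exact Or.inl (hincl i j hji.symm h)
    · exact Or.inr (hincl j i hji h)

end Structure

/-! ### Parameters of structure recovery -/

section Parameters

theorem abs_le_mul_abs_tanh (W : ℝ) : |W| ≤ (1 + |W|) * |tanh W| := by
  have key : ∀ x : ℝ, 0 ≤ x → x ≤ (1 + x) * tanh x := by
    intro x hx
    rw [Real.tanh_eq_sinh_div_cosh, ← mul_div_assoc, le_div_iff₀ (Real.cosh_pos x),
      Real.cosh_eq, Real.sinh_eq]
    have h1 := Real.add_one_le_exp (2 * x)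
    have h2 : exp x = exp (2 * x) * exp (-x) := by rw [← Real.exp_add]; ring_nf
    have h3 := mul_le_mul_of_nonneg_right h1 (Real.exp_pos (-x)).le
    rw [← h2] at h3
    linarith
  have hnn : ∀ x : ℝ, 0 ≤ x → 0 ≤ tanh x := fun x hx => by
    rw [Real.tanh_eq_sinh_div_cosh]
    exact div_nonneg (Real.sinh_nonneg_iff.2 hx) (Real.cosh_pos x).le
  have habs : |tanh W| = tanh |W| := by
    rcases le_total 0 W with h | h
    · rw [abs_of_nonneg h, abs_of_nonneg (hnn W h)]
    · have := hnn (-W) (neg_nonneg.2 h)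
      rw [abs_of_nonpos h, Real.tanh_neg, abs_of_nonpos]
      rw [Real.tanh_neg] at this
      linarith
  rw [habs]
  exact key _ (abs_nonneg W)

namespace RBM

variable {n nh : ℕ} {M : RBM n nh} {lam1 lam2 : ℝ}

theorem IsBounded.abs_weight_le (h : M.IsBounded lam1 lam2) (i : Fin n) (j : Fin nh) :
    |M.W i j| ≤ lam2 :=
  (Finset.single_le_sum (f := fun i => |M.W i j|) (fun _ _ => abs_nonneg _)
    (Finset.mem_univ i)).trans (h.2 j)

theorem IsBounded.sum_abs_add_le (h : M.IsBounded lam1 lam2) (hl : 0 ≤ lam2) (i : Fin n) :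
    (∑ j, |M.W i j|) + |M.b1 i| ≤ lam1 * (1 + lam2) := by
  have h1 : ∑ j, |M.W i j| ≤ ∑ j, (1 + lam2) * |tanh (M.W i j)| :=
    Finset.sum_le_sum fun j _ => (abs_le_mul_abs_tanh _).trans
      (mul_le_mul_of_nonneg_right (by linarith [h.abs_weight_le i j]) (abs_nonneg _))
  rw [← Finset.mul_sum] at h1
  have h2 := mul_le_mul_of_nonneg_left (h.1 i) (by linarith : 0 ≤ 1 + lam2)
  nlinarith [abs_nonneg (M.b1 i)]

theorem IsBounded.le_of_le_condMutualInfo (h : M.IsBounded lam1 lam2) {eta : ℝ} {i j : Fin n}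
    (hij : i ≠ j) (heta : eta ≤ condMutualInfo M.law i j) : 16 / 25 * eta ≤ lam1 := by
  rcases le_or_gt (9 / 20) lam1 with hl | hl
  · have := condMutualInfo_le_log_two M.law_pos M.sum_law hij
    linarith [Real.log_two_lt_d9]
  · have hW : ∀ l, |M.W i l| ≤ 20 / 11 * |tanh (M.W i l)| := by
      intro l
      have h1 : |tanh (M.W i l)| ≤ lam1 :=
        ((Finset.single_le_sum (f := fun l => |tanh (M.W i l)|) (fun _ _ => abs_nonneg _)
          (Finset.mem_univ l)).trans (le_add_of_nonneg_right (abs_nonneg _))).trans (h.1 i)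
      have h2 := abs_le_mul_abs_tanh (M.W i l)
      have h3 : |M.W i l| * |tanh (M.W i l)| ≤ |M.W i l| * (9 / 20) :=
        mul_le_mul_of_nonneg_left (h1.trans hl.le) (abs_nonneg _)
      linarith
    have hB : ∀ x, |logit M.law (univ.erase i) i x - M.b1 i| ≤ 20 / 11 * lam1 := by
      intro x
      refine (M.abs_logit_law_sub_le i x).trans ((Finset.sum_le_sum fun l _ => hW l).trans ?_)
      rw [← Finset.mul_sum]
      have := h.1 i
      linarith [abs_nonneg (M.b1 i)]
    have h4 := condMutualInfo_le_sq M.law_pos M.sum_law hij hB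
    have h5 : 0 ≤ lam1 := le_trans (add_nonneg (Finset.sum_nonneg fun _ _ => abs_nonneg _)
      (abs_nonneg _)) (h.1 i)
    nlinarith

end RBM

theorem le_regDegree (c lam1 lam2 eta : ℝ) :
    c * lam2 * log (lam1 * lam2 / eta) ≤ regDegree c lam1 lam2 eta := Nat.le_ceil _

theorem approx_error_le {lam1 lam2 eta : ℝ} (hlam : 2 ≤ lam2) (heta : 0 < eta)
    (hT : 16 / 25 * eta ≤ lam1) :
    4 * lam2 * (lam1 * (1 + lam2)) * exp (-(regDegree 100 lam1 lam2 eta / (2 * lam2))) ≤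
      eta / 16 := by
  have hl : 0 < lam2 := by linarith
  have hD := le_regDegree 100 lam1 lam2 eta
  have hlam1 : 0 < lam1 := by linarith
  set T := lam1 * lam2 / eta with hTdef
  have hTlam : 16 / 25 * lam2 ≤ T := by
    rw [hTdef, le_div_iff₀ heta]
    nlinarith
  have hT1 : 32 / 25 ≤ T := by linarith
  have hT0 : 0 < T := by linarith
  have hprod : lam1 * lam2 = eta * T := by rw [hTdef]; field_simp
  have hexp : exp (-(regDegree 100 lam1 lam2 eta / (2 * lam2))) ≤ (T ^ 50)⁻¹ := by
    rw [← Real.exp_log (pow_pos hT0 50), ← Real.exp_neg, Real.log_pow]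
    apply Real.exp_le_exp.2
    rw [neg_le_neg_iff, le_div_iff₀ (by positivity)]
    push_cast
    linarith
  have h48 : 150 ≤ T ^ 48 := by
    calc (150 : ℝ) ≤ (32 / 25) ^ 48 := by norm_num
      _ ≤ T ^ 48 := pow_le_pow_left₀ (by norm_num) hT1 48
  have hpoly : 4 * lam2 * (lam1 * (1 + lam2)) ≤ 75 / 8 * eta * T ^ 2 := by
    calc 4 * lam2 * (lam1 * (1 + lam2)) = 4 * (lam1 * lam2) * (1 + lam2) := by ring
      _ = 4 * (eta * T) * (1 + lam2) := by rw [hprod]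
      _ ≤ 4 * (eta * T) * (75 / 32 * T) := by
          apply mul_le_mul_of_nonneg_left _ (by positivity)
          linarith
      _ = _ := by ring
  calc 4 * lam2 * (lam1 * (1 + lam2)) * exp (-(regDegree 100 lam1 lam2 eta / (2 * lam2)))
      ≤ 75 / 8 * eta * T ^ 2 * (T ^ 50)⁻¹ :=
        mul_le_mul hpoly hexp (Real.exp_pos _).le (by positivity)
    _ = 75 / 8 * eta * (T ^ 48)⁻¹ := by
        have : T ^ 50 = T ^ 2 * T ^ 48 := by ring
        rw [this]
        field_simp
    _ ≤ 75 / 8 * eta * (150 : ℝ)⁻¹ := by gcongr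
    _ ≤ eta / 16 := by linarith

theorem regRadius_le {lam1 lam2 eta : ℝ} (hlam1 : 0 ≤ lam1) (hlam : 2 ≤ lam2) (heta : 0 < eta) :
    regRadius lam1 lam2 (regDegree 100 lam1 lam2 eta) ≤
      18 * eta * lam2 ^ (15 * regDegree 100 lam1 lam2 eta) := by
  have hl : 0 < lam2 := by linarith
  have hD := le_regDegree 100 lam1 lam2 eta
  set D := regDegree 100 lam1 lam2 eta with hDdef
  set T := lam1 * lam2 / eta with hTdef
  have hT0 : 0 ≤ T := by positivity
  have hprod : lam1 * lam2 = eta * T := by rw [hTdef]; field_simp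
  have he : exp 1 ≤ 2.72 := by linarith [Real.exp_one_lt_d9]
  have he0 := Real.exp_pos 1
  rcases Nat.eq_zero_or_pos D with h0 | hpos
  · rw [h0] at hD ⊢
    have hlog : log T ≤ 0 := by
      by_contra h
      push Not at h
      have : 0 < 100 * lam2 * log T := by positivity
      simp at hD
      linarith
    have hT1 : T ≤ 1 := (Real.log_nonpos_iff hT0).1 hlog
    have h1 : lam1 * lam2 ≤ eta := by rw [hprod]; exact mul_le_of_le_one_right heta.le hT1
    have h2 : lam1 * (1 + lam2) ≤ 3 / 2 * eta := by nlinarith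
    simp only [regRadius, Nat.cast_zero, zero_add, Real.sqrt_one, mul_one, pow_one, mul_zero,
      pow_zero]
    calc lam1 * (4 * exp 1) * (1 + lam2) = 4 * exp 1 * (lam1 * (1 + lam2)) := by ring
      _ ≤ 4 * 2.72 * (3 / 2 * eta) := by gcongr
      _ ≤ 18 * eta := by linarith
  · have hlog : log T ≤ D := by
      by_contra h
      push Not at h
      have hD0 : (0 : ℝ) ≤ D := by positivity
      have : (0 : ℝ) < log T := by linarith
      nlinarith
    have hTD : T ≤ lam2 ^ (2 * D) := by
      rcases hT0.eq_or_lt with h | h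
      · rw [← h]; positivity
      · calc T = exp (log T) := (Real.exp_log h).symm
          _ ≤ exp D := Real.exp_le_exp.2 hlog
          _ = exp 1 ^ D := by rw [← Real.exp_nat_mul, mul_one]
          _ ≤ (lam2 ^ 2) ^ D := by
              apply pow_le_pow_left₀ he0.le
              nlinarith
          _ = _ := by rw [← pow_mul]
    have hl1 : lam1 ≤ eta * lam2 ^ (2 * D) := by
      have h3 : lam1 ≤ lam1 * lam2 := le_mul_of_one_le_right hlam1 (by linarith)
      rw [hprod] at h3
      exact h3.trans (mul_le_mul_of_nonneg_left hTD heta.le)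
    have hsqrt : sqrt ((D : ℝ) + 1) ≤ lam2 ^ D := by
      have h4 : ((D : ℝ) + 1) ≤ 2 ^ D := by
        exact_mod_cast Nat.lt_two_pow_self
      have h5 : (2 : ℝ) ^ D ≤ lam2 ^ D := pow_le_pow_left₀ two_pos.le hlam D
      have h6 : (1 : ℝ) ≤ lam2 ^ D := one_le_pow₀ (by linarith)
      rw [Real.sqrt_le_left (by positivity)]
      nlinarith
    have hbase : 4 * exp 1 * (1 + lam2) ≤ lam2 ^ 6 := by
      have h7 : (2 : ℝ) ^ 5 ≤ lam2 ^ 5 := pow_le_pow_left₀ two_pos.le hlam 5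
      calc 4 * exp 1 * (1 + lam2) ≤ 4 * 2.72 * (3 / 2 * lam2) := by
            gcongr
            linarith
        _ ≤ 2 ^ 5 * lam2 := by linarith
        _ ≤ lam2 ^ 5 * lam2 := mul_le_mul_of_nonneg_right h7 hl.le
        _ = lam2 ^ 6 := by ring
    have hpow : (4 * exp 1) ^ (D + 1) * (1 + lam2) ^ (D + 1) ≤ lam2 ^ (12 * D) := by
      rw [← mul_pow]
      calc (4 * exp 1 * (1 + lam2)) ^ (D + 1) ≤ (lam2 ^ 6) ^ (D + 1) :=
            pow_le_pow_left₀ (by positivity) hbase _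
        _ = lam2 ^ (6 * (D + 1)) := by rw [← pow_mul]
        _ ≤ lam2 ^ (12 * D) := pow_le_pow_right₀ (by linarith) (by omega)
    calc regRadius lam1 lam2 D
        = lam1 * sqrt ((D : ℝ) + 1) * ((4 * exp 1) ^ (D + 1) * (1 + lam2) ^ (D + 1)) := by
          unfold regRadius; ring
      _ ≤ eta * lam2 ^ (2 * D) * lam2 ^ D * lam2 ^ (12 * D) := by gcongr
      _ = eta * lam2 ^ (15 * D) := by
          rw [mul_assoc, mul_assoc, ← pow_add, ← pow_add]; congr 2; ring
      _ ≤ 18 * eta * lam2 ^ (15 * D) := by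
          apply mul_le_mul_of_nonneg_right _ (by positivity)
          linarith

theorem mul_pow_le_regRadius {lam1 lam2 : ℝ} (hlam1 : 0 ≤ lam1) (hlam : 2 ≤ lam2) (D : ℕ) :
    lam1 * (1 + lam2) * 3 ^ (D + 1) ≤ regRadius lam1 lam2 D := by
  have h1 : 1 ≤ sqrt ((D : ℝ) + 1) := Real.one_le_sqrt.2 (by simp)
  have h2 : (3 : ℝ) ≤ 4 * exp 1 := by linarith [Real.add_one_le_exp 1]
  have h3 : (1 + lam2) ≤ (1 + lam2) ^ (D + 1) := le_self_pow₀ (by linarith) (by omega)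
  have h4 : 0 ≤ 1 + lam2 := by linarith
  calc lam1 * (1 + lam2) * 3 ^ (D + 1) = lam1 * 1 * 3 ^ (D + 1) * (1 + lam2) := by ring
    _ ≤ lam1 * sqrt ((D : ℝ) + 1) * (4 * exp 1) ^ (D + 1) * (1 + lam2) ^ (D + 1) := by gcongr

theorem union_bound_le {n D m : ℕ} {lam2 del t : ℝ} (hlam : 2 ≤ lam2) (hn : 0 < n)
    (hdel : 0 < del) (hdel1 : del < 1) (hdn : 2 * del ≤ n)
    (ht : t = 1 / (1152 * lam2 ^ (15 * D)))
    (hm : 32000000 * (lam2 ^ (31 * D) * log (2 * n / del)) ≤ m) :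
    (n : ℝ) ^ 2 * ((n + 1) ^ D + 2) * (2 * exp (-(m * t ^ 2 / 2))) ≤ del / 2 := by
  have hl : 0 < lam2 := by linarith
  have hn1 : (1 : ℝ) ≤ n := by exact_mod_cast hn
  set y := 2 * (n : ℝ) / del with hy
  have hy4 : 4 ≤ y := by rw [hy, le_div_iff₀ hdel]; linarith
  have hy0 : 0 < y := by linarith
  have hyn : 2 * (n : ℝ) ≤ y := by
    rw [hy, le_div_iff₀ hdel]; nlinarith
  have hydel : 2 ≤ del * y := by
    rw [hy, mul_div_cancel₀ _ hdel.ne']; linarith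
  have hlog : 0 ≤ log y := Real.log_nonneg (by linarith)
  have hexpo : ((D + 5 : ℕ) : ℝ) * log y ≤ m * t ^ 2 / 2 := by
    have h2D : ((D : ℝ) + 1) ≤ lam2 ^ D := by
      have h4 : ((D : ℝ) + 1) ≤ 2 ^ D := by exact_mod_cast Nat.lt_two_pow_self
      exact h4.trans (pow_le_pow_left₀ two_pos.le hlam D)
    have ht2 : lam2 ^ (31 * D) * t ^ 2 = lam2 ^ D / 1152 ^ 2 := by
      rw [ht, div_pow, mul_pow, ← pow_mul, one_pow]
      rw [show 31 * D = D + 15 * D * 2 by ring, pow_add]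
      field_simp
    calc ((D + 5 : ℕ) : ℝ) * log y ≤ (12 * ((D : ℝ) + 1)) * log y := by
          apply mul_le_mul_of_nonneg_right _ hlog
          push_cast
          have : (0 : ℝ) ≤ D := by positivity
          linarith
      _ ≤ 12 * lam2 ^ D * log y := by gcongr
      _ ≤ 32000000 * (lam2 ^ D / 1152 ^ 2 * log y) / 2 := by
          have : 0 ≤ lam2 ^ D * log y := by positivity
          nlinarith
      _ = 32000000 * (lam2 ^ (31 * D) * log y) * t ^ 2 / 2 := by rw [← ht2]; ring
      _ ≤ m * t ^ 2 / 2 := by gcongr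
  have hexp : exp (-(m * t ^ 2 / 2)) ≤ (y ^ (D + 5))⁻¹ := by
    rw [← Real.exp_log (pow_pos hy0 (D + 5)), ← Real.exp_neg, Real.log_pow]
    exact Real.exp_le_exp.2 (neg_le_neg hexpo)
  have hyD : 1 ≤ y ^ D := one_le_pow₀ (by linarith)
  have hA : ((n : ℝ) + 1) ^ D + 2 ≤ y ^ D * y := by
    have : ((n : ℝ) + 1) ^ D ≤ y ^ D := pow_le_pow_left₀ (by linarith) (by linarith) D
    nlinarith
  have hB : (n : ℝ) ^ 2 ≤ y ^ 2 := pow_le_pow_left₀ (by linarith) (by linarith) 2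
  calc (n : ℝ) ^ 2 * ((n + 1) ^ D + 2) * (2 * exp (-(m * t ^ 2 / 2)))
      ≤ y ^ 2 * (y ^ D * y) * (2 * (y ^ (D + 5))⁻¹) := by gcongr
    _ = 2 / y ^ 2 := by
        rw [pow_add y D 5]
        field_simp
    _ ≤ del / 2 := by
        rw [div_le_iff₀ (by positivity)]
        nlinarith

end Parameters

section StructureRecovery

variable {n nh m : ℕ} {M : RBM n nh} {lam1 lam2 eta del : ℝ}

theorem RBM.IsBounded.exists_polyRep_logit (hM : M.IsBounded lam1 lam2) (hlam : 2 ≤ lam2)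
    (heta : 0 < eta) {N : Fin n → Finset (Fin n)} (hsep : ∀ i, Separates M.law i (N i))
    (hnd : ∀ i, ∀ j ∈ N i, Nondegenerate M.law eta i j) (i j : Fin n)
    (hind : ∀ x, logit M.law (univ.erase i) i (flipAt j x) = logit M.law (univ.erase i) i x) :
    ∃ v, PolyRep ((univ.erase i).erase j) (regDegree 100 lam1 lam2 eta)
      (regRadius lam1 lam2 (regDegree 100 lam1 lam2 eta)) v ∧
      ∀ x, |v x - logit M.law (univ.erase i) i x| ≤ eta / 16 := by
  set D := regDegree 100 lam1 lam2 eta with hD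
  have hlam1 : 0 ≤ lam1 := le_trans (add_nonneg (Finset.sum_nonneg fun _ _ => abs_nonneg _)
      (abs_nonneg _)) (hM.1 i)
  have hF := hM.sum_abs_add_le (by linarith) i
  have hR := mul_pow_le_regRadius hlam1 hlam D
  have h3 : (1 : ℝ) ≤ 3 ^ (D + 1) := one_le_pow₀ (by norm_num)
  by_cases hN : ∃ a b, b ∈ N a
  · obtain ⟨a, b, hab⟩ := hN
    have hne : b ≠ a := fun h => (hsep a).1 (h ▸ hab)
    have hT : 16 / 25 * eta ≤ lam1 := by
      rcases hnd a b hab with h | h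
      · exact hM.le_of_le_condMutualInfo hne.symm h
      · exact hM.le_of_le_condMutualInfo hne h
    have happ : ∃ v, PolyRep ((univ.erase i).erase j) D
        (|M.b1 i| + (∑ j, |M.W i j|) * 3 ^ (D + 1)) v ∧
        ∀ x, |v x - logit M.law (univ.erase i) i x| ≤
          4 * lam2 * (∑ j, |M.W i j|) * exp (-(D / (2 * lam2))) := by
      by_cases hij : i = j
      · subst hij
        obtain ⟨v, hv, hv'⟩ := M.exists_polyRep_response i M.b2 (univ.erase i) hlam hM.2 D
        refine ⟨v, by simpa using hv, fun x => ?_⟩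
        rw [M.logit_law]
        exact hv' x
      · exact M.exists_polyRep_logit hij hlam hM.2 hind D
    obtain ⟨v, hv, hv'⟩ := happ
    refine ⟨v, hv.mono (le_trans ?_ hR), fun x => (hv' x).trans (le_trans ?_
      (approx_error_le hlam heta hT))⟩
    · nlinarith [abs_nonneg (M.b1 i)]
    · have : ∑ j, |M.W i j| ≤ lam1 * (1 + lam2) := by linarith [abs_nonneg (M.b1 i)]
      gcongr
  · push Not at hN
    have hNi : N i = ∅ := Finset.eq_empty_of_forall_notMem (hN i)
    have hconst : ∀ x, logit M.law (univ.erase i) i x = logit M.law ∅ i 1 := by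
      intro x
      rw [logit_eq_of_separates M.law_pos (hsep i), hNi]
      exact logit_congr _ fun a ha => absurd ha (Finset.notMem_empty a)
    refine ⟨_, (PolyRep.const (logit M.law ∅ i 1)).mono ?_, fun x => ?_⟩
    · rw [← hconst 1]
      refine (M.abs_logit_law_le i 1).trans (hF.trans (le_trans ?_ hR))
      exact le_mul_of_one_le_right (by nlinarith) h3
    · rw [hconst x, sub_self, abs_zero]; positivity

theorem RBM.IsBounded.sampleProb_recoveredNbhd_ne_le (hM : M.IsBounded lam1 lam2)
    (hlam : 2 ≤ lam2) (heta : 0 < eta) (hn : 0 < n) (hdel : 0 < del) (hdel1 : del < 1)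
    (hdn : 2 * del ≤ n) {N : Fin n → Finset (Fin n)} (hsep : ∀ i, Separates M.law i (N i))
    (hnd : ∀ i, ∀ j ∈ N i, Nondegenerate M.law eta i j) (hm0 : 0 < m)
    (hm : 32000000 * (lam2 ^ (31 * regDegree 100 lam1 lam2 eta) * log (2 * n / del)) ≤ m) :
    sampleProb M.law m {s | recoveredNbhd s lam1 lam2 eta (regDegree 100 lam1 lam2 eta) ≠ N} ≤
      del / 2 := by
  set D := regDegree 100 lam1 lam2 eta with hD
  have hl : 0 < lam2 := by linarith
  have hlam1 : 0 ≤ lam1 := le_trans (add_nonneg (Finset.sum_nonneg fun _ _ => abs_nonneg _)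
      (abs_nonneg _)) (hM.1 ⟨0, hn⟩)
  set t := 1 / (1152 * lam2 ^ (15 * D)) with ht
  have ht0 : 0 ≤ t := by positivity
  have hF : ∀ i x, |logit M.law (univ.erase i) i x| ≤ lam1 * (1 + lam2) := fun i x =>
    (M.abs_logit_law_le i x).trans (hM.sum_abs_add_le hl.le i)
  have h3 : (1 : ℝ) ≤ 3 ^ (D + 1) := one_le_pow₀ (by norm_num)
  have hF0 : 0 ≤ lam1 * (1 + lam2) := by positivity
  have hRt : regRadius lam1 lam2 D * t ≤ eta / 64 := by
    calc regRadius lam1 lam2 D * t ≤ 18 * eta * lam2 ^ (15 * D) * t :=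
          mul_le_mul_of_nonneg_right (regRadius_le hlam1 hlam heta) ht0
      _ = eta / 64 := by rw [ht]; field_simp; norm_num
  refine le_trans (sampleProb_mono (fun x => (M.law_pos x).le) fun s hs => ?_)
    ((sampleProb_not_representative_le M.law_pos M.sum_law hm0 hF D ht0).trans
      (union_bound_le hlam hn hdel hdel1 hdn ht hm))
  intro hrep
  exact hs (recoveredNbhd_eq_of_representative M.law_pos hm0 hsep hnd heta hF0
    ((le_mul_of_one_le_right hF0 h3).trans (mul_pow_le_regRadius hlam1 hlam D)) ht0
    (hM.exists_polyRep_logit hlam heta hsep hnd) hRt le_rfl hrep)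

end StructureRecovery

/-! ### Fourier analysis of Markov random fields -/

section Fourier

variable {n : ℕ}

theorem chi_flipAt_of_mem {U : Finset (Fin n)} {k : Fin n} (hk : k ∈ U) (x : Config n) :
    chi U (flipAt k x) = -chi U x := by
  unfold chi
  rw [← Finset.mul_prod_erase U _ hk, ← Finset.mul_prod_erase U _ hk, spin_flipAt_self,
    Finset.prod_congr rfl fun j hj => spin_flipAt_ne (Finset.ne_of_mem_erase hj) x]
  ring

theorem chi_flipAt_of_notMem {U : Finset (Fin n)} {k : Fin n} (hk : k ∉ U) (x : Config n) :
    chi U (flipAt k x) = chi U x :=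
  chi_congr (Finset.Subset.refl U) (agree_flipAt hk x)

theorem sum_mul_chi_eq_zero {U : Finset (Fin n)} {k : Fin n} (hk : k ∈ U) {F : Config n → ℝ}
    (hF : ∀ x, F (flipAt k x) = F x) : ∑ x, F x * chi U x = 0 := by
  rw [sum_eq_half_sum_add_flipAt k, Finset.sum_eq_zero, zero_div]
  intro x _
  rw [hF, chi_flipAt_of_mem hk]
  ring

theorem card_config : (Fintype.card (Config n) : ℝ) = 2 ^ n := by
  rw [Fintype.card_fun, Fintype.card_fin, Fintype.card_units_int]
  norm_num

theorem sum_chi_mul_chi (x y : Config n) :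
    ∑ S : Finset (Fin n), chi S x * chi S y = if y = x then 2 ^ n else 0 := by
  have h : ∏ j, (1 + spin x j * spin y j) = ∑ S : Finset (Fin n), chi S x * chi S y := by
    rw [Finset.prod_one_add, Finset.powerset_univ]
    exact Finset.sum_congr rfl fun S _ => Finset.prod_mul_distrib
  rw [← h]
  split_ifs with hxy
  · subst hxy
    simp only [spin_mul_self]
    norm_num
  · obtain ⟨j, hj⟩ := Function.ne_iff.1 hxy
    refine Finset.prod_eq_zero (Finset.mem_univ j) ?_
    rcases Int.units_eq_one_or (x j) with h1 | h1 <;>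
    rcases Int.units_eq_one_or (y j) with h2 | h2 <;> simp_all [spin]

theorem fourier_inversion (F : Config n → ℝ) (x : Config n) :
    ∑ S : Finset (Fin n), (1 / (2 : ℝ) ^ n * ∑ y, F y * chi S y) * chi S x = F x := by
  have h : ∀ S : Finset (Fin n), (1 / (2 : ℝ) ^ n * ∑ y, F y * chi S y) * chi S x =
      ∑ y, 1 / (2 : ℝ) ^ n * F y * (chi S x * chi S y) := by
    intro S
    rw [Finset.mul_sum, Finset.sum_mul]
    exact Finset.sum_congr rfl fun y _ => by ring
  simp only [h]
  rw [Finset.sum_comm]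
  simp only [← Finset.mul_sum, sum_chi_mul_chi, mul_ite, mul_zero]
  rw [Finset.sum_ite_eq' univ x, if_pos (Finset.mem_univ x)]
  field_simp

/-- The kernel of the averaged noise operator acting on the coordinates other than `i`. -/
def noiseKernel (i : Fin n) (x y : Config n) : ℝ :=
  1 / (2 : ℝ) ^ n * ∑ U ∈ (univ.erase i).powerset, 1 / ((U.card : ℝ) + 1) * (chi U x * chi U y)

theorem noiseKernel_nonneg (i : Fin n) (x y : Config n) : 0 ≤ noiseKernel i x y := by
  have h : ∫ r : ℝ in (0 : ℝ)..1, ∏ j ∈ univ.erase i, (1 + r * (spin x j * spin y j)) =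
      ∑ U ∈ (univ.erase i).powerset, 1 / ((U.card : ℝ) + 1) * (chi U x * chi U y) := by
    have e : ∀ r : ℝ, ∏ j ∈ univ.erase i, (1 + r * (spin x j * spin y j)) =
        ∑ U ∈ (univ.erase i).powerset, r ^ U.card * (chi U x * chi U y) := by
      intro r
      rw [Finset.prod_one_add]
      refine Finset.sum_congr rfl fun U _ => ?_
      rw [Finset.prod_mul_distrib, Finset.prod_const, Finset.prod_mul_distrib]
      rfl
    simp only [e]
    rw [intervalIntegral.integral_finsetSum fun U _ =>
      (Continuous.intervalIntegrable (by fun_prop) _ _)]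
    refine Finset.sum_congr rfl fun U _ => ?_
    rw [intervalIntegral.integral_mul_const, integral_pow]
    simp
  rw [noiseKernel, ← h]
  refine mul_nonneg (by positivity) (intervalIntegral.integral_nonneg zero_le_one ?_)
  intro r hr
  refine Finset.prod_nonneg fun j _ => ?_
  have h1 : |spin x j * spin y j| = 1 := by rw [abs_mul, abs_spin, abs_spin, one_mul]
  have h2 := (abs_le.1 h1.le).1
  nlinarith [hr.1, hr.2]

theorem sum_noiseKernel (i : Fin n) (x : Config n) : ∑ y, noiseKernel i x y = 1 := by
  unfold noiseKernel
  rw [← Finset.mul_sum, Finset.sum_comm, Finset.sum_eq_single ∅]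
  · simp only [Finset.card_empty, chi, Finset.prod_empty]
    rw [Finset.sum_const, Finset.card_univ, nsmul_eq_mul, card_config]
    norm_num
  · intro U _ hU
    obtain ⟨k, hk⟩ := Finset.nonempty_iff_ne_empty.2 hU
    have := sum_mul_chi_eq_zero hk (F := fun _ => 1 / ((U.card : ℝ) + 1) * chi U x)
      fun _ => rfl
    simpa only [mul_assoc] using this
  · intro h
    exact absurd (Finset.empty_mem_powerset _) h

theorem sum_filter_mem_eq (i : Fin n) (g : Finset (Fin n) → ℝ) :
    ∑ S ∈ univ.filter (fun S : Finset (Fin n) => i ∈ S), g S =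
      ∑ U ∈ (univ.erase i).powerset, g (insert i U) := by
  refine Finset.sum_nbij' (fun S => S.erase i) (fun U => insert i U) ?_ ?_ ?_ ?_ ?_
  · intro S _
    exact Finset.mem_powerset.2 (Finset.erase_subset_erase i (Finset.subset_univ S))
  · intro U _
    simp
  · intro S hS
    exact Finset.insert_erase (Finset.mem_filter.1 hS).2
  · intro U hU
    exact Finset.erase_insert fun h => Finset.notMem_erase i univ (Finset.mem_powerset.1 hU h)
  · intro S hS
    rw [Finset.insert_erase (Finset.mem_filter.1 hS).2]

/-- The log-density of the recovered field in terms of the predicted log-odds. -/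
theorem sum_mrfCoeff_mul_chi (f : Fin n → Config n → ℝ) (x : Config n) :
    ∑ S : Finset (Fin n), mrfCoeff f S * chi S x =
      ∑ i, spin x i * ∑ y, noiseKernel i x y * artanh (f i y) := by
  have h1 : ∀ S : Finset (Fin n), mrfCoeff f S * chi S x =
      ∑ i, if i ∈ S then 1 / (S.card : ℝ) * nodeCoeff f S i * chi S x else 0 := by
    intro S
    rw [mrfCoeff, Finset.mul_sum, Finset.sum_mul, ← Finset.sum_filter]
    refine Finset.sum_congr ?_ fun _ _ => rfl
    ext i; simp
  simp only [h1]
  rw [Finset.sum_comm]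
  refine Finset.sum_congr rfl fun i _ => ?_
  rw [← Finset.sum_filter, sum_filter_mem_eq]
  have h2 : ∀ y, noiseKernel i x y * artanh (f i y) = ∑ U ∈ (univ.erase i).powerset,
      1 / (2 : ℝ) ^ n * (1 / ((U.card : ℝ) + 1) * (chi U x * chi U y)) * artanh (f i y) := by
    intro y
    rw [noiseKernel, Finset.mul_sum, Finset.sum_mul]
  simp only [h2]
  rw [Finset.sum_comm, Finset.mul_sum]
  refine Finset.sum_congr rfl fun U hU => ?_
  have hi : i ∉ U := fun h => Finset.notMem_erase i univ (Finset.mem_powerset.1 hU h)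
  have h3 : chi (insert i U) x = spin x i * chi U x := by
    unfold chi; rw [Finset.prod_insert hi]
  rw [nodeCoeff, Finset.erase_insert hi, Finset.card_insert_of_notMem hi, h3, Finset.mul_sum,
    Finset.mul_sum, Finset.sum_mul, Finset.mul_sum]
  push_cast
  exact Finset.sum_congr rfl fun y _ => by ring

theorem sum_mrfSets_eq {N : Fin n → Finset (Fin n)} {f : Fin n → Config n → ℝ}
    (hf : ∀ i x y, Agree (N i) x y → f i y = f i x) (x : Config n) :
    ∑ S ∈ mrfSets N, mrfCoeff f S * chi S x = ∑ S : Finset (Fin n), mrfCoeff f S * chi S x := by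
  refine Finset.sum_subset (Finset.subset_univ _) fun S _ hS => ?_
  have h0 : mrfCoeff f S = 0 := by
    rw [mrfCoeff, Finset.sum_eq_zero, mul_zero]
    intro i _
    have hSi : ¬ S ⊆ insert i (N i) := fun h => hS (by
      simp only [mrfSets, Finset.mem_filter, Finset.mem_univ, true_and]
      exact ⟨i, h⟩)
    obtain ⟨k, hkS, hk⟩ := Finset.not_subset.1 hSi
    rw [Finset.mem_insert, not_or] at hk
    rw [nodeCoeff, sum_mul_chi_eq_zero (Finset.mem_erase.2 ⟨hk.1, hkS⟩), mul_zero]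
    intro y
    rw [hf i y _ (agree_flipAt hk.2 y)]
  rw [h0, zero_mul]

theorem mrfCoeff_tanh_logit (P : Config n → ℝ) {S : Finset (Fin n)} (hS : S.Nonempty) :
    mrfCoeff (fun i x => tanh (logit P (univ.erase i) i x)) S =
      1 / (2 : ℝ) ^ n * ∑ y, log (P y) * chi S y := by
  have h : ∀ i ∈ S, nodeCoeff (fun i x => tanh (logit P (univ.erase i) i x)) S i =
      1 / (2 : ℝ) ^ n * ∑ y, log (P y) * chi S y := by
    intro i hi
    rw [nodeCoeff]
    congr 1
    have hchi : ∀ y : Config n, chi S y = spin y i * chi (S.erase i) y := fun y =>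
      (Finset.mul_prod_erase S (fun j => spin y j) hi).symm
    rw [sum_eq_half_sum_add_flipAt i, sum_eq_half_sum_add_flipAt i (fun y => log (P y) * chi S y)]
    congr 1
    refine Finset.sum_congr rfl fun y _ => ?_
    simp only [Real.artanh_tanh]
    rw [logit_flipAt, chi_flipAt_of_notMem (Finset.notMem_erase i S), chi_flipAt_of_mem hi,
      logit_univ_erase, hchi y]
    ring
  rw [mrfCoeff, Finset.sum_congr rfl h, Finset.sum_const, nsmul_eq_mul]
  have : (S.card : ℝ) ≠ 0 := by exact_mod_cast hS.card_pos.ne'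
  field_simp

/-- Every positive distribution is the field built from its own conditional expectations. -/
theorem exists_log_eq_add_sum (P : Config n → ℝ) :
    ∃ c : ℝ, ∀ x, log (P x) = c +
      ∑ i, spin x i * ∑ y, noiseKernel i x y * logit P (univ.erase i) i y := by
  refine ⟨1 / (2 : ℝ) ^ n * ∑ y, log (P y) * chi ∅ y, fun x => ?_⟩
  have h1 := sum_mrfCoeff_mul_chi (fun i x => tanh (logit P (univ.erase i) i x)) x
  simp only [Real.artanh_tanh] at h1
  rw [← h1, ← fourier_inversion (fun y => log (P y)) x,
    ← Finset.add_sum_erase univ _ (Finset.mem_univ ∅),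
    ← Finset.add_sum_erase univ (fun S => mrfCoeff _ S * chi S x) (Finset.mem_univ ∅)]
  have h2 : mrfCoeff (fun i x => tanh (logit P (univ.erase i) i x)) ∅ = 0 := by simp [mrfCoeff]
  rw [h2, zero_mul, zero_add]
  congr 1
  · simp [chi]
  · refine Finset.sum_congr rfl fun S hS => ?_
    rw [mrfCoeff_tanh_logit P (Finset.nonempty_iff_ne_empty.2 (Finset.ne_of_mem_erase hS))]

/-- The error of the log-density recovered from predictors `f`. -/
def logDensityError (P : Config n → ℝ) (f : Fin n → Config n → ℝ) (x : Config n) : ℝ :=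
  ∑ i, spin x i * ∑ y, noiseKernel i x y * (artanh (f i y) - logit P (univ.erase i) i y)

theorem exists_mrfWeight_eq {P : Config n → ℝ} (hP : ∀ x, 0 < P x) {N : Fin n → Finset (Fin n)}
    {f : Fin n → Config n → ℝ} (hf : ∀ i x y, Agree (N i) x y → f i y = f i x) :
    ∃ c : ℝ, 0 < c ∧ ∀ x, mrfWeight N f x = c * (P x * exp (logDensityError P f x)) := by
  obtain ⟨c, hc⟩ := exists_log_eq_add_sum P
  refine ⟨exp (-c), Real.exp_pos _, fun x => ?_⟩
  conv_rhs => rw [← Real.exp_log (hP x)]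
  rw [← Real.exp_add, ← Real.exp_add, mrfWeight, sum_mrfSets_eq hf, sum_mrfCoeff_mul_chi,
    hc x, logDensityError]
  congr 1
  simp only [mul_sub, Finset.sum_sub_distrib]
  ring

end Fourier

/-! ### Total variation distance -/

section TotalVariation

variable {n : ℕ} {P : Config n → ℝ}

theorem abs_exp_sub_one_le_exp_abs (u : ℝ) : |exp u - 1| ≤ exp |u| - 1 := by
  rcases le_total 0 u with h | h
  · rw [abs_of_nonneg h, abs_of_nonneg (by linarith [Real.one_le_exp h])]
  · rw [abs_of_nonpos h, abs_of_nonpos (by linarith [Real.exp_le_one_iff.2 h])]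
    have := Real.one_le_cosh u
    rw [Real.cosh_eq] at this
    linarith

theorem tvDist_le_of_exp_moment (hP : ∀ x, 0 < P x) (h1 : ∑ x, P x = 1) {w Δ : Config n → ℝ}
    {c a : ℝ} (hc : 0 < c) (hw : ∀ x, w x = c * (P x * exp (Δ x)))
    (ha : ∑ x, P x * exp |Δ x| ≤ 1 + a) (ha2 : a ≤ 1 / 2) :
    tvDist (fun x => w x / ∑ y, w y) P ≤ 2 * a := by
  set Z := ∑ x, P x * exp (Δ x) with hZ
  have hZ1 : ∑ x, P x * |exp (Δ x) - 1| ≤ a := by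
    calc _ ≤ ∑ x, P x * (exp |Δ x| - 1) := Finset.sum_le_sum fun x _ =>
          mul_le_mul_of_nonneg_left (abs_exp_sub_one_le_exp_abs _) (hP x).le
      _ = ∑ x, P x * exp |Δ x| - 1 := by
          simp only [mul_sub, Finset.sum_sub_distrib, mul_one, h1]
      _ ≤ a := by linarith
  have hZ2 : |Z - 1| ≤ a := by
    have e : Z - 1 = ∑ x, P x * (exp (Δ x) - 1) := by
      simp only [mul_sub, Finset.sum_sub_distrib, mul_one, h1, hZ]
    rw [e]
    refine (Finset.abs_sum_le_sum_abs _ _).trans (le_trans (le_of_eq ?_) hZ1)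
    exact Finset.sum_congr rfl fun x _ => by rw [abs_mul, abs_of_pos (hP x)]
  have hZh : 1 / 2 ≤ Z := by linarith [(abs_le.1 hZ2).1]
  have hZ0 : 0 < Z := by linarith
  have hsum : ∑ y, w y = c * Z := by simp only [hw, ← Finset.mul_sum, hZ]
  have hterm : ∀ x, |w x / (∑ y, w y) - P x| ≤
      (P x * |exp (Δ x) - 1| + P x * |Z - 1|) / Z := by
    intro x
    have e : w x / (∑ y, w y) - P x = P x * ((exp (Δ x) - 1) - (Z - 1)) / Z := by
      rw [hsum, hw]; field_simp; ring
    rw [e, abs_div, abs_mul, abs_of_pos (hP x), abs_of_pos hZ0, ← mul_add]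
    gcongr
    · exact (hP x).le
    · exact abs_sub _ _
  have htot : ∑ x, |w x / (∑ y, w y) - P x| ≤ (a + a) / Z := by
    refine (Finset.sum_le_sum fun x _ => hterm x).trans ?_
    rw [← Finset.sum_div, Finset.sum_add_distrib, ← Finset.sum_mul, h1, one_mul]
    gcongr
  have ha0 : 0 ≤ a := (abs_nonneg _).trans hZ2
  have hfin : (a + a) / Z ≤ 4 * a := by
    rw [div_le_iff₀ hZ0]; nlinarith
  unfold tvDist
  linarith

/-- Exponential moments of the error of the log-density are controlled by those of the errors of
the predicted log-odds. -/
theorem exp_mul_abs_logDensityError_le (hn : 0 < n) (f : Fin n → Config n → ℝ) {l : ℝ}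
    (hl : 0 ≤ l) (x : Config n) :
    exp (l * |logDensityError P f x|) ≤ 1 / (n : ℝ) * ∑ i, ∑ y, noiseKernel i x y *
      exp (l * n * |artanh (f i y) - logit P (univ.erase i) i y|) := by
  have hn' : (0 : ℝ) < n := by exact_mod_cast hn
  set g : Fin n → Config n → ℝ := fun i y => artanh (f i y) - logit P (univ.erase i) i y with hg
  have h1 : |logDensityError P f x| ≤ ∑ i, ∑ y, noiseKernel i x y * |g i y| := by
    refine (Finset.abs_sum_le_sum_abs _ _).trans (Finset.sum_le_sum fun i _ => ?_)
    rw [abs_mul, abs_spin, one_mul]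
    refine (Finset.abs_sum_le_sum_abs _ _).trans (le_of_eq (Finset.sum_congr rfl fun y _ => ?_))
    rw [abs_mul, abs_of_nonneg (noiseKernel_nonneg i x y)]
  have h2 := convexOn_exp.map_sum_le (t := (univ : Finset (Fin n × Config n)))
    (w := fun a => 1 / (n : ℝ) * noiseKernel a.1 x a.2) (p := fun a => l * n * |g a.1 a.2|)
    (fun a _ => mul_nonneg (by positivity) (noiseKernel_nonneg _ _ _))
    (by
      rw [← Finset.mul_sum, Fintype.sum_prod_type]
      simp only [sum_noiseKernel]
      simp [hn'.ne'])
    (fun _ _ => Set.mem_univ _)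
  simp only [smul_eq_mul] at h2
  rw [Fintype.sum_prod_type, Fintype.sum_prod_type] at h2
  refine le_trans (Real.exp_le_exp.2 ?_) (h2.trans (le_of_eq ?_))
  · refine (mul_le_mul_of_nonneg_left h1 hl).trans (le_of_eq ?_)
    simp only [Finset.mul_sum]
    refine Finset.sum_congr rfl fun i _ => Finset.sum_congr rfl fun y _ => ?_
    field_simp
  · simp only [Finset.mul_sum]
    exact Finset.sum_congr rfl fun i _ => Finset.sum_congr rfl fun y _ => by ring

end TotalVariation

/-! ### Empirical conditional expectations -/

section Empirical

variable {n m : ℕ} {P : Config n → ℝ}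

theorem sampleCount_eq_add (s : Fin m → Config n) {A : Finset (Fin n)} {i : Fin n} (hi : i ∉ A)
    (x : Config n) : (sampleCount s A x : ℝ) =
      sampleCount s (insert i A) x + sampleCount s (insert i A) (flipAt i x) := by
  rw [sampleCount_eq_sum, sampleCount_eq_sum, sampleCount_eq_sum, ← Finset.sum_add_distrib]
  refine Finset.sum_congr rfl fun k _ => ?_
  obtain ⟨h1, h2⟩ := agree_insert_or hi x (s k)
  rw [if_congr h1 rfl rfl]
  by_cases ha : Agree (insert i A) x (s k) <;> by_cases hb : Agree (insert i A) (flipAt i x) (s k)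
  · exact absurd ⟨ha, hb⟩ h2
  · rw [if_pos (Or.inl ha), if_pos ha, if_neg hb, add_zero]
  · rw [if_pos (Or.inr hb), if_neg ha, if_pos hb, zero_add]
  · rw [if_neg (by tauto), if_neg ha, if_neg hb, zero_add]

theorem sum_spin_eq (s : Fin m → Config n) {A : Finset (Fin n)} {i : Fin n} (hi : i ∉ A)
    (x : Config n) : ∑ k ∈ univ.filter (fun k => Agree A x (s k)), spin (s k) i =
      spin x i *
        (sampleCount s (insert i A) x - sampleCount s (insert i A) (flipAt i x)) := by
  rw [sampleCount_eq_sum, sampleCount_eq_sum, ← Finset.sum_sub_distrib, Finset.mul_sum,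
    Finset.sum_filter]
  refine Finset.sum_congr rfl fun k _ => ?_
  obtain ⟨h1, h2⟩ := agree_insert_or hi x (s k)
  rw [if_congr h1 rfl rfl]
  by_cases ha : Agree (insert i A) x (s k) <;> by_cases hb : Agree (insert i A) (flipAt i x) (s k)
  · exact absurd ⟨ha, hb⟩ h2
  · rw [if_pos (Or.inl ha), if_pos ha, if_neg hb, spin_congr (ha i (Finset.mem_insert_self i A))]
    ring
  · rw [if_pos (Or.inr hb), if_neg ha, if_pos hb, spin_congr (hb i (Finset.mem_insert_self i A)),
      spin_flipAt_self]
    ring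
  · rw [if_neg (by tauto), if_neg ha, if_neg hb]
    ring

theorem empCondExp_eq (s : Fin m → Config n) {A : Finset (Fin n)} {i : Fin n} (hi : i ∉ A)
    {x : Config n} (h1 : 0 < sampleCount s (insert i A) x)
    (h2 : 0 < sampleCount s (insert i A) (flipAt i x)) :
    empCondExp s A i x = tanh (spin x i * ((log (sampleCount s (insert i A) x) -
      log (sampleCount s (insert i A) (flipAt i x))) / 2)) := by
  have h1' : (0 : ℝ) < sampleCount s (insert i A) x := by exact_mod_cast h1
  have h2' : (0 : ℝ) < sampleCount s (insert i A) (flipAt i x) := by exact_mod_cast h2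
  rw [empCondExp, sum_spin_eq s hi, sampleCount_eq_add s hi, mul_div_assoc,
    ← tanh_half_log_sub h1' h2']
  rcases spin_eq_one_or x i with h | h <;> rw [h]
  · rw [one_mul, one_mul]
  · rw [neg_one_mul, neg_one_mul, Real.tanh_neg]

theorem empCondExp_congr (s : Fin m → Config n) {A : Finset (Fin n)} {i : Fin n}
    {x y : Config n} (h : Agree A x y) : empCondExp s A i y = empCondExp s A i x := by
  have e : ∀ z, Agree A y z ↔ Agree A x z := fun z =>
    ⟨fun hz a ha => (hz a ha).trans (h a ha), fun hz a ha => (hz a ha).trans (h a ha).symm⟩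
  have e2 : univ.filter (fun k => Agree A y (s k)) = univ.filter (fun k => Agree A x (s k)) :=
    Finset.filter_congr fun k _ => e (s k)
  rw [empCondExp, empCondExp, sampleCount, sampleCount, e2]

theorem sampleCount_pos_of_abs_countDev_le {s : Fin m → Config n} {B : Finset (Fin n)}
    {x : Config n} (h : |countDev P s B x| ≤ 1 / 2) : 0 < sampleCount s B x := by
  rw [Nat.pos_iff_ne_zero]
  intro h0
  rw [countDev, h0] at h
  norm_num at h

theorem abs_log_one_add_le {r : ℝ} (h : |r| ≤ 1 / 2) : |log (1 + r)| ≤ 2 * |r| := by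
  have h' := abs_le.1 h
  have hp : 0 < 1 + r := by linarith
  have h1 := Real.log_le_sub_one_of_pos hp
  have h2 := Real.one_sub_inv_le_log_of_pos hp
  have h3 : -(2 * |r|) ≤ 1 - (1 + r)⁻¹ := by
    have : 1 - (1 + r)⁻¹ = r / (1 + r) := by field_simp; ring
    rw [this, le_div_iff₀ hp]
    rcases abs_cases r with ⟨h4, _⟩ | ⟨h4, _⟩ <;> rw [h4] <;> nlinarith
  rw [abs_le]
  constructor
  · linarith
  · linarith [le_abs_self r, abs_nonneg r]

theorem log_sampleCount (hP : ∀ x, 0 < P x) (hm : 0 < m) {s : Fin m → Config n}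
    {B : Finset (Fin n)} {x : Config n} (h : |countDev P s B x| ≤ 1 / 2) :
    log (sampleCount s B x) = log m + log (marg P B x) + log (1 + countDev P s B x) := by
  have hm' : (0 : ℝ) < m := by exact_mod_cast hm
  have hp := marg_pos hP B x
  have hr : 0 < 1 + countDev P s B x := by linarith [(abs_le.1 h).1]
  rw [← Real.log_mul hm'.ne' hp.ne', ← Real.log_mul (by positivity) hr.ne']
  congr 1
  rw [countDev]
  field_simp
  ring

theorem abs_artanh_empCondExp_sub_logit_le (hP : ∀ x, 0 < P x) (hm : 0 < m)
    {s : Fin m → Config n} {A : Finset (Fin n)} {i : Fin n} (hi : i ∉ A) {x : Config n}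
    (h1 : |countDev P s (insert i A) x| ≤ 1 / 2)
    (h2 : |countDev P s (insert i A) (flipAt i x)| ≤ 1 / 2) :
    |artanh (empCondExp s A i x) - logit P A i x| ≤
      |countDev P s (insert i A) x| + |countDev P s (insert i A) (flipAt i x)| := by
  rw [empCondExp_eq s hi (sampleCount_pos_of_abs_countDev_le h1)
    (sampleCount_pos_of_abs_countDev_le h2), Real.artanh_tanh, log_sampleCount hP hm h1,
    log_sampleCount hP hm h2, logit_eq, ← mul_sub, abs_mul, abs_spin, one_mul]
  have a := abs_le.1 (abs_log_one_add_le h1)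
  have b := abs_le.1 (abs_log_one_add_le h2)
  rw [abs_le]
  constructor <;> linarith [a.1, a.2, b.1, b.2]

theorem wellDefinedRun_of_abs_countDev_le {s : Fin m → Config n} {N : Fin n → Finset (Fin n)}
    (hN : ∀ i, i ∉ N i) (h : ∀ i x, |countDev P s (insert i (N i)) x| ≤ 1 / 2) :
    WellDefinedRun s N := by
  intro i x
  have h1 := sampleCount_pos_of_abs_countDev_le (h i x)
  have h2 := sampleCount_pos_of_abs_countDev_le (h i (flipAt i x))
  refine ⟨?_, ?_⟩
  · have := sampleCount_eq_add s (hN i) x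
    have e : sampleCount s (N i) x = sampleCount s (insert i (N i)) x +
        sampleCount s (insert i (N i)) (flipAt i x) := by exact_mod_cast this
    omega
  · rw [empCondExp_eq s (hN i) h1 h2]
    exact abs_lt.2 ⟨Real.neg_one_lt_tanh _, Real.tanh_lt_one _⟩

/-- Every assignment to a set of coordinates is bounded below in probability. -/
theorem pow_card_le_marg (hP : ∀ x, 0 < P x) (h1 : ∑ x, P x = 1) {L : ℝ}
    (hL : ∀ i x, |logit P (univ.erase i) i x| ≤ L) (B : Finset (Fin n)) (x : Config n) :
    ((1 - tanh L) / 2) ^ B.card ≤ marg P B x := by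
  induction B using Finset.induction_on with
  | empty =>
    have : marg P ∅ x = 1 := by
      rw [← h1]
      exact Finset.sum_congr rfl fun y _ => if_pos fun a ha => absurd ha (Finset.notMem_empty a)
    rw [this, Finset.card_empty, pow_zero]
  | insert i B hi ih =>
    have hα : (1 - tanh L) / 2 = 1 / (1 + exp (2 * L)) := by
      rw [Real.tanh_eq_sinh_div_cosh, Real.sinh_eq, Real.cosh_eq, two_mul, Real.exp_add,
        Real.exp_neg]
      have := Real.exp_pos L
      field_simp
      ring
    have hflip : ∀ x, P x ≤ exp (2 * L) * P (flipAt i x) := by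
      intro x
      have := hL i x
      rw [logit_univ_erase, abs_mul, abs_spin, one_mul] at this
      have h2 := (abs_le.1 this).2
      rw [← Real.exp_log (hP x), ← Real.exp_log (hP (flipAt i x)), ← Real.exp_add]
      apply Real.exp_le_exp.2
      linarith
    have h3 := marg_insert_le hflip hi (flipAt i x)
    rw [flipAt_flipAt] at h3
    have h4 : 1 / (1 + exp (2 * L)) * marg P B x ≤ marg P (insert i B) x := by
      rw [one_div_mul_eq_div, div_le_iff₀ (by positivity), marg_eq_add P hi x]
      linarith
    rw [Finset.card_insert_of_notMem hi, pow_succ, mul_comm, hα]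
    rw [hα] at ih
    exact (mul_le_mul_of_nonneg_left ih (by positivity)).trans h4

end Empirical

/-! ### Recovery of the distribution -/

section Distribution

variable {n m : ℕ} {P : Config n → ℝ}

/-- A bound on the exponential moments of the errors in the predicted log-odds. -/
def countDevMoment (P : Config n → ℝ) (N : Fin n → Finset (Fin n)) (l : ℝ)
    (s : Fin m → Config n) : ℝ :=
  ∑ x, ∑ i, ∑ y, (P x * (1 / (n : ℝ)) * noiseKernel i x y) *
    (1 / 2 * (exp (l * |countDev P s (insert i (N i)) y|) +
      exp (l * |countDev P s (insert i (N i)) (flipAt i y)|)))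

theorem sampleExp_countDevMoment_le (hP : ∀ x, 0 < P x) (h1 : ∑ x, P x = 1) (hm : 0 < m)
    (hn : 0 < n) (N : Fin n → Finset (Fin n)) {l q : ℝ} (hl : 0 ≤ l) (hlq : l ≤ q)
    (hq : ∀ i x, q ≤ m * marg P (insert i (N i)) x) (hq0 : 0 < q) :
    sampleExp P m (countDevMoment P N l) ≤ 2 * exp (l ^ 2 / q) := by
  have hn' : (0 : ℝ) < n := by exact_mod_cast hn
  have hcell : ∀ i y, sampleExp P m (fun s => exp (l * |countDev P s (insert i (N i)) y|)) ≤
      2 * exp (l ^ 2 / q) := fun i y =>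
    (sampleExp_exp_abs_countDev_le hP h1 hm _ y hl (hlq.trans (hq i y))).trans
      (mul_le_mul_of_nonneg_left (Real.exp_le_exp.2
        (div_le_div_of_nonneg_left (sq_nonneg l) hq0 (hq i y))) two_pos.le)
  unfold countDevMoment
  simp only [sampleExp_sum, sampleExp_const_mul, sampleExp_add]
  have hw : ∑ x, ∑ i, ∑ y, P x * (1 / (n : ℝ)) * noiseKernel i x y = 1 := by
    simp only [← Finset.mul_sum, sum_noiseKernel]
    simp only [Finset.sum_const, Finset.card_univ, Fintype.card_fin, nsmul_eq_mul, mul_one,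
      ← Finset.sum_mul, h1]
    field_simp
  calc _ ≤ ∑ x, ∑ i, ∑ y, P x * (1 / (n : ℝ)) * noiseKernel i x y * (2 * exp (l ^ 2 / q)) := by
        refine Finset.sum_le_sum fun x _ => Finset.sum_le_sum fun i _ =>
          Finset.sum_le_sum fun y _ => mul_le_mul_of_nonneg_left ?_
            (mul_nonneg (mul_nonneg (hP x).le (by positivity)) (noiseKernel_nonneg i x y))
        linarith [hcell i y, hcell i (flipAt i y)]
    _ = 2 * exp (l ^ 2 / q) := by simp only [← Finset.sum_mul, hw, one_mul]

theorem sum_exp_logDensityError_le (hP : ∀ x, 0 < P x) (hm : 0 < m) (hn : 0 < n)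
    {N : Fin n → Finset (Fin n)} (hsep : ∀ i, Separates P i (N i)) {s : Fin m → Config n}
    (hs : ∀ i x, |countDev P s (insert i (N i)) x| ≤ 1 / 2) {l : ℝ} (hl : 0 ≤ l) :
    ∑ x, P x * exp (l * |logDensityError P (fun i => empCondExp s (N i) i) x|) ≤
      countDevMoment P N (2 * (l * n)) s := by
  refine Finset.sum_le_sum fun x _ => ?_
  refine (mul_le_mul_of_nonneg_left (exp_mul_abs_logDensityError_le hn _ hl x) (hP x).le).trans ?_
  simp only [Finset.mul_sum]
  refine Finset.sum_le_sum fun i _ => Finset.sum_le_sum fun y _ => ?_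
  have hw : 0 ≤ P x * (1 / (n : ℝ)) * noiseKernel i x y :=
    mul_nonneg (mul_nonneg (hP x).le (by positivity)) (noiseKernel_nonneg i x y)
  have hln : 0 ≤ l * n := by positivity
  refine le_trans (le_of_eq (by ring)) (mul_le_mul_of_nonneg_left
    (a := P x * (1 / (n : ℝ)) * noiseKernel i x y)
    (b := exp (l * n * |artanh (empCondExp s (N i) i y) - logit P (univ.erase i) i y|)) ?_ hw)
  rw [logit_eq_of_separates hP (hsep i)]
  have h1 := abs_artanh_empCondExp_sub_logit_le hP hm (hsep i).1 (hs i y) (hs i (flipAt i y))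
  set r := |countDev P s (insert i (N i)) y|
  set r' := |countDev P s (insert i (N i)) (flipAt i y)|
  calc exp (l * n * |artanh (empCondExp s (N i) i y) - logit P (N i) i y|)
      ≤ exp (l * n * r) * exp (l * n * r') := by
        rw [← Real.exp_add, ← mul_add]
        exact Real.exp_le_exp.2 (mul_le_mul_of_nonneg_left h1 hln)
    _ ≤ 1 / 2 * (exp (l * n * r) ^ 2 + exp (l * n * r') ^ 2) := by
        nlinarith [sq_nonneg (exp (l * n * r) - exp (l * n * r'))]
    _ = _ := by
        rw [← Real.exp_nat_mul, ← Real.exp_nat_mul]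
        push_cast
        ring_nf

theorem tvDist_le_of_countDevMoment_le (hP : ∀ x, 0 < P x) (h1 : ∑ x, P x = 1) (hm : 0 < m)
    (hn : 0 < n) {N : Fin n → Finset (Fin n)} (hsep : ∀ i, Separates P i (N i))
    {s : Fin m → Config n} (hs : ∀ i x, |countDev P s (insert i (N i)) x| ≤ 1 / 2)
    {l eps : ℝ} (hl : 1 ≤ l) (heps : 0 < eps) (heps1 : eps ≤ 1)
    (hmom : countDevMoment P N (2 * (l * n)) s ≤ exp (l * (eps / 4))) :
    tvDist (distributionFromStructure s N) P ≤ eps := by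
  set Δ := logDensityError P (fun i => empCondExp s (N i) i) with hΔ
  have h2 := (sum_exp_logDensityError_le hP hm hn hsep hs (by linarith : 0 ≤ l)).trans hmom
  have h3 : (∑ x, P x * exp |Δ x|) ^ l ≤ exp (l * (eps / 4)) := by
    refine (Real.rpow_arith_mean_le_arith_mean_rpow univ P (fun x => exp |Δ x|)
      (fun x _ => (hP x).le) h1 (fun x _ => (Real.exp_pos _).le) hl).trans
      (le_trans (le_of_eq ?_) h2)
    refine Finset.sum_congr rfl fun x _ => ?_
    rw [← Real.exp_mul, mul_comm |Δ x| l]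
  have h4 : ∑ x, P x * exp |Δ x| ≤ exp (eps / 4) := by
    rw [mul_comm, Real.exp_mul] at h3
    exact (Real.rpow_le_rpow_iff (Finset.sum_nonneg fun x _ =>
      mul_nonneg (hP x).le (Real.exp_pos _).le) (Real.exp_pos _).le (by linarith)).1 h3
  have h5 : exp (eps / 4) ≤ 1 + eps / 2 := by
    have := (abs_le.1 (Real.abs_exp_sub_one_sub_id_le (x := eps / 4)
      (by rw [abs_of_pos (by positivity)]; linarith))).2
    nlinarith
  obtain ⟨c, hc, hw⟩ := exists_mrfWeight_eq hP (N := N) (f := fun i => empCondExp s (N i) i)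
    fun i x y hxy => empCondExp_congr s hxy
  have := tvDist_le_of_exp_moment hP h1 hc hw (h4.trans h5) (by linarith)
  rw [show 2 * (eps / 2) = eps by ring] at this
  exact this

/-- With high probability, the run of the distribution recovery on the correct structure is well
defined and accurate. -/
theorem sampleProb_distribution_le (hP : ∀ x, 0 < P x) (h1 : ∑ x, P x = 1) (hm : 0 < m)
    (hn : 0 < n) {N : Fin n → Finset (Fin n)} (hsep : ∀ i, Separates P i (N i))
    {Lam eps del : ℝ} {d : ℕ} (hL : ∀ i x, |logit P (univ.erase i) i x| ≤ Lam)
    (hd : ∀ i, (N i).card ≤ d) (heps : 0 < eps) (heps1 : eps ≤ 1) (hdel : 0 < del)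
    (hdel1 : del < 1) (hdn : 2 * del ≤ n)
    (hmC : 1024 * ((n : ℝ) ^ 2 * (2 / (1 - tanh Lam)) ^ (d + 1) * log (n / del) / eps ^ 4) ≤ m) :
    sampleProb P m {s | ¬ (WellDefinedRun s N ∧ tvDist (distributionFromStructure s N) P ≤ eps)} ≤
      del / 2 := by
  have hP' : ∀ x, 0 ≤ P x := fun x => (hP x).le
  have hn1 : (1 : ℝ) ≤ n := by exact_mod_cast hn
  have hm' : (0 : ℝ) < m := by exact_mod_cast hm
  set L := log (n / del) with hLdef
  have hnd : 2 ≤ n / del := by rw [le_div_iff₀ hdel]; exact hdn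
  have hexpL : exp L = n / del := Real.exp_log (by linarith)
  have hL2 : log 2 ≤ L := Real.log_le_log two_pos hnd
  have hL0 : 0 < L := lt_of_lt_of_le (Real.log_pos (by norm_num)) hL2
  set q := 1024 * ((n : ℝ) ^ 2 * L / eps ^ 4) with hqdef
  have hq0 : 0 < q := by positivity
  have hα0 : 0 < (1 - tanh Lam) / 2 := by linarith [Real.tanh_lt_one Lam]
  have hα1 : (1 - tanh Lam) / 2 ≤ 1 := by linarith [Real.neg_one_lt_tanh Lam]
  have hq : ∀ i x, q ≤ m * marg P (insert i (N i)) x := by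
    intro i x
    have h2 : ((1 - tanh Lam) / 2) ^ (d + 1) ≤ marg P (insert i (N i)) x := by
      refine le_trans (pow_le_pow_of_le_one hα0.le hα1 ?_) (pow_card_le_marg hP h1 hL _ x)
      exact (Finset.card_insert_le _ _).trans (by have := hd i; omega)
    have h3 : q = 1024 * ((n : ℝ) ^ 2 * (2 / (1 - tanh Lam)) ^ (d + 1) * L / eps ^ 4) *
        ((1 - tanh Lam) / 2) ^ (d + 1) := by
      have : (2 / (1 - tanh Lam)) ^ (d + 1) * ((1 - tanh Lam) / 2) ^ (d + 1) = 1 := by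
        rw [← mul_pow, div_mul_div_comm, mul_comm, div_self (by
          have : 1 - tanh Lam ≠ 0 := by linarith [Real.tanh_lt_one Lam]
          positivity), one_pow]
      rw [hqdef]
      linear_combination (-1024 * ((n : ℝ) ^ 2 * L / eps ^ 4)) * this
    rw [h3]
    exact mul_le_mul hmC h2 (by positivity) hm'.le
  set l := 32 * L / eps ^ 2 with hl
  have heps2 : eps ^ 2 ≤ 1 := pow_le_one₀ heps.le heps1
  have hl1 : 1 ≤ l := by
    rw [hl, le_div_iff₀ (by positivity)]
    linarith [Real.log_two_gt_d9]
  have hlq : 2 * (l * n) ≤ q := by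
    rw [hl, hqdef]
    have e : 1024 * ((n : ℝ) ^ 2 * L / eps ^ 4) =
        (1024 * (n : ℝ) ^ 2 / eps ^ 2) * (L / eps ^ 2) := by field_simp
    have e2 : 2 * (32 * L / eps ^ 2 * n) = (64 * n) * (L / eps ^ 2) := by ring
    rw [e, e2]
    apply mul_le_mul_of_nonneg_right _ (by positivity)
    rw [le_div_iff₀ (by positivity)]
    nlinarith
  have hl2q : (2 * (l * n)) ^ 2 / q = 4 * L := by
    rw [hl, hqdef]; field_simp; norm_num
  let Q : Fin n × Config n → (Fin m → Config n) → Prop := fun a s =>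
    1 / 2 < |countDev P s (insert a.1 (N a.1)) a.2|
  have hB1 : sampleProb P m {s | ∃ a ∈ (univ : Finset (Fin n × Config n)), Q a s} ≤ del / 4 := by
    have hcell : ∀ a ∈ (univ : Finset (Fin n × Config n)),
        sampleProb P m {s | Q a s} ≤ 2 * exp (-(q / 16)) := by
      intro a _
      refine (sampleProb_abs_countDev_gt_le hP h1 hm _ a.2).trans ?_
      have := hq a.1 a.2
      exact mul_le_mul_of_nonneg_left (Real.exp_le_exp.2 (by linarith)) two_pos.le
    refine (sampleProb_exists_le hP' univ Q hcell).trans ?_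
    have hcard : ((univ : Finset (Fin n × Config n)).card : ℝ) = n * 2 ^ n := by
      rw [Finset.card_univ, Fintype.card_prod, Nat.cast_mul, card_config, Fintype.card_fin]
    have h2n : (2 : ℝ) ^ (n + 3) ≤ exp ((n + 3) * L) := by
      rw [← Real.exp_log two_pos, ← Real.exp_nat_mul]
      refine Real.exp_le_exp.2 ?_
      push_cast
      gcongr
    have hqL : (n + 4) * L ≤ q / 16 := by
      have h4 : (n : ℝ) ^ 2 * L ≤ (n : ℝ) ^ 2 * L / eps ^ 4 := by
        rw [le_div_iff₀ (by positivity)]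
        exact mul_le_of_le_one_right (by positivity) (pow_le_one₀ heps.le heps1)
      have h5 : (n + 4 : ℝ) ≤ 64 * n ^ 2 := by nlinarith
      have h6 := mul_le_mul_of_nonneg_right h5 hL0.le
      rw [hqdef]
      linarith
    rw [hcard]
    calc n * 2 ^ n * (2 * exp (-(q / 16)))
        = del / 4 * ((n / del) * 2 ^ (n + 3) * exp (-(q / 16))) := by
          rw [pow_add]; field_simp; norm_num
      _ ≤ del / 4 * (exp L * exp ((n + 3) * L) * exp (-((n + 4) * L))) := by
          rw [hexpL]
          gcongr
      _ = del / 4 := by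
          rw [← Real.exp_add, ← Real.exp_add]
          ring_nf
          simp
  have hmom0 : ∀ s : Fin m → Config n, 0 ≤ countDevMoment P N (2 * (l * n)) s := fun s =>
    Finset.sum_nonneg fun x _ => Finset.sum_nonneg fun i _ => Finset.sum_nonneg fun y _ =>
      mul_nonneg (mul_nonneg (mul_nonneg (hP' x) (by positivity)) (noiseKernel_nonneg i x y))
        (by positivity)
  have hB2 : sampleProb P m {s | 8 * exp (4 * L) / del < countDevMoment P N (2 * (l * n)) s} ≤
      del / 4 := by
    refine (sampleProb_lt_le_div hP' hmom0 (by positivity)).trans ?_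
    have h3 := sampleExp_countDevMoment_le hP h1 hm hn N (by positivity) hlq hq hq0
    rw [hl2q] at h3
    rw [div_le_iff₀ (by positivity)]
    refine h3.trans (le_of_eq ?_)
    field_simp
    norm_num
  have h8 : 8 * exp (4 * L) / del ≤ exp (l * (eps / 4)) := by
    have e1 : exp (4 * L) = (n / del) ^ 4 := by
      rw [← hexpL, ← Real.exp_nat_mul]; norm_num
    have e2 : 8 / del ≤ (n / del) ^ 4 := by
      have h5 : 1 / del ≤ n / del := by gcongr
      have h6 : (2 : ℝ) ^ 3 ≤ (n / del) ^ 3 := pow_le_pow_left₀ two_pos.le hnd 3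
      calc 8 / del = 2 ^ 3 * (1 / del) := by ring
        _ ≤ (n / del) ^ 3 * (n / del) := by gcongr
        _ = _ := by ring
    have e3 : 8 * L ≤ l * (eps / 4) := by
      rw [hl]
      have : 32 * L / eps ^ 2 * (eps / 4) = 8 * L / eps := by field_simp; norm_num
      rw [this, le_div_iff₀ heps]
      nlinarith
    calc 8 * exp (4 * L) / del = 8 / del * exp (4 * L) := by ring
      _ ≤ exp (4 * L) * exp (4 * L) := by
          apply mul_le_mul_of_nonneg_right _ (Real.exp_pos _).le
          rw [e1]; exact e2
      _ = exp (8 * L) := by rw [← Real.exp_add]; ring_nf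
      _ ≤ _ := Real.exp_le_exp.2 e3
  have hsub : {s : Fin m → Config n | ¬ (WellDefinedRun s N ∧
      tvDist (distributionFromStructure s N) P ≤ eps)} ⊆
      {s | ∃ a ∈ (univ : Finset (Fin n × Config n)), Q a s} ∪
      {s | 8 * exp (4 * L) / del < countDevMoment P N (2 * (l * n)) s} := by
    intro s hs
    by_contra hc
    rw [Set.mem_union, not_or] at hc
    have hdev : ∀ i x, |countDev P s (insert i (N i)) x| ≤ 1 / 2 := by
      intro i x
      by_contra h
      exact hc.1 ⟨(i, x), Finset.mem_univ _, not_le.1 h⟩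
    have hmo : countDevMoment P N (2 * (l * n)) s ≤ 8 * exp (4 * L) / del := by
      by_contra h
      exact hc.2 (not_le.1 h)
    exact hs ⟨wellDefinedRun_of_abs_countDev_le (fun i => (hsep i).1) hdev,
      tvDist_le_of_countDevMoment_le hP h1 hm hn hsep hdev hl1 heps heps1 (hmo.trans h8)⟩
  have h9 := sampleProb_mono hP' hsub
  have h10 := sampleProb_union_le hP'
    {s : Fin m → Config n | ∃ a ∈ (univ : Finset (Fin n × Config n)), Q a s}
    {s | 8 * exp (4 * L) / del < countDevMoment P N (2 * (l * n)) s}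
  linarith

end Distribution

end

theorem mainTheorem7 :
    ∃ (c C : ℝ) (K : ℕ), 0 < c ∧ 0 < C ∧
      ∀ (n nh : ℕ) (M : RBM n nh) (lam1 lam2 Lam eta eps del : ℝ) (d2 m : ℕ)
        (N : Fin n → Finset (Fin n)),
        2 ≤ lam2 → 0 < eta → 0 < eps → eps ≤ 1 → 0 < del → 2 * del ≤ (n : ℝ) →
        M.IsBounded lam1 lam2 →
        (∀ i, (∑ j, |M.W i j|) + |M.b1 i| ≤ Lam) →
        (∀ i, IsMarkovBlanket M.law i (N i)) →
        (∀ i, ∀ j ∈ N i, Nondegenerate M.law eta i j) →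
        (∀ i, (N i).card ≤ d2) →
        C * (lam2 ^ (K * regDegree c lam1 lam2 eta) * Real.log (2 * n / del)
            + (n : ℝ) ^ 2 * (2 / (1 - Real.tanh Lam)) ^ (d2 + 1) * Real.log (n / del) / eps ^ 4)
          ≤ (m : ℝ) →
        1 - del ≤ sampleProb M.law m
          {s | recoveredNbhd s lam1 lam2 eta (regDegree c lam1 lam2 eta) = N ∧
               WellDefinedRun s (recoveredNbhd s lam1 lam2 eta (regDegree c lam1 lam2 eta)) ∧
               tvDist (distributionFromStructure s
                 (recoveredNbhd s lam1 lam2 eta (regDegree c lam1 lam2 eta))) M.law ≤ eps} := by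
  refine ⟨100, 32000000, 31, by norm_num, by norm_num, ?_⟩
  intro n nh M lam1 lam2 Lam eta eps del d2 m N hlam heta heps heps1 hdel hdn hM hLam hN hnd hd hm
  have hP := M.law_pos
  have hP' : ∀ x, 0 ≤ M.law x := fun x => (hP x).le
  have h1 := M.sum_law
  have hsep : ∀ i, Separates M.law i (N i) := fun i => (hN i).prop
  rcases le_or_gt 1 del with hdel1 | hdel1
  · exact le_trans (by linarith) (sampleProb_nonneg hP' _)
  have hnR : (0 : ℝ) < n := by linarith
  have hn : 0 < n := by exact_mod_cast hnR
  have hl : 0 < lam2 := by linarith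
  have hlog : 0 < Real.log (n / del) :=
    Real.log_pos (by rw [lt_div_iff₀ hdel]; linarith)
  have hlog2 : 0 < Real.log (2 * n / del) :=
    Real.log_pos (by rw [lt_div_iff₀ hdel]; linarith)
  have ht : 0 < 1 - Real.tanh Lam := by linarith [Real.tanh_lt_one Lam]
  set D := regDegree 100 lam1 lam2 eta with hD
  have hA : 0 < lam2 ^ (31 * D) * Real.log (2 * n / del) := by positivity
  have hB : 0 < (n : ℝ) ^ 2 * (2 / (1 - Real.tanh Lam)) ^ (d2 + 1) * Real.log (n / del) /
      eps ^ 4 := by positivity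
  have hm0 : 0 < m := by
    have : (0 : ℝ) < m := by linarith
    exact_mod_cast this
  have hstruct := hM.sampleProb_recoveredNbhd_ne_le hlam heta hn hdel hdel1 hdn hsep hnd hm0
    (by linarith)
  have hdist := sampleProb_distribution_le hP h1 hm0 hn hsep
    (fun i x => (M.abs_logit_law_le i x).trans (hLam i)) hd heps heps1 hdel hdel1 hdn
    (by linarith)
  refine le_trans ?_ (one_sub_sampleProb_compl_le hP' h1 _)
  have hU := sampleProb_union_le hP' {s : Fin m → Config n | recoveredNbhd s lam1 lam2 eta D ≠ N}
    {s | ¬ (WellDefinedRun s N ∧ tvDist (distributionFromStructure s N) M.law ≤ eps)}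
  have hsub := sampleProb_mono hP' (m := m)
    (E := {s | recoveredNbhd s lam1 lam2 eta D = N ∧
               WellDefinedRun s (recoveredNbhd s lam1 lam2 eta D) ∧
               tvDist (distributionFromStructure s
                 (recoveredNbhd s lam1 lam2 eta D)) M.law ≤ eps}ᶜ)
    (G := {s : Fin m → Config n | recoveredNbhd s lam1 lam2 eta D ≠ N} ∪
      {s | ¬ (WellDefinedRun s N ∧ tvDist (distributionFromStructure s N) M.law ≤ eps)})
    (by
      intro s hs
      by_contra hc
      rw [Set.mem_union, not_or] at hc
      have e : recoveredNbhd s lam1 lam2 eta D = N := not_not.1 hc.1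
      refine hs ⟨e, ?_⟩
      rw [e]
      exact not_not.1 hc.2)
  linarith
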